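/- Let $(G,H,t,\alpha)$ be a smooth crossed module of finite-dimensional Lie groups: $t\colon H\to G$ is a smooth homomorphism, $\alpha\colon G\to\mathrm{Aut}(H)$ is a smooth action, $t(\alpha_g h)=g\,t(h)\,g^{-1}$ and $\alpha_{t(h)}h'=hh'h^{-1}$. Let $\mathcal G=(G\ltimes H\rightrightarrows G)$ be the associated 2-group, in which $(g,h)\colon g\to t(h)g$. A $\mathcal G$-2-torsor is a groupoid $\mathcal X_1\rightrightarrows\mathcal X_0$ with a functorial right $\mathcal G$-action that is free and transitive on objects and on morphisms; 1-morphisms are equivariant functors and 2-morphisms are natural transformations $\eta$ with $\eta(p\cdot g)=\eta(p)\cdot\mathrm{id}_g$. For $x,y\in\mathcal X_i$ let $y:x$ be the unique element with $x\cdot(y:x)=y$. Let $M$ be a smooth manifold and let $\mathscr F$ be a transport 2-functor on $M$: a strict 2-functor, with values $\mathrm{tra}(\gamma)$ on paths and $\mathrm{tra}^2(\Sigma)$ on bigons, from the thin fundamental 2-groupoid $\Pi_2^{\rm thin}(M)$ (points; paths modulo homotopies of rank $\le 1$; bigons modulo homotopies of rank $\le 2$) to the 2-category of $\mathcal G$-2-torsors,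 such that for all $x,y\in M$ and $p\in\mathscr F(x)_0$ the element $\mathrm{tra}(\gamma)(p):p\in G$ depends smoothly on the loop $\gamma$ at $x$, and the element $\mathrm{tra}^2(\Sigma)(p):\mathrm{id}_{\mathrm{tra}(\gamma)(p)}\in H$ depends smoothly on the bigon $\Sigma\colon\gamma\Rightarrow\gamma'$ between paths from $x$ to $y$ (smoothness meaning: along all smooth finite-dimensional families). Then $P=\bigsqcup_{x\in M}\mathscr F(x)_0$ carries the structure of a smooth principal $G$-bundle $\pi\colon P\to M$ for which $\mathrm{tra}(\gamma)(p)$ depends smoothly on $\gamma$ for paths $\gamma$ starting at a fixed point, and for every such structure the following holds. 1. There is a unique $\mathfrak g$-valued 1-form $A$ on $P$ such that $A(c'(0))=\left.\frac{d}{dt}\right|_{0}\big(\mathrm{tra}(\gamma_t)^{-1}(c(t)):c(0)\big)$ for all smooth curves $c$ in $P$, where $\gamma_t(v)=\pi(c(tv))$; it is a smooth connection form on $P$. 2. For $s,t$ let $\Gamma(s,t)$ be the canonical bigon in the plane from the path $(0,0)\to(0,t)\to(s,t)$ to the path $(0,0)\to(s,0)\to(s,t)$ that fills the rectangle between them. There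 is a unique $\mathfrak h$-valued 2-form $B$ on $P$ such that, for every smooth map $\Sigma$ from the plane to $P$, with $X=\partial_s\Sigma(0,0)$ and $Y=\partial_t\Sigma(0,0)$, $$B(X,Y)=\left.\frac{\partial^2}{\partial s\,\partial t}\right|_{(0,0)}\mathrm{tra}^2(\pi_*\Sigma_*\Gamma(s,t))^{-1}(\Sigma(s,t)):\mathrm{id}_{\mathrm{tra}(\sigma(s,t))^{-1}(\Sigma(s,t))},$$ where $\sigma(s,t)$ is the source path of $\pi_*\Sigma_*\Gamma(s,t)$, the inverse of $\mathrm{tra}^2$ is the inverse for horizontal composition, and the expression that is differentiated takes values in $H$ and is $1$ for $t=0$. In particular the right-hand side depends on $\Sigma$ only through $X$ and $Y$. 3. $B$ is smooth, i.e. $B\in\Omega^2(P,\mathfrak h)$. 4. $B$ is fake-flat: $t_*B=F_A$, where $F_A=dA+\frac12[A\wedge A]$ is the curvature of $A$. 5. $R_g^*B=(\alpha_g^{-1})_*B$ for every smooth map $g\colon P\to G$, in particular for every equivariant one and every constant one, where $R_g(p)=p\cdot g(p)$ and $(\alpha_{g})_*\colon\mathfrak h\to\mathfrak h$ is the derivative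 of $\alpha_{g(p)}\colon H\to H$ at $1$, for each $p$. -/

import Mathlib

open scoped Manifold ContDiff

noncomputable section

universe w

/-! ### Smooth crossed modules (strict Lie 2-groups) -/

/-- A smooth crossed module `(G, H, t, α)` of Lie groups `G`, `H`. -/
structure SmoothCrossedModule
    (EG : Type*) [NormedAddCommGroup EG] [NormedSpace ℝ EG]
    (EH : Type*) [NormedAddCommGroup EH] [NormedSpace ℝ EH]
    (G : Type*) [TopologicalSpace G] [ChartedSpace EG G] [Group G] [LieGroup 𝓘(ℝ, EG) ∞ G]
    (H : Type*) [TopologicalSpace H] [ChartedSpace EH H] [Group H] [LieGroup 𝓘(ℝ, EH) ∞ H] where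
  t : H →* G
  t_smooth : ContMDiff 𝓘(ℝ, EH) 𝓘(ℝ, EG) ∞ t
  α : G →* MulAut H
  α_smooth : ContMDiff (𝓘(ℝ, EG).prod 𝓘(ℝ, EH)) 𝓘(ℝ, EH) ∞ (fun x : G × H => α x.1 x.2)
  t_α : ∀ g h, t (α g h) = g * t h * g⁻¹
  α_t : ∀ h h', α (t h) h' = h * h' * h⁻¹

section CrossedModule

variable {EG : Type*} [NormedAddCommGroup EG] [NormedSpace ℝ EG]
  {EH : Type*} [NormedAddCommGroup EH] [NormedSpace ℝ EH]
  {G : Type*} [TopologicalSpace G] [ChartedSpace EG G] [Group G] [LieGroup 𝓘(ℝ, EG) ∞ G]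
  {H : Type*} [TopologicalSpace H] [ChartedSpace EH H] [Group H] [LieGroup 𝓘(ℝ, EH) ∞ H]

/-- The derivative `t_* : 𝔥 → 𝔤` of `t` at the identity (recall `t 1 = 1`). -/
def SmoothCrossedModule.tStar (C : SmoothCrossedModule EG EH G H)
    (ξ : GroupLieAlgebra 𝓘(ℝ, EH) H) : GroupLieAlgebra 𝓘(ℝ, EG) G :=
  (mfderiv 𝓘(ℝ, EH) 𝓘(ℝ, EG) C.t 1 ξ : TangentSpace 𝓘(ℝ, EG) (C.t 1))

/-- The derivative `(α_g)_* : 𝔥 → 𝔥` of `α g` at the identity (recall `α g 1 = 1`). -/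
def SmoothCrossedModule.αStar (C : SmoothCrossedModule EG EH G H) (g : G)
    (ξ : GroupLieAlgebra 𝓘(ℝ, EH) H) : GroupLieAlgebra 𝓘(ℝ, EH) H :=
  (mfderiv 𝓘(ℝ, EH) 𝓘(ℝ, EH) (fun h => C.α g h) 1 ξ : TangentSpace 𝓘(ℝ, EH) (C.α g 1))

/-- The adjoint action `Ad_g : 𝔤 → 𝔤`, the derivative of conjugation at the identity. -/
def lieAd (g : G) (ξ : GroupLieAlgebra 𝓘(ℝ, EG) G) : GroupLieAlgebra 𝓘(ℝ, EG) G :=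
  (mfderiv 𝓘(ℝ, EG) 𝓘(ℝ, EG) (fun a => g * a * g⁻¹) 1 ξ : TangentSpace 𝓘(ℝ, EG) (g * 1 * g⁻¹))

/-! ### 2-torsors -/

/-- A 2-torsor for the 2-group `G ⋉ H ⇉ G` of a crossed module: a groupoid `X₁ ⇉ X₀` with a
functorial right action of the 2-group which is free and transitive on objects and on morphisms.
The group of morphisms of the 2-group is the semidirect product, with elements
`⟨h, g⟩ : g ⟶ t h * g`, and composition `⟨h', t h * g⟩ ∘ ⟨h, g⟩ = ⟨h' * h, g⟩`.
`comp x y` is `x` followed by `y`, that is `y ∘ x`.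

The smooth structures of `X₀` and `X₁` are not separate data: they are those carried over from `G`
and `H ⋊ G` along the orbit maps, which do not depend on the base points, and for which the
structure maps of the groupoid, the action, and all equivariant maps are smooth. -/
structure TwoTorsor (C : SmoothCrossedModule EG EH G H) where
  X₀ : Type w
  X₁ : Type w
  src : X₁ → X₀
  tgt : X₁ → X₀
  ident : X₀ → X₁
  comp : (x y : X₁) → tgt x = src y → X₁
  src_ident : ∀ p, src (ident p) = p
  tgt_ident : ∀ p, tgt (ident p) = p
  src_comp : ∀ x y h, src (comp x y h) = src x
  tgt_comp : ∀ x y h, tgt (comp x y h) = tgt y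
  ident_comp : ∀ x, comp (ident (src x)) x (tgt_ident _) = x
  comp_ident : ∀ x, comp x (ident (tgt x)) (src_ident _).symm = x
  comp_assoc : ∀ x y z h h', comp (comp x y h) z ((tgt_comp x y h).trans h') =
    comp x (comp y z h') (h.trans (src_comp y z h').symm)
  exists_inv : ∀ x, ∃ (y : X₁) (h : tgt x = src y) (h' : tgt y = src x),
    comp x y h = ident (src x) ∧ comp y x h' = ident (tgt x)
  act₀ : X₀ → G → X₀
  act₁ : X₁ → H ⋊[C.α] G → X₁
  act₀_one : ∀ p, act₀ p 1 = p
  act₀_mul : ∀ p g g', act₀ p (g * g') = act₀ (act₀ p g) g'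
  act₁_one : ∀ x, act₁ x 1 = x
  act₁_mul : ∀ x k k', act₁ x (k * k') = act₁ (act₁ x k) k'
  src_act : ∀ x k, src (act₁ x k) = act₀ (src x) k.right
  tgt_act : ∀ x k, tgt (act₁ x k) = act₀ (tgt x) (C.t k.left * k.right)
  ident_act : ∀ p g, ident (act₀ p g) = act₁ (ident p) ⟨1, g⟩
  comp_act : ∀ x y (hxy : tgt x = src y) (g : G) (h h' : H)
    (hc : tgt (act₁ x ⟨h, g⟩) = src (act₁ y ⟨h', C.t h * g⟩)),
    comp (act₁ x ⟨h, g⟩) (act₁ y ⟨h', C.t h * g⟩) hc = act₁ (comp x y hxy) ⟨h' * h, g⟩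
  nonempty : Nonempty X₀
  free_transitive₀ : ∀ p q : X₀, ∃! g : G, act₀ p g = q
  free_transitive₁ : ∀ x y : X₁, ∃! k : H ⋊[C.α] G, act₁ x k = y

namespace TwoTorsor

variable {C : SmoothCrossedModule EG EH G H}

/-- Division of objects: `X.div q p` is `q : p`, the unique `g` with `p · g = q`. -/
def div (X : TwoTorsor C) (q p : X.X₀) : G := (X.free_transitive₀ p q).choose

/-- Division of morphisms: `X.div₁ y x` is `y : x`, the unique `k` with `x · k = y`. -/
def div₁ (X : TwoTorsor C) (y x : X.X₁) : H ⋊[C.α] G := (X.free_transitive₁ x y).choose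

/-- The quotient `x : id_{s(x)}` of a morphism by the identity at its source. Its `G`-component
is `1`, so it is the element of `H` given here. -/
def hdiv (X : TwoTorsor C) (x : X.X₁) : H := (X.div₁ x (X.ident (X.src x))).left

/-- 1-morphisms of 2-torsors: equivariant functors. -/
@[ext]
structure Hom (X Y : TwoTorsor C) where
  map₀ : X.X₀ → Y.X₀
  map₁ : X.X₁ → Y.X₁
  src_map : ∀ x, Y.src (map₁ x) = map₀ (X.src x)
  tgt_map : ∀ x, Y.tgt (map₁ x) = map₀ (X.tgt x)
  map_ident : ∀ p, map₁ (X.ident p) = Y.ident (map₀ p)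
  map_comp : ∀ x y h, map₁ (X.comp x y h) =
    Y.comp (map₁ x) (map₁ y) ((tgt_map x).trans ((congrArg map₀ h).trans (src_map y).symm))
  map₀_act : ∀ p g, map₀ (X.act₀ p g) = Y.act₀ (map₀ p) g
  map₁_act : ∀ x k, map₁ (X.act₁ x k) = Y.act₁ (map₁ x) k

/-- The identity 1-morphism. -/
def Hom.id (X : TwoTorsor C) : Hom X X where
  map₀ p := p
  map₁ x := x
  src_map _ := rfl
  tgt_map _ := rfl
  map_ident _ := rfl
  map_comp _ _ _ := rfl
  map₀_act _ _ := rfl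
  map₁_act _ _ := rfl

/-- Composition of 1-morphisms: `f` followed by `f'`. -/
def Hom.comp {X Y Z : TwoTorsor C} (f : Hom X Y) (f' : Hom Y Z) : Hom X Z where
  map₀ p := f'.map₀ (f.map₀ p)
  map₁ x := f'.map₁ (f.map₁ x)
  src_map x := by rw [f'.src_map, f.src_map]
  tgt_map x := by rw [f'.tgt_map, f.tgt_map]
  map_ident p := by rw [f.map_ident, f'.map_ident]
  map_comp x y h := by rw [← f'.map_comp]; congr 1; exact f.map_comp x y h
  map₀_act p g := by rw [f.map₀_act, f'.map₀_act]
  map₁_act x k := by rw [f.map₁_act, f'.map₁_act]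

/-- 2-morphisms `f ⇒ f'` of 2-torsors: equivariant natural transformations. -/
@[ext]
structure TwoHom {X Y : TwoTorsor C} (f f' : Hom X Y) where
  app : X.X₀ → Y.X₁
  src_app : ∀ p, Y.src (app p) = f.map₀ p
  tgt_app : ∀ p, Y.tgt (app p) = f'.map₀ p
  natural : ∀ x : X.X₁,
    Y.comp (f.map₁ x) (app (X.tgt x)) ((f.tgt_map x).trans (src_app _).symm) =
      Y.comp (app (X.src x)) (f'.map₁ x) ((tgt_app _).trans (f'.src_map x).symm)
  equivariant : ∀ p g, app (X.act₀ p g) = Y.act₁ (app p) ⟨1, g⟩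

/-- The identity 2-morphism. -/
def TwoHom.id {X Y : TwoTorsor C} (f : Hom X Y) : TwoHom f f where
  app p := Y.ident (f.map₀ p)
  src_app p := Y.src_ident _
  tgt_app p := Y.tgt_ident _
  natural x := by
    have h1 := Y.comp_ident (f.map₁ x)
    have h2 := Y.ident_comp (f.map₁ x)
    simp only [f.tgt_map] at h1
    simp only [f.src_map] at h2
    rw [h1, h2]
  equivariant p g := by rw [f.map₀_act, Y.ident_act]

/-- The components `η'(p) ∘ η(p)` of the vertical composition `η' • η`. -/
def TwoHom.vcompApp {X Y : TwoTorsor C} {f f' f'' : Hom X Y} (η : TwoHom f f')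
    (η' : TwoHom f' f'') (p : X.X₀) : Y.X₁ :=
  Y.comp (η.app p) (η'.app p) ((η.tgt_app p).trans (η'.src_app p).symm)

/-- The components `η'(f'(p)) ∘ k(η(p))` of the horizontal composition `η' ∘ η` of
`η : f ⇒ f'` and `η' : k ⇒ k'`. -/
def TwoHom.hcompApp {X Y Z : TwoTorsor C} {f f' : Hom X Y} {k k' : Hom Y Z} (η : TwoHom f f')
    (η' : TwoHom k k') (p : X.X₀) : Z.X₁ :=
  Z.comp (k.map₁ (η.app p)) (η'.app (f'.map₀ p))
    ((k.tgt_map _).trans ((congrArg k.map₀ (η.tgt_app p)).trans (η'.src_app _).symm))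

end TwoTorsor

end CrossedModule

/-! ### Paths, bigons and thin homotopies

A path `[0,1] → M` with sitting instants extends to a smooth map `ℝ → M` by its end points, and a
bigon `[0,1]² → M` with sitting instants extends to `ℝ²` in the same way; we work with these
extensions. -/

section Paths

variable {E : Type*} [NormedAddCommGroup E] [NormedSpace ℝ E]
  {M : Type*} [TopologicalSpace M] [ChartedSpace E M]

/-- Smooth paths from `x` to `y` with sitting instants. -/
structure SmoothPath (E : Type*) [NormedAddCommGroup E] [NormedSpace ℝ E]
    {M : Type*} [TopologicalSpace M] [ChartedSpace E M] (x y : M) where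
  toFun : ℝ → M
  smooth : ContMDiff 𝓘(ℝ, ℝ) 𝓘(ℝ, E) ∞ toFun
  sitting : ∃ ε > 0, (∀ v ≤ ε, toFun v = x) ∧ (∀ v ≥ 1 - ε, toFun v = y)

/-- Bigons `γ₀ ⇒ γ₁` with sitting instants: smooth maps `(u, v) ↦ Σ(u, v)` such that `Σ(u, ·)` is
a path from `x` to `y` for all `u`, equal to `γ₀` for `u` near `0` and to `γ₁` for `u` near `1`. -/
structure Bigon {x y : M} (γ₀ γ₁ : SmoothPath E x y) where
  toFun : ℝ × ℝ → M
  smooth : ContMDiff 𝓘(ℝ, ℝ × ℝ) 𝓘(ℝ, E) ∞ toFun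
  sitting : ∃ ε > 0, (∀ u, ∀ v ≤ ε, toFun (u, v) = x) ∧ (∀ u, ∀ v ≥ 1 - ε, toFun (u, v) = y) ∧
    (∀ u ≤ ε, ∀ v, toFun (u, v) = γ₀.toFun v) ∧ (∀ u ≥ 1 - ε, ∀ v, toFun (u, v) = γ₁.toFun v)

/-- The differential of `f : V → M` has rank at most `k` at every point. -/
def RankAtMost (E : Type*) [NormedAddCommGroup E] [NormedSpace ℝ E]
    {M : Type*} [TopologicalSpace M] [ChartedSpace E M]
    {V : Type*} [NormedAddCommGroup V] [NormedSpace ℝ V] (k : ℕ) (f : V → M) : Prop :=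
  ∀ z : V, (mfderiv 𝓘(ℝ, V) 𝓘(ℝ, E) f z).rank ≤ k

/-- Two paths are thinly homotopic if there is a bigon between them of rank at most `1`. -/
def SmoothPath.ThinHomotopic {x y : M} (γ₀ γ₁ : SmoothPath E x y) : Prop :=
  ∃ S : Bigon γ₀ γ₁, RankAtMost E 1 S.toFun

/-- Two bigons `S : γ₀ ⇒ γ₁` and `S' : γ₀' ⇒ γ₁'` are thinly homotopic if there is a homotopy
`h(r, u, v)` of bigons from `S` to `S'` (with sitting instants) of rank at most `2`, which is a
thin homotopy of paths from `γ₀` to `γ₀'` and from `γ₁` to `γ₁'` on the faces `u = 0` and `u = 1`.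
These are the 2-morphisms between thin homotopy classes of paths. -/
def Bigon.ThinHomotopic {x y : M} {γ₀ γ₁ γ₀' γ₁' : SmoothPath E x y}
    (S : Bigon γ₀ γ₁) (S' : Bigon γ₀' γ₁') : Prop :=
  ∃ h : ℝ × ℝ × ℝ → M, ContMDiff 𝓘(ℝ, ℝ × ℝ × ℝ) 𝓘(ℝ, E) ∞ h ∧ RankAtMost E 2 h ∧
    RankAtMost E 1 (fun z : ℝ × ℝ => h (z.1, 0, z.2)) ∧
    RankAtMost E 1 (fun z : ℝ × ℝ => h (z.1, 1, z.2)) ∧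
    ∃ ε > 0,
      (∀ r ≤ ε, ∀ u v, h (r, u, v) = S.toFun (u, v)) ∧
      (∀ r ≥ 1 - ε, ∀ u v, h (r, u, v) = S'.toFun (u, v)) ∧
      (∀ r, ∀ u ≤ ε, ∀ v, h (r, u, v) = h (r, 0, v)) ∧
      (∀ r, ∀ u ≥ 1 - ε, ∀ v, h (r, u, v) = h (r, 1, v)) ∧
      (∀ r u, ∀ v ≤ ε, h (r, u, v) = x) ∧
      (∀ r u, ∀ v ≥ 1 - ε, h (r, u, v) = y)

/-- The constant path. -/
def SmoothPath.const (E : Type*) [NormedAddCommGroup E] [NormedSpace ℝ E]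
    {M : Type*} [TopologicalSpace M] [ChartedSpace E M] (x : M) : SmoothPath E x x where
  toFun _ := x
  smooth := contMDiff_const
  sitting := ⟨1, one_pos, fun _ _ => rfl, fun _ _ => rfl⟩

/-- The reversed path. -/
def SmoothPath.reverse {x y : M} (γ : SmoothPath E x y) : SmoothPath E y x where
  toFun v := γ.toFun (1 - v)
  smooth := γ.smooth.comp (contDiff_const.sub contDiff_id).contMDiff
  sitting := by
    obtain ⟨ε, hε, h0, h1⟩ := γ.sitting
    exact ⟨ε, hε, fun v hv => h1 _ (by linarith), fun v hv => h0 _ (by linarith)⟩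

/-- Gluing along a slit where both maps are locally constant in the gluing direction. -/
theorem contMDiff_glue {V : Type*} [NormedAddCommGroup V] [NormedSpace ℝ V] {f g : V → M}
    (hf : ContMDiff 𝓘(ℝ, V) 𝓘(ℝ, E) ∞ f) (hg : ContMDiff 𝓘(ℝ, V) 𝓘(ℝ, E) ∞ g)
    (l : V → ℝ) (hl : Continuous l) (a b : ℝ) (hab : a < 1 / 2) (hb : 1 / 2 < b)
    (hfg : ∀ z, a < l z → l z < b → f z = g z) :
    ContMDiff 𝓘(ℝ, V) 𝓘(ℝ, E) ∞ (fun z => if l z ≤ 1 / 2 then f z else g z) := by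
  intro z
  by_cases hz : l z < b
  · refine (hf z).congr_of_eventuallyEq ?_
    filter_upwards [(isOpen_lt hl continuous_const).mem_nhds hz] with w hw
    by_cases h : l w ≤ 1 / 2
    · exact if_pos h
    · refine (if_neg h).trans ?_
      exact (hfg w (by linarith [not_le.1 h]) hw).symm
  · refine (hg z).congr_of_eventuallyEq ?_
    have hz' : (1 : ℝ) / 2 < l z := by linarith [not_lt.1 hz]
    filter_upwards [(isOpen_lt continuous_const hl).mem_nhds hz'] with w hw
    exact if_neg (not_le.2 hw)

/-- Concatenation: `γ` followed by `γ'`. -/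
def SmoothPath.trans {x y z : M} (γ : SmoothPath E x y) (γ' : SmoothPath E y z) :
    SmoothPath E x z where
  toFun v := if v ≤ 1 / 2 then γ.toFun (2 * v) else γ'.toFun (2 * v - 1)
  smooth := by
    obtain ⟨ε, hε, -, h1⟩ := γ.sitting
    obtain ⟨δ, hδ, h0, -⟩ := γ'.sitting
    refine contMDiff_glue (f := fun v : ℝ => γ.toFun (2 * v))
      (g := fun v : ℝ => γ'.toFun (2 * v - 1))
      (γ.smooth.comp (contDiff_const.mul contDiff_id).contMDiff)
      (γ'.smooth.comp ((contDiff_const.mul contDiff_id).sub contDiff_const).contMDiff)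
      (fun v => v) continuous_id ((1 - ε) / 2) ((1 + δ) / 2)
      (by linarith) (by linarith) ?_
    intro v hv hv'
    rw [h1 _ (by linarith), h0 _ (by linarith)]
  sitting := by
    obtain ⟨ε, hε, h0, -⟩ := γ.sitting
    obtain ⟨δ, hδ, -, h1⟩ := γ'.sitting
    refine ⟨min (min ε δ / 2) (1 / 4), by positivity, fun v hv => ?_, fun v hv => ?_⟩
    · have := min_le_left (min ε δ / 2) (1 / 4)
      have := min_le_right (min ε δ / 2) (1 / 4)
      have := min_le_left ε δ
      rw [if_pos (by linarith), h0 _ (by linarith)]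
    · have := min_le_left (min ε δ / 2) (1 / 4)
      have := min_le_right (min ε δ / 2) (1 / 4)
      have := min_le_right ε δ
      rw [if_neg (by linarith), h1 _ (by linarith)]

/-- The identity bigon of a path. -/
def Bigon.id {x y : M} (γ : SmoothPath E x y) : Bigon γ γ where
  toFun z := γ.toFun z.2
  smooth := γ.smooth.comp contDiff_snd.contMDiff
  sitting := by
    obtain ⟨ε, hε, h0, h1⟩ := γ.sitting
    exact ⟨ε, hε, fun _ => h0, fun _ => h1, fun _ _ _ => rfl, fun _ _ _ => rfl⟩

/-- The horizontal inverse of a bigon: all paths are reversed. -/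
def Bigon.hinv {x y : M} {γ₀ γ₁ : SmoothPath E x y} (S : Bigon γ₀ γ₁) :
    Bigon γ₀.reverse γ₁.reverse where
  toFun z := S.toFun (z.1, 1 - z.2)
  smooth := S.smooth.comp (contDiff_fst.prodMk (contDiff_const.sub contDiff_snd)).contMDiff
  sitting := by
    obtain ⟨ε, hε, h0, h1, h2, h3⟩ := S.sitting
    exact ⟨ε, hε, fun u v hv => h1 _ _ (by linarith), fun u v hv => h0 _ _ (by linarith),
      fun u hu v => h2 u hu _, fun u hu v => h3 u hu _⟩

/-- Vertical composition of bigons: `S : γ₀ ⇒ γ₁` followed by `S' : γ₁ ⇒ γ₂`. -/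
def Bigon.vcomp {x y : M} {γ₀ γ₁ γ₂ : SmoothPath E x y} (S : Bigon γ₀ γ₁) (S' : Bigon γ₁ γ₂) :
    Bigon γ₀ γ₂ where
  toFun z := if z.1 ≤ 1 / 2 then S.toFun (2 * z.1, z.2) else S'.toFun (2 * z.1 - 1, z.2)
  smooth := by
    obtain ⟨ε, hε, -, -, -, h1⟩ := S.sitting
    obtain ⟨δ, hδ, -, -, h0, -⟩ := S'.sitting
    refine contMDiff_glue (f := fun z : ℝ × ℝ => S.toFun (2 * z.1, z.2))
      (g := fun z : ℝ × ℝ => S'.toFun (2 * z.1 - 1, z.2))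
      (S.smooth.comp ((contDiff_const.mul contDiff_fst).prodMk contDiff_snd).contMDiff)
      (S'.smooth.comp
        (((contDiff_const.mul contDiff_fst).sub contDiff_const).prodMk contDiff_snd).contMDiff)
      (fun z => z.1) continuous_fst ((1 - ε) / 2) ((1 + δ) / 2)
      (by linarith) (by linarith) ?_
    intro z hz hz'
    rw [h1 _ (by linarith), h0 _ (by linarith)]
  sitting := by
    obtain ⟨ε, hε, a0, a1, a2, a3⟩ := S.sitting
    obtain ⟨δ, hδ, b0, b1, b2, b3⟩ := S'.sitting
    have e1 := min_le_left (min ε δ / 2) (1 / 4)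
    have e2 := min_le_right (min ε δ / 2) (1 / 4)
    have e3 := min_le_left ε δ
    have e4 := min_le_right ε δ
    refine ⟨min (min ε δ / 2) (1 / 4), by positivity, fun u v hv => ?_, fun u v hv => ?_,
      fun u hu v => ?_, fun u hu v => ?_⟩
    · dsimp only
      split_ifs
      · exact a0 _ _ (by linarith)
      · exact b0 _ _ (by linarith)
    · dsimp only
      split_ifs
      · exact a1 _ _ (by linarith)
      · exact b1 _ _ (by linarith)
    · dsimp only
      rw [if_pos (by linarith), a2 _ (by linarith)]
    · dsimp only
      rw [if_neg (by linarith), b3 _ (by linarith)]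

/-- Horizontal composition of bigons: `S` followed by `S'`. -/
def Bigon.hcomp {x y z : M} {γ₀ γ₁ : SmoothPath E x y} {γ₀' γ₁' : SmoothPath E y z}
    (S : Bigon γ₀ γ₁) (S' : Bigon γ₀' γ₁') : Bigon (γ₀.trans γ₀') (γ₁.trans γ₁') where
  toFun z := if z.2 ≤ 1 / 2 then S.toFun (z.1, 2 * z.2) else S'.toFun (z.1, 2 * z.2 - 1)
  smooth := by
    obtain ⟨ε, hε, -, h1, -, -⟩ := S.sitting
    obtain ⟨δ, hδ, h0, -, -, -⟩ := S'.sitting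
    refine contMDiff_glue (f := fun z : ℝ × ℝ => S.toFun (z.1, 2 * z.2))
      (g := fun z : ℝ × ℝ => S'.toFun (z.1, 2 * z.2 - 1))
      (S.smooth.comp (contDiff_fst.prodMk (contDiff_const.mul contDiff_snd)).contMDiff)
      (S'.smooth.comp
        (contDiff_fst.prodMk ((contDiff_const.mul contDiff_snd).sub contDiff_const)).contMDiff)
      (fun z => z.2) continuous_snd ((1 - ε) / 2) ((1 + δ) / 2)
      (by linarith) (by linarith) ?_
    intro z hz hz'
    rw [h1 _ _ (by linarith), h0 _ _ (by linarith)]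
  sitting := by
    obtain ⟨ε, hε, a0, a1, a2, a3⟩ := S.sitting
    obtain ⟨δ, hδ, b0, b1, b2, b3⟩ := S'.sitting
    have e1 := min_le_left (min ε δ / 2) (1 / 4)
    have e2 := min_le_right (min ε δ / 2) (1 / 4)
    have e3 := min_le_left ε δ
    have e4 := min_le_right ε δ
    have e5 : 0 < min ε δ := lt_min hε hδ
    refine ⟨min (min ε δ / 2) (1 / 4), by positivity, fun u v hv => ?_, fun u v hv => ?_,
      fun u hu v => ?_, fun u hu v => ?_⟩
    · dsimp only
      rw [if_pos (by linarith), a0 _ _ (by linarith)]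
    · dsimp only
      rw [if_neg (by linarith), b1 _ _ (by linarith)]
    · dsimp only [SmoothPath.trans]
      rw [a2 _ (by linarith), b2 _ (by linarith)]
    · dsimp only [SmoothPath.trans]
      rw [a3 _ (by linarith), b3 _ (by linarith)]

/-- For a smooth curve `f` in `M`, the path `γ_t : v ↦ f (t v)` from `f 0` to `f t`,
reparametrised so as to have sitting instants. -/
def curvePath (f : ℝ → M) (hf : ContMDiff 𝓘(ℝ, ℝ) 𝓘(ℝ, E) ∞ f) (t : ℝ) :
    SmoothPath E (f 0) (f t) where
  toFun v := f (t * Real.smoothTransition (3 * v - 1))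
  smooth := hf.comp (contDiff_const.mul (Real.smoothTransition.contDiff.comp
    ((contDiff_const.mul contDiff_id).sub contDiff_const))).contMDiff
  sitting := by
    refine ⟨1 / 3, by norm_num, fun v hv => ?_, fun v hv => ?_⟩
    · rw [Real.smoothTransition.zero_of_nonpos (by linarith), mul_zero]
    · rw [Real.smoothTransition.one_of_one_le (by linarith), mul_one]

/-- Monotone step from `0` to `1` in the first half of the unit interval. -/
def earlyStep (v : ℝ) : ℝ := Real.smoothTransition (6 * v - 1)

/-- Monotone step from `0` to `1` in the second half of the unit interval. -/
def lateStep (v : ℝ) : ℝ := Real.smoothTransition (6 * v - 4)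

theorem contDiff_earlyStep : ContDiff ℝ ∞ earlyStep :=
  Real.smoothTransition.contDiff.comp ((contDiff_const.mul contDiff_id).sub contDiff_const)

theorem contDiff_lateStep : ContDiff ℝ ∞ lateStep :=
  Real.smoothTransition.contDiff.comp ((contDiff_const.mul contDiff_id).sub contDiff_const)

/-- For `f : ℝ² → M`, the image of the path `(0,0) → (s,0) → (s,t)`. -/
def southEastPath (f : ℝ × ℝ → M) (hf : ContMDiff 𝓘(ℝ, ℝ × ℝ) 𝓘(ℝ, E) ∞ f) (s t : ℝ) :
    SmoothPath E (f (0, 0)) (f (s, t)) where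
  toFun v := f (s * earlyStep v, t * lateStep v)
  smooth := hf.comp ((contDiff_const.mul contDiff_earlyStep).prodMk
    (contDiff_const.mul contDiff_lateStep)).contMDiff
  sitting := by
    refine ⟨1 / 6, by norm_num, fun v hv => ?_, fun v hv => ?_⟩
    · rw [earlyStep, lateStep, Real.smoothTransition.zero_of_nonpos (by linarith),
        Real.smoothTransition.zero_of_nonpos (by linarith), mul_zero, mul_zero]
    · rw [earlyStep, lateStep, Real.smoothTransition.one_of_one_le (by linarith),
        Real.smoothTransition.one_of_one_le (by linarith), mul_one, mul_one]

/-- For `f : ℝ² → M`, the image of the path `(0,0) → (0,t) → (s,t)`. -/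
def westNorthPath (f : ℝ × ℝ → M) (hf : ContMDiff 𝓘(ℝ, ℝ × ℝ) 𝓘(ℝ, E) ∞ f) (s t : ℝ) :
    SmoothPath E (f (0, 0)) (f (s, t)) where
  toFun v := f (s * lateStep v, t * earlyStep v)
  smooth := hf.comp ((contDiff_const.mul contDiff_lateStep).prodMk
    (contDiff_const.mul contDiff_earlyStep)).contMDiff
  sitting := by
    refine ⟨1 / 6, by norm_num, fun v hv => ?_, fun v hv => ?_⟩
    · rw [earlyStep, lateStep, Real.smoothTransition.zero_of_nonpos (by linarith),
        Real.smoothTransition.zero_of_nonpos (by linarith), mul_zero, mul_zero]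
    · rw [earlyStep, lateStep, Real.smoothTransition.one_of_one_le (by linarith),
        Real.smoothTransition.one_of_one_le (by linarith), mul_one, mul_one]

/-- The image `f_* Γ(s,t)` of the canonical bigon `Γ(s,t)` in the rectangle spanned by `(0,0)` and
`(s,t)`, from `(0,0) → (0,t) → (s,t)` to `(0,0) → (s,0) → (s,t)`. (Any two bigons in the plane
with this source and target are thinly homotopic; this one interpolates linearly.) -/
def canonicalBigon (f : ℝ × ℝ → M) (hf : ContMDiff 𝓘(ℝ, ℝ × ℝ) 𝓘(ℝ, E) ∞ f) (s t : ℝ) :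
    Bigon (westNorthPath f hf s t) (southEastPath f hf s t) where
  toFun z := f
    (s * ((1 - Real.smoothTransition (3 * z.1 - 1)) * lateStep z.2 +
      Real.smoothTransition (3 * z.1 - 1) * earlyStep z.2),
     t * ((1 - Real.smoothTransition (3 * z.1 - 1)) * earlyStep z.2 +
      Real.smoothTransition (3 * z.1 - 1) * lateStep z.2))
  smooth := by
    have hb : ContDiff ℝ ∞ (fun z : ℝ × ℝ => Real.smoothTransition (3 * z.1 - 1)) :=
      Real.smoothTransition.contDiff.comp ((contDiff_const.mul contDiff_fst).sub contDiff_const)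
    have he : ContDiff ℝ ∞ (fun z : ℝ × ℝ => earlyStep z.2) := contDiff_earlyStep.comp contDiff_snd
    have hl : ContDiff ℝ ∞ (fun z : ℝ × ℝ => lateStep z.2) := contDiff_lateStep.comp contDiff_snd
    exact hf.comp ((contDiff_const.mul (((contDiff_const.sub hb).mul hl).add (hb.mul he))).prodMk
      (contDiff_const.mul (((contDiff_const.sub hb).mul he).add (hb.mul hl)))).contMDiff
  sitting := by
    refine ⟨1 / 6, by norm_num, fun u v hv => ?_, fun u v hv => ?_, fun u hu v => ?_,
      fun u hu v => ?_⟩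
    · have h1 : earlyStep v = 0 := Real.smoothTransition.zero_of_nonpos (by linarith)
      have h2 : lateStep v = 0 := Real.smoothTransition.zero_of_nonpos (by linarith)
      simp [h1, h2]
    · have h1 : earlyStep v = 1 := Real.smoothTransition.one_of_one_le (by linarith)
      have h2 : lateStep v = 1 := Real.smoothTransition.one_of_one_le (by linarith)
      simp [h1, h2]
    · have h1 : Real.smoothTransition (3 * u - 1) = 0 :=
        Real.smoothTransition.zero_of_nonpos (by linarith)
      simp [h1, westNorthPath]
    · have h1 : Real.smoothTransition (3 * u - 1) = 1 :=
        Real.smoothTransition.one_of_one_le (by linarith)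
      simp [h1, southEastPath]

end Paths

/-! ### Transport 2-functors -/

section Transport

variable {EG : Type*} [NormedAddCommGroup EG] [NormedSpace ℝ EG]
  {EH : Type*} [NormedAddCommGroup EH] [NormedSpace ℝ EH]
  {G : Type*} [TopologicalSpace G] [ChartedSpace EG G] [Group G] [LieGroup 𝓘(ℝ, EG) ∞ G]
  {H : Type*} [TopologicalSpace H] [ChartedSpace EH H] [Group H] [LieGroup 𝓘(ℝ, EH) ∞ H]

/-- A transport 2-functor on `M`: a strict 2-functor from the thin fundamental 2-groupoid of `M`
to the 2-category of 2-torsors, given on points, paths and bigons, compatible with thin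
homotopies, identities and all compositions, and smooth on the plots of the diffeological spaces
of loops at a point and of bigons between paths with fixed end points. (Plots are families indexed
by open subsets `U` of Euclidean spaces that are jointly smooth in all variables.) -/
structure TransportTwoFunctor (C : SmoothCrossedModule EG EH G H)
    (E : Type*) [NormedAddCommGroup E] [NormedSpace ℝ E]
    (M : Type*) [TopologicalSpace M] [ChartedSpace E M] where
  obj : M → TwoTorsor.{w, _, _, _, _} C
  map : ∀ {x y : M}, SmoothPath E x y → TwoTorsor.Hom (obj x) (obj y)
  map₂ : ∀ {x y : M} {γ₀ γ₁ : SmoothPath E x y}, Bigon γ₀ γ₁ →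
    TwoTorsor.TwoHom (map γ₀) (map γ₁)
  map_thin : ∀ {x y : M} {γ₀ γ₁ : SmoothPath E x y}, γ₀.ThinHomotopic γ₁ → map γ₀ = map γ₁
  map₂_thin : ∀ {x y : M} {γ₀ γ₁ γ₀' γ₁' : SmoothPath E x y} (S : Bigon γ₀ γ₁)
    (S' : Bigon γ₀' γ₁'), S.ThinHomotopic S' → (map₂ S).app = (map₂ S').app
  map_const : ∀ x, map (SmoothPath.const E x) = TwoTorsor.Hom.id (obj x)
  map_trans : ∀ {x y z : M} (γ : SmoothPath E x y) (γ' : SmoothPath E y z),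
    map (γ.trans γ') = (map γ).comp (map γ')
  map₂_id : ∀ {x y : M} (γ : SmoothPath E x y), map₂ (Bigon.id γ) = TwoTorsor.TwoHom.id (map γ)
  map₂_vcomp : ∀ {x y : M} {γ₀ γ₁ γ₂ : SmoothPath E x y} (S : Bigon γ₀ γ₁) (S' : Bigon γ₁ γ₂),
    (map₂ (S.vcomp S')).app = (map₂ S).vcompApp (map₂ S')
  map₂_hcomp : ∀ {x y z : M} {γ₀ γ₁ : SmoothPath E x y} {γ₀' γ₁' : SmoothPath E y z}
    (S : Bigon γ₀ γ₁) (S' : Bigon γ₀' γ₁'),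
    (map₂ (S.hcomp S')).app = (map₂ S).hcompApp (map₂ S')
  /-- Smoothness on loops at `x`; `Aut (obj x) ≅ G` through `φ ↦ φ(p) : p`. -/
  smooth_loops : ∀ (x : M) (p : (obj x).X₀) (n : ℕ) (U : Set (EuclideanSpace ℝ (Fin n))),
    IsOpen U → ∀ γ : EuclideanSpace ℝ (Fin n) → SmoothPath E x x,
    ContMDiffOn 𝓘(ℝ, EuclideanSpace ℝ (Fin n) × ℝ) 𝓘(ℝ, E) ∞
      (fun z : EuclideanSpace ℝ (Fin n) × ℝ => (γ z.1).toFun z.2) (U ×ˢ Set.univ) →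
    ContMDiffOn 𝓘(ℝ, EuclideanSpace ℝ (Fin n)) 𝓘(ℝ, EG) ∞
      (fun a => (obj x).div ((map (γ a)).map₀ p) p) U
  /-- Smoothness on bigons between paths from `x` to `y`; equivariant maps
  `(obj x)₀ → (obj y)₁` are identified with elements of `H` through `f ↦ f(p) : id_{s(f(p))}`. -/
  smooth_bigons : ∀ (x y : M) (p : (obj x).X₀) (n : ℕ) (U : Set (EuclideanSpace ℝ (Fin n))),
    IsOpen U → ∀ (γ₀ γ₁ : EuclideanSpace ℝ (Fin n) → SmoothPath E x y)
    (S : ∀ a, Bigon (γ₀ a) (γ₁ a)),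
    ContMDiffOn 𝓘(ℝ, EuclideanSpace ℝ (Fin n) × ℝ × ℝ) 𝓘(ℝ, E) ∞
      (fun z : EuclideanSpace ℝ (Fin n) × ℝ × ℝ => (S z.1).toFun z.2) (U ×ˢ Set.univ) →
    ContMDiffOn 𝓘(ℝ, EuclideanSpace ℝ (Fin n)) 𝓘(ℝ, EH) ∞
      (fun a => (obj y).hdiv ((map₂ (S a)).app p)) U

variable {C : SmoothCrossedModule EG EH G H}
  {E : Type*} [NormedAddCommGroup E] [NormedSpace ℝ E]
  {M : Type*} [TopologicalSpace M] [ChartedSpace E M]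

/-- The set underlying the bundle of a transport 2-functor: the union of the `G`-torsors of
objects. -/
def TransportTwoFunctor.Total (F : TransportTwoFunctor C E M) : Type _ :=
  Σ x : M, (F.obj x).X₀

/-- The point `p` of the fibre over `x`. -/
def TransportTwoFunctor.point (F : TransportTwoFunctor C E M) (x : M) (p : (F.obj x).X₀) :
    F.Total :=
  ⟨x, p⟩

/-- The right `G`-action on the bundle. -/
def TransportTwoFunctor.act (F : TransportTwoFunctor C E M) (p : F.Total) (g : G) : F.Total :=
  ⟨p.1, (F.obj p.1).act₀ p.2 g⟩

/-- The structure of a smooth principal `G`-bundle over `M` on the union of the `G`-torsors of a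
transport 2-functor, for which the transport along paths from a fixed point is smooth. (The last
condition makes the sections `y ↦ tra(γ_y)(p)` smooth for smooth families of paths `γ_y : x → y`,
so the smooth structure is determined by the functor.) -/
structure TransportTwoFunctor.Bundle (F : TransportTwoFunctor C E M) where
  top : TopologicalSpace F.Total
  charted : ChartedSpace (E × EG) F.Total
  isManifold : IsManifold 𝓘(ℝ, E × EG) ∞ F.Total
  smooth_proj : ContMDiff 𝓘(ℝ, E × EG) 𝓘(ℝ, E) ∞ (fun p : F.Total => p.1)
  smooth_act : ContMDiff (𝓘(ℝ, E × EG).prod 𝓘(ℝ, EG)) 𝓘(ℝ, E × EG) ∞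
    (fun z : F.Total × G => F.act z.1 z.2)
  /-- Around each point there is a smooth local section `σ` whose local trivialization
  `(x, g) ↦ σ(x) · g` has a smooth inverse `p ↦ (π(p), p : σ(π(p)))`. -/
  local_triv : ∀ x₀ : M, ∃ (U : Set M) (σ : ∀ x : M, (F.obj x).X₀), IsOpen U ∧ x₀ ∈ U ∧
    ContMDiffOn 𝓘(ℝ, E) 𝓘(ℝ, E × EG) ∞ (fun x => F.point x (σ x)) U ∧
    ContMDiffOn 𝓘(ℝ, E × EG) 𝓘(ℝ, EG) ∞
      (fun p : F.Total => (F.obj p.1).div p.2 (σ p.1)) {p | p.1 ∈ U}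
  smooth_transport : ∀ (x : M) (p : (F.obj x).X₀) (n : ℕ) (U : Set (EuclideanSpace ℝ (Fin n))),
    IsOpen U → ∀ (y : EuclideanSpace ℝ (Fin n) → M) (γ : ∀ a, SmoothPath E x (y a)),
    ContMDiffOn 𝓘(ℝ, EuclideanSpace ℝ (Fin n) × ℝ) 𝓘(ℝ, E) ∞
      (fun z : EuclideanSpace ℝ (Fin n) × ℝ => (γ z.1).toFun z.2) (U ×ˢ Set.univ) →
    ContMDiffOn 𝓘(ℝ, EuclideanSpace ℝ (Fin n)) 𝓘(ℝ, E × EG) ∞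
      (fun a => F.point (y a) ((F.map (γ a)).map₀ p)) U

namespace TransportTwoFunctor.Bundle

variable {F : TransportTwoFunctor C E M}

/-- The total space of the bundle, as a manifold. -/
def Space (_P : F.Bundle) : Type _ := F.Total

instance (P : F.Bundle) : TopologicalSpace P.Space := P.top

instance (P : F.Bundle) : ChartedSpace (E × EG) P.Space := P.charted

instance (P : F.Bundle) : IsManifold 𝓘(ℝ, E × EG) ∞ P.Space := P.isManifold

/-- The projection. -/
def proj (P : F.Bundle) (p : P.Space) : M := p.1

/-- The point of the fibre. -/
def pt (P : F.Bundle) (p : P.Space) : (F.obj (P.proj p)).X₀ := p.2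

/-- The right action. -/
def act (P : F.Bundle) (p : P.Space) (g : G) : P.Space := F.act p g

theorem contMDiff_proj (P : F.Bundle) : ContMDiff 𝓘(ℝ, E × EG) 𝓘(ℝ, E) ∞ P.proj :=
  P.smooth_proj

end TransportTwoFunctor.Bundle

end Transport

/-! ### Differential forms with values in a vector space -/

section Forms

variable {V : Type*} [NormedAddCommGroup V] [NormedSpace ℝ V]
  {N : Type*} [TopologicalSpace N] [ChartedSpace V N]
  {W : Type*} [NormedAddCommGroup W] [NormedSpace ℝ W]

/-- The tangent vector at `φ⁻¹(z)` with components `v` in the preferred chart `φ` at `p₀`. -/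
def chartVector (p₀ : N) (z v : V) : TangentSpace 𝓘(ℝ, V) ((extChartAt 𝓘(ℝ, V) p₀).symm z) :=
  mfderiv 𝓘(ℝ, V) 𝓘(ℝ, V) (extChartAt 𝓘(ℝ, V) p₀).symm z v

/-- A 1-form is smooth if its components in charts are smooth. -/
def SmoothOneForm (A : ∀ p : N, TangentSpace 𝓘(ℝ, V) p →L[ℝ] W) : Prop :=
  ∀ (p₀ : N) (v : V), ContDiffOn ℝ ∞
    (fun z => A ((extChartAt 𝓘(ℝ, V) p₀).symm z) (chartVector p₀ z v))
    (extChartAt 𝓘(ℝ, V) p₀).target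

/-- A 2-form is smooth if its components in charts are smooth. -/
def SmoothTwoForm (B : ∀ p : N, TangentSpace 𝓘(ℝ, V) p [⋀^Fin 2]→L[ℝ] W) : Prop :=
  ∀ (p₀ : N) (v w : V), ContDiffOn ℝ ∞
    (fun z => B ((extChartAt 𝓘(ℝ, V) p₀).symm z) ![chartVector p₀ z v, chartVector p₀ z w])
    (extChartAt 𝓘(ℝ, V) p₀).target

/-- The exterior derivative `dA(X, Y)` of a smooth 1-form, computed in the preferred chart at `p`,
where it is `D_X (A(Y)) - D_Y (A(X))` for the constant extensions of `X` and `Y`. -/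
def extDerivOneForm (A : ∀ p : N, TangentSpace 𝓘(ℝ, V) p →L[ℝ] W) (p : N)
    (X Y : TangentSpace 𝓘(ℝ, V) p) : W :=
  let φ := extChartAt 𝓘(ℝ, V) p
  let X' : V := mfderiv 𝓘(ℝ, V) 𝓘(ℝ, V) φ p X
  let Y' : V := mfderiv 𝓘(ℝ, V) 𝓘(ℝ, V) φ p Y
  fderiv ℝ (fun z => A (φ.symm z) (chartVector p z Y')) (φ p) X' -
    fderiv ℝ (fun z => A (φ.symm z) (chartVector p z X')) (φ p) Y'

/-- The curve `c` has velocity `v` at time `0`. -/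
def HasVelocity (c : ℝ → N) (v : TangentSpace 𝓘(ℝ, V) (c 0)) : Prop :=
  HasMFDerivAt 𝓘(ℝ, ℝ) 𝓘(ℝ, V) c 0 (ContinuousLinearMap.toSpanSingleton ℝ v)

/-- For `u : ℝ² → N` with `u(s, 0) = e` for all `s`, the mixed derivative `∂²u/∂s∂t` at `(0,0)`
exists and equals `b ∈ T_e N`: for all `s` the derivative `w s ∈ T_{u(s,0)} N = T_e N` of `u(s, ·)`
at `0` exists, and `w` has derivative `b` at `0`. -/
def HasMixedDeriv (u : ℝ → ℝ → N) (e : N) (b : TangentSpace 𝓘(ℝ, V) e) : Prop :=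
  (∀ s, u s 0 = e) ∧ ∃ w : ℝ → V, (∀ s, HasVelocity (V := V) (u s) (w s)) ∧
    HasDerivAt w b 0

end Forms

section Extraction

variable {EG : Type*} [NormedAddCommGroup EG] [NormedSpace ℝ EG]
  {EH : Type*} [NormedAddCommGroup EH] [NormedSpace ℝ EH]
  {G : Type*} [TopologicalSpace G] [ChartedSpace EG G] [Group G] [LieGroup 𝓘(ℝ, EG) ∞ G]
  {H : Type*} [TopologicalSpace H] [ChartedSpace EH H] [Group H] [LieGroup 𝓘(ℝ, EH) ∞ H]
  {C : SmoothCrossedModule EG EH G H}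
  {E : Type*} [NormedAddCommGroup E] [NormedSpace ℝ E]
  {M : Type*} [TopologicalSpace M] [ChartedSpace E M]
  {F : TransportTwoFunctor C E M}

namespace TransportTwoFunctor.Bundle

/-- `𝔤`-valued 1-forms on the bundle (no smoothness imposed). The Lie algebra `𝔤 = T_1 G` is,
as a vector space, the model space `EG` by definition of the tangent space; we write the latter
in order to have its norm. -/
abbrev OneForm (P : F.Bundle) : Type _ :=
  ∀ p : P.Space, TangentSpace 𝓘(ℝ, E × EG) p →L[ℝ] EG

/-- `𝔥`-valued 2-forms on the bundle (no smoothness imposed), where `𝔥 = T_1 H` is `EH` as a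
vector space. -/
abbrev TwoForm (P : F.Bundle) : Type _ :=
  ∀ p : P.Space, TangentSpace 𝓘(ℝ, E × EG) p [⋀^Fin 2]→L[ℝ] EH

/-- For a smooth curve `c` in the bundle, with `γ_t` the path `v ↦ π(c(tv))`, the curve
`t ↦ tra(γ_t)⁻¹(c(t)) : c(0)` in `G`. -/
def curveHolonomy (P : F.Bundle) (c : ℝ → P.Space)
    (hc : ContMDiff 𝓘(ℝ, ℝ) 𝓘(ℝ, E × EG) ∞ c) (t : ℝ) : G :=
  (F.obj (P.proj (c 0))).div
    ((F.map (curvePath (fun r => P.proj (c r)) (P.contMDiff_proj.comp hc) t).reverse).map₀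
      (P.pt (c t)))
    (P.pt (c 0))

/-- `A` is the connection form of the transport functor: for all smooth curves `c`,
`A(c'(0)) = d/dt|₀ tra(γ_t)⁻¹(c(t)) : c(0)`. -/
def IsTransportConnection (P : F.Bundle) (A : P.OneForm) : Prop :=
  ∀ (c : ℝ → P.Space) (hc : ContMDiff 𝓘(ℝ, ℝ) 𝓘(ℝ, E × EG) ∞ c)
    (X : TangentSpace 𝓘(ℝ, E × EG) (c 0)), HasVelocity c X →
    P.curveHolonomy c hc 0 = 1 ∧ HasVelocity (V := EG) (P.curveHolonomy c hc) (A (c 0) X)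

/-- For a smooth map `S` from the plane to the bundle, the function
`(s, t) ↦ tra²(π_* S_* Γ(s,t))⁻¹(S(s,t)) : id` with values in `H`, where the inverse is that of
horizontal composition and the identity is that of the source,
`tra(s(π_* S_* Γ(s,t)))⁻¹(S(s,t))`. -/
def surfaceHolonomy (P : F.Bundle) (S : ℝ × ℝ → P.Space)
    (hS : ContMDiff 𝓘(ℝ, ℝ × ℝ) 𝓘(ℝ, E × EG) ∞ S) (s t : ℝ) : H :=
  (F.obj (P.proj (S (0, 0)))).hdiv
    ((F.map₂ (canonicalBigon (fun z => P.proj (S z)) (P.contMDiff_proj.comp hS) s t).hinv).app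
      (P.pt (S (s, t))))

/-- `B` is given by the mixed second derivative of 2-transport along canonical bigons: for all
smooth maps `S` from the plane to the bundle, with `X = ∂S/∂s(0,0)` and `Y = ∂S/∂t(0,0)`,
the mixed derivative of `surfaceHolonomy` at `(0,0)` exists and is `B(X, Y)`. -/
def IsTransportTwoForm (P : F.Bundle) (B : P.TwoForm) : Prop :=
  ∀ (S : ℝ × ℝ → P.Space) (hS : ContMDiff 𝓘(ℝ, ℝ × ℝ) 𝓘(ℝ, E × EG) ∞ S)
    (X Y : TangentSpace 𝓘(ℝ, E × EG) (S (0, 0))),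
    HasVelocity (fun s => S (s, 0)) X → HasVelocity (fun t => S (0, t)) Y →
    HasMixedDeriv (P.surfaceHolonomy S hS) 1 (B (S (0, 0)) ![X, Y])

/-- `A` is a smooth connection 1-form: it reproduces the generators of fundamental vector fields,
and is equivariant. -/
def IsConnection (P : F.Bundle) (A : P.OneForm) : Prop :=
  SmoothOneForm A ∧
  (∀ (p : P.Space) (ξ : GroupLieAlgebra 𝓘(ℝ, EG) G),
    A (P.act p 1) (mfderiv 𝓘(ℝ, EG) 𝓘(ℝ, E × EG) (fun g : G => P.act p g) 1 ξ) = ξ) ∧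
  (∀ (g : G) (p : P.Space) (X : TangentSpace 𝓘(ℝ, E × EG) p),
    A (P.act p g) (mfderiv 𝓘(ℝ, E × EG) 𝓘(ℝ, E × EG) (fun q : P.Space => P.act q g) p X) =
      lieAd g⁻¹ (A p X))

/-- The curvature `F_A = dA + ½[A ∧ A]`, that is `F_A(X, Y) = dA(X, Y) + [A(X), A(Y)]`. -/
def curvature (P : F.Bundle) (A : P.OneForm) (p : P.Space)
    (X Y : TangentSpace 𝓘(ℝ, E × EG) p) : EG :=
  let a : GroupLieAlgebra 𝓘(ℝ, EG) G := A p X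
  let b : GroupLieAlgebra 𝓘(ℝ, EG) G := A p Y
  let ab : EG := (⁅a, b⁆ : GroupLieAlgebra 𝓘(ℝ, EG) G)
  extDerivOneForm A p X Y + ab

/-- For a map `g` from the bundle to `G`, the map `R_g : p ↦ p · g(p)`. -/
def rightMul (P : F.Bundle) (g : P.Space → G) (p : P.Space) : P.Space := P.act p (g p)

/-- `R_g^* B = (α_g⁻¹)_* B` for a map `g` from the bundle to `G`. -/
def PullbackEq (P : F.Bundle) (B : P.TwoForm) (g : P.Space → G) : Prop :=
  ∀ (p : P.Space) (X Y : TangentSpace 𝓘(ℝ, E × EG) p),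
    B (P.rightMul g p) ![mfderiv 𝓘(ℝ, E × EG) 𝓘(ℝ, E × EG) (P.rightMul g) p X,
      mfderiv 𝓘(ℝ, E × EG) 𝓘(ℝ, E × EG) (P.rightMul g) p Y] =
    C.αStar (g p)⁻¹ (B p ![X, Y])

end TransportTwoFunctor.Bundle

end Extraction

end

/-! The transport functor assigns to a curve in the bundle a holonomy in `G` and to a surface a
holonomy in `H`; `A` and `B` are their first and mixed second derivatives. Three properties of
holonomy carry everything. It is smooth in families even when end points move: prefixing and
appending paths along rays of a parametrization reduces to fixed end points, and whiskering does not
change the `H`-value (`contMDiff_transport`, `contMDiff_hdiv`). It depends only on the piece of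
curve or surface used, so it scales under rescaling of the parameters. Finally, thin homotopy makes
surface holonomy trivial on maps that factor through the real line.

That the derivatives depend only on velocities is the main point. For curves, write the coordinates
as `t e(t)` and compare with the line `t e(0)` inside the family `a t e(b t)`: the rate is smooth in
`(a, b)` and homogeneous along three rays, so linearity of its derivative at the origin gives
equality (`holonomyRate_eq_of_coordinates`). For surfaces, the rescaled coordinates `κ(ε, ·)` tend
to the linear surface `s X + t Y` as `ε → 0`. Apply a linear map `L` to them and consider the rate
as a function of `(L, ε)`. It vanishes when `L` has rank one, so its first derivative at `L = 0`
vanishes on sums of rank one maps, in particular on the identity. With `L = d • id` the rate is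
therefore `d²` times a continuous function, whose limits along `d = ε` and along `ε = 0` are the
rates of the given and of the linear surface (`surfaceRate_eq_of_coordinates`). A function that is
homogeneous of degree one and differentiable at the origin is linear, so the rates are forms; `B` is
alternating because `s X + t X` factors through a line.

Fake-flatness differentiates the relation between the holonomies along the two halves of the
boundary of a rectangle, which differ by `t` of the surface holonomy. In a chart of `G` at the
identity the product rule leaves `dA` plus the antisymmetrized second derivative of the
multiplication, which is the bracket. The law for `R_g^* B` follows from equivariance of
2-morphisms: the surface holonomy is `1` on both axes, so derivatives of `g` do not contribute.

The bundle itself is built from local sections given by transport along rays of charts. Two of them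
differ by transport around loops, whose smoothness is part of the definition of the functor. -/

noncomputable section

/-! ### Calculus in vector spaces: homogeneity, Hadamard's lemma, cut-offs -/

section Calculus

variable {Z : Type*} [NormedAddCommGroup Z] [NormedSpace ℝ Z]
  {W : Type*} [NormedAddCommGroup W] [NormedSpace ℝ W]

/-- A function which is homogeneous of degree one and differentiable at the origin is linear. -/
theorem eq_fderiv_of_homogeneous {f : Z → W} (hf : DifferentiableAt ℝ f 0)
    (h : ∀ (r : ℝ) z, f (r • z) = r • f z) (z : Z) : f z = fderiv ℝ f 0 z := by
  -- The derivative of `f (r • z)` at `r = 0` is computed twice, by the chain rule and by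
  -- homogeneity.
  have h1 : HasDerivAt (fun r : ℝ => f (r • z)) (fderiv ℝ f 0 z) 0 := by
    have h2 : HasDerivAt (fun r : ℝ => r • z) z 0 := by
      simpa using (hasDerivAt_id (0 : ℝ)).smul_const z
    have h3 : HasFDerivAt f (fderiv ℝ f 0) ((0 : ℝ) • z) := by
      rw [zero_smul]; exact hf.hasFDerivAt
    exact h3.comp_hasDerivAt 0 h2
  have h4 : HasDerivAt (fun r : ℝ => f (r • z)) (f z) 0 := by
    simp only [h]
    simpa using (hasDerivAt_id (0 : ℝ)).smul_const (f z)
  exact h4.unique h1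

/-- Smooth dependence of a partial derivative on parameters. -/
theorem ContDiffAt.deriv_param {F : Z × ℝ → W} {z₀ : Z} {t₀ : ℝ}
    (hF : ContDiffAt ℝ ∞ F (z₀, t₀)) :
    ContDiffAt ℝ ∞ (fun x : Z × ℝ => deriv (fun t => F (x.1, t)) x.2) (z₀, t₀) := by
  have h1 : ContDiffAt ℝ ∞ (fun x : Z × ℝ => fderiv ℝ F x (0, 1)) (z₀, t₀) :=
    (hF.fderiv_right (m := ∞) (by simp)).clm_apply contDiffAt_const
  refine h1.congr_of_eventuallyEq ?_
  have h2 : ∀ᶠ x in nhds (z₀, t₀), DifferentiableAt ℝ F x :=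
    ((hF.of_le (m := 1) (by norm_cast)).eventually (by simp)).mono
      fun x hx => hx.differentiableAt (by simp)
  filter_upwards [h2] with x hx
  have h3 : HasDerivAt (fun t : ℝ => (x.1, t)) ((0 : Z), (1 : ℝ)) x.2 :=
    (hasDerivAt_const _ _).prodMk (hasDerivAt_id _)
  exact (hx.hasFDerivAt.comp_hasDerivAt x.2 h3).deriv

theorem ContDiffAt.deriv_param_zero {F : Z × ℝ → W} {z₀ : Z}
    (hF : ContDiffAt ℝ ∞ F (z₀, 0)) : ContDiffAt ℝ ∞ (fun z => deriv (fun t => F (z, t)) 0) z₀ :=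
  (hF.deriv_param).comp z₀ (f := fun z => (z, (0 : ℝ))) (by fun_prop)

variable [FiniteDimensional ℝ Z]

/-- Differentiation under the integral sign, over the unit interval. -/
theorem hasFDerivAt_integral_unitInterval {F : Z × ℝ → W} (hF : ContDiff ℝ ∞ F) (z₀ : Z) :
    HasFDerivAt (fun z => ∫ r in (0 : ℝ)..1, F (z, r))
      (∫ r in (0 : ℝ)..1, (fderiv ℝ F (z₀, r)).comp (ContinuousLinearMap.inl ℝ Z ℝ)) z₀ := by
  have hcont : Continuous fun x : Z × ℝ => (fderiv ℝ F x).comp (ContinuousLinearMap.inl ℝ Z ℝ) :=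
    (hF.continuous_fderiv (by simp)).clm_comp continuous_const
  have : ProperSpace Z := FiniteDimensional.proper ℝ Z
  obtain ⟨K, hK⟩ := ((isCompact_closedBall z₀ 1).prod
    (isCompact_Icc (a := (0 : ℝ)) (b := 1))).exists_bound_of_continuousOn hcont.continuousOn
  refine (intervalIntegral.hasFDerivAt_integral_of_dominated_of_fderiv_le
    (F := fun z r => F (z, r)) (bound := fun _ => K)
    (F' := fun z r => (fderiv ℝ F (z, r)).comp (ContinuousLinearMap.inl ℝ Z ℝ))
    (Metric.ball_mem_nhds z₀ one_pos) ?_ ?_ ?_ ?_ ?_ ?_)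
  · exact Filter.Eventually.of_forall fun z =>
      (hF.continuous.comp (by fun_prop)).aestronglyMeasurable
  · exact (hF.continuous.comp (by fun_prop)).intervalIntegrable _ _
  · exact (hcont.comp (by fun_prop : Continuous fun r : ℝ => (z₀, r))).aestronglyMeasurable
  · refine Filter.Eventually.of_forall fun r hr z hz => hK (z, r) ⟨?_, ?_⟩
    · exact Metric.ball_subset_closedBall hz
    · rw [Set.uIoc_of_le zero_le_one] at hr
      exact ⟨hr.1.le, hr.2⟩
  · exact intervalIntegrable_const
  · refine Filter.Eventually.of_forall fun r hr z hz => ?_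
    exact ((hF.differentiable (by simp)) (z, r)).hasFDerivAt.comp z (hasFDerivAt_prodMk_left z r)

/-- Induction on the order with `F` general: a directional derivative of the integral is again the
integral of a smooth function, the corresponding partial derivative of `F`. -/
theorem contDiff_integral_unitInterval [CompleteSpace W] {F : Z × ℝ → W} (hF : ContDiff ℝ ∞ F) :
    ContDiff ℝ ∞ (fun z => ∫ r in (0 : ℝ)..1, F (z, r)) := by
  rw [contDiff_infty]
  intro n
  induction n generalizing F with
  | zero =>
    rw [Nat.cast_zero, contDiff_zero]
    exact intervalIntegral.continuous_parametric_intervalIntegral_of_continuous'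
      (f := fun z r => F (z, r)) hF.continuous 0 1
  | succ n ih =>
    rw [Nat.cast_succ, contDiff_succ_iff_fderiv_apply]
    refine ⟨fun z => (hasFDerivAt_integral_unitInterval hF z).differentiableAt, by simp,
      fun y => ?_⟩
    have h1 : (fun z => fderiv ℝ (fun z => ∫ r in (0 : ℝ)..1, F (z, r)) z y) =
        fun z => ∫ r in (0 : ℝ)..1, (fun x : Z × ℝ => fderiv ℝ F x (y, 0)) (z, r) := by
      funext z
      rw [(hasFDerivAt_integral_unitInterval hF z).fderiv,
        ContinuousLinearMap.intervalIntegral_apply]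
      · simp
      · have hcont : Continuous fun x : Z × ℝ =>
            (fderiv ℝ F x).comp (ContinuousLinearMap.inl ℝ Z ℝ) :=
          (hF.continuous_fderiv (by simp)).clm_comp continuous_const
        exact (hcont.comp (by fun_prop : Continuous fun r : ℝ => (z, r))).intervalIntegrable _ _
    rw [h1]
    exact ih ((hF.fderiv_right (m := ∞) (by simp)).clm_apply contDiff_const)

/-- Hadamard's lemma: a smooth function vanishing for `t = 0` is `t` times a smooth function. -/
theorem exists_contDiff_eq_smul [CompleteSpace W] {f : Z × ℝ → W} (hf : ContDiff ℝ ∞ f)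
    (h0 : ∀ z, f (z, 0) = 0) :
    ∃ g : Z × ℝ → W, ContDiff ℝ ∞ g ∧ (∀ z t, f (z, t) = t • g (z, t)) ∧
      ∀ z, HasDerivAt (fun t => f (z, t)) (g (z, 0)) 0 := by
  have hF : ContDiff ℝ ∞ (fun x : (Z × ℝ) × ℝ => fderiv ℝ f (x.1.1, x.2 * x.1.2) (0, 1)) :=
    ((hf.fderiv_right (m := ∞) (by simp)).comp
      (by fun_prop : ContDiff ℝ ∞ fun x : (Z × ℝ) × ℝ => (x.1.1, x.2 * x.1.2))).clm_apply
      contDiff_const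
  have hd : ∀ z t r, HasDerivAt (fun r : ℝ => f (z, r * t)) (t • fderiv ℝ f (z, r * t) (0, 1)) r := by
    intro z t r
    have h1 : HasDerivAt (fun r : ℝ => (z, r * t)) ((0 : Z), t) r :=
      (hasDerivAt_const r z).prodMk (by simpa using (hasDerivAt_id r).mul_const t)
    have h2 := ((hf.differentiable (by simp)) (z, r * t)).hasFDerivAt.comp_hasDerivAt r h1
    convert! h2 using 1
    rw [← map_smul]
    simp
  -- The quotient is the average of `∂f/∂t` over the segment from `(z, 0)` to `(z, t)`; the
  -- fundamental theorem of calculus for `r ↦ f (z, r t)` gives the factorization.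
  refine ⟨fun x => ∫ r in (0 : ℝ)..1, fderiv ℝ f (x.1, r * x.2) (0, 1),
    contDiff_integral_unitInterval hF, fun z t => ?_, fun z => ?_⟩
  · rw [← intervalIntegral.integral_smul]
    have hcont_r : Continuous fun r : ℝ => t • fderiv ℝ f (z, r * t) (0, 1) :=
      continuous_const.smul (hF.continuous.comp
        (by fun_prop : Continuous fun r : ℝ => (((z, t), r) : (Z × ℝ) × ℝ)))
    rw [intervalIntegral.integral_eq_sub_of_hasDerivAt (fun r _ => hd z t r)
      (hcont_r.intervalIntegrable _ _)]
    simp [h0]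
  -- At `t = 0` the integrand is constant in `r`, so the quotient there is the partial derivative
  -- itself.
  · have := hd z 1 0
    simpa using this

/-- Comparison of the second order terms along the diagonal and along the first axis of a
function vanishing to second order along the second axis. -/
theorem eq_of_quadratic [CompleteSpace W] {φ : ℝ × ℝ → W} (hφ : ContDiff ℝ ∞ φ)
    (h0 : ∀ e, φ (0, e) = 0) (h1 : ∀ e, HasDerivAt (fun d => φ (d, e)) 0 0) {c c' : W}
    (hc : ∀ e : ℝ, φ (e, e) = e ^ 2 • c) (hc' : ∀ d : ℝ, φ (d, 0) = d ^ 2 • c') : c = c' := by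
  -- The variables are swapped so that `d`, which is divided out, comes last. The first quotient
  -- vanishes at `d = 0` because it equals the derivative there, so `d` can be divided out a second
  -- time.
  have hs : ContDiff ℝ ∞ fun x : ℝ × ℝ => φ (x.2, x.1) := hφ.comp (by fun_prop)
  obtain ⟨g, hg, hgt, hgd⟩ := exists_contDiff_eq_smul hs (by simpa using h0)
  have hg0 : ∀ e, g (e, 0) = 0 := fun e => (hgd e).unique (h1 e)
  obtain ⟨q, hq, hqt, -⟩ := exists_contDiff_eq_smul hg hg0
  have key : ∀ d e : ℝ, φ (d, e) = d ^ 2 • q (e, d) := by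
    intro d e
    have := hgt e d
    simp only at this
    rw [this, hqt, smul_smul, sq]
  have e1 : ∀ e : ℝ, e ≠ 0 → q (e, e) = c := fun e he => by
    have := (key e e).symm.trans (hc e)
    exact smul_right_injective W (pow_ne_zero 2 he) this
  have e2 : ∀ e : ℝ, e ≠ 0 → q (0, e) = c' := fun e he => by
    have := (key e 0).symm.trans (hc' e)
    exact smul_right_injective W (pow_ne_zero 2 he) this
  -- The second quotient `q` is constant along each of two curves through the origin, with the
  -- origin removed; by continuity both constants are `q 0`.
  have lim : ∀ (k : ℝ → ℝ × ℝ), Continuous k → k 0 = 0 → ∀ a, (∀ e, e ≠ 0 → q (k e) = a) →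
      a = q 0 := by
    intro k hk hk0 a ha
    have t1 : Filter.Tendsto (fun e => q (k e)) (nhdsWithin 0 {0}ᶜ) (nhds (q 0)) := by
      have := (hq.continuous.comp hk).tendsto 0
      simp only [Function.comp_apply, hk0] at this
      exact this.mono_left nhdsWithin_le_nhds
    refine tendsto_nhds_unique (tendsto_const_nhds.congr' ?_) t1
    filter_upwards [self_mem_nhdsWithin] with e he
    exact (ha e he).symm
  rw [lim (fun e => (e, e)) (by fun_prop) rfl c e1, lim (fun e => (0, e)) (by fun_prop) rfl c' e2]

/-- Near a given point, the identity can be cut off to a smooth map with values in a given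
neighbourhood. -/
theorem exists_contDiff_cutoff (z₀ : Z) {U : Set Z} (hU : U ∈ nhds z₀) :
    ∃ ρ : Z → Z, ContDiff ℝ ∞ ρ ∧ (∀ z, ρ z ∈ U) ∧ ρ =ᶠ[nhds z₀] id := by
  obtain ⟨R, hR, hRU⟩ := Metric.mem_nhds_iff.1 hU
  -- The map `z₀ + χ(z) (z - z₀)` stays in the ball of radius `R`, since `χ ≤ 1` inside the ball and
  -- `χ = 0` outside.
  let χ : ContDiffBump z₀ := ⟨R / 2, R, by positivity, by linarith⟩
  refine ⟨fun z => z₀ + χ z • (z - z₀), ?_, fun z => hRU ?_, ?_⟩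
  · exact contDiff_const.add (χ.contDiff.smul (contDiff_id.sub contDiff_const))
  · rw [mem_ball_iff_norm, add_sub_cancel_left, norm_smul, Real.norm_of_nonneg χ.nonneg]
    by_cases hz : z ∈ Metric.ball z₀ R
    · rw [mem_ball_iff_norm] at hz
      calc χ z * ‖z - z₀‖ ≤ 1 * ‖z - z₀‖ := by gcongr; exact χ.le_one
        _ < R := by linarith
    · rw [χ.zero_of_le_dist (not_lt.1 hz), zero_mul]; exact hR
  · filter_upwards [χ.eventuallyEq_one] with z hz
    simp [hz]

end Calculus

end

noncomputable section

/-! ### Velocities and mixed derivatives on manifolds -/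

section ManifoldCalculus

variable {V : Type*} [NormedAddCommGroup V] [NormedSpace ℝ V]
  {N : Type*} [TopologicalSpace N] [ChartedSpace V N]
  {V' : Type*} [NormedAddCommGroup V'] [NormedSpace ℝ V']
  {N' : Type*} [TopologicalSpace N'] [ChartedSpace V' N']
  {Z : Type*} [NormedAddCommGroup Z] [NormedSpace ℝ Z]

/-- Velocities are derivatives in the preferred chart. -/
theorem hasVelocity_iff {c : ℝ → N} {e : N} (hc : c 0 = e) (v : V) :
    HasVelocity (V := V) c v ↔
      ContinuousAt c 0 ∧ HasDerivAt (fun t => extChartAt 𝓘(ℝ, V) e (c t)) v 0 := by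
  subst hc
  refine and_congr Iff.rfl ?_
  rw [hasDerivAt_iff_hasFDerivAt, ← hasFDerivWithinAt_univ, ← Set.range_id]
  exact Iff.rfl

theorem HasVelocity.unique {c : ℝ → N} {v v' : V} (h : HasVelocity (V := V) c v)
    (h' : HasVelocity (V := V) c v') : v = v' :=
  ((hasVelocity_iff rfl v).1 h).2.unique ((hasVelocity_iff rfl v').1 h').2

theorem HasVelocity.congr {c c' : ℝ → N} {v : V} (h : HasVelocity (V := V) c v)
    (hcc' : c' =ᶠ[nhds 0] c) : HasVelocity (V := V) c' v := by
  rw [hasVelocity_iff hcc'.eq_of_nhds]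
  rw [hasVelocity_iff rfl] at h
  refine ⟨h.1.congr hcc'.symm, h.2.congr_of_eventuallyEq ?_⟩
  filter_upwards [hcc'] with t ht
  rw [ht]

theorem HasVelocity.comp_mfderiv {c : ℝ → N} {v : V} (h : HasVelocity (V := V) c v) {f : N → N'}
    (hf : MDifferentiableAt 𝓘(ℝ, V) 𝓘(ℝ, V') f (c 0)) :
    HasVelocity (V := V') (fun t => f (c t)) (mfderiv 𝓘(ℝ, V) 𝓘(ℝ, V') f (c 0) v) := by
  have h1 : HasMFDerivAt 𝓘(ℝ, ℝ) 𝓘(ℝ, V') (fun t => f (c t)) 0 _ :=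
    hf.hasMFDerivAt.comp (0 : ℝ) h
  have h2 : (mfderiv 𝓘(ℝ, V) 𝓘(ℝ, V') f (c 0)).comp (ContinuousLinearMap.toSpanSingleton ℝ v) =
      ContinuousLinearMap.toSpanSingleton ℝ (mfderiv 𝓘(ℝ, V) 𝓘(ℝ, V') f (c 0) v) :=
    ContinuousLinearMap.comp_toSpanSingleton _ _
  exact (congrArg (fun L : ℝ →L[ℝ] V' => HasMFDerivAt 𝓘(ℝ, ℝ) 𝓘(ℝ, V') (fun t => f (c t)) 0 L)
    h2).mp h1

theorem HasVelocity.comp_mul {c : ℝ → N} {v : V} (h : HasVelocity (V := V) c v) (r : ℝ) :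
    HasVelocity (V := V) (fun t => c (r * t)) (r • v) := by
  have hr : HasDerivAt (fun t : ℝ => r * t) r 0 := by simpa using (hasDerivAt_id (0 : ℝ)).const_mul r
  rw [hasVelocity_iff rfl] at h
  rw [hasVelocity_iff (e := c 0) (by simp)]
  refine ⟨ContinuousAt.comp (g := c) (by simpa using h.1) hr.continuousAt, ?_⟩
  have h2 : HasDerivAt (fun t => extChartAt 𝓘(ℝ, V) (c 0) (c t)) v (r * 0) := by simpa using h.2
  exact h2.scomp (0 : ℝ) hr

/-- The mixed second derivative at the origin of a function of two variables. -/
def mixedDeriv (f : ℝ × ℝ → V) : V := deriv (fun s => deriv (fun t => f (s, t)) 0) 0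

theorem Filter.EventuallyEq.mixedDeriv_eq {f g : ℝ × ℝ → V} (h : f =ᶠ[nhds 0] g) :
    mixedDeriv f = mixedDeriv g := by
  refine Filter.EventuallyEq.deriv_eq ?_
  have h1 : ∀ᶠ x in nhds (0 : ℝ × ℝ), f =ᶠ[nhds x] g := eventually_eventually_nhds.2 h
  have h2 : Filter.Tendsto (fun s : ℝ => (s, (0 : ℝ))) (nhds 0) (nhds 0) :=
    (by fun_prop : Continuous fun s : ℝ => (s, (0 : ℝ))).tendsto 0
  filter_upwards [h2.eventually h1] with s hs
  refine Filter.EventuallyEq.deriv_eq ?_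
  have h3 : Filter.Tendsto (fun t : ℝ => (s, t)) (nhds 0) (nhds (s, 0)) :=
    (by fun_prop : Continuous fun t : ℝ => (s, t)).tendsto 0
  exact h3.eventually hs

/-- Smooth dependence of the mixed derivative on parameters. -/
theorem ContDiffAt.mixedDeriv_param {F : Z × ℝ × ℝ → V} {z₀ : Z}
    (hF : ContDiffAt ℝ ∞ F (z₀, 0, 0)) :
    ContDiffAt ℝ ∞ (fun z => mixedDeriv fun x => F (z, x)) z₀ := by
  have h1 : ContDiffAt ℝ ∞ (fun y : (Z × ℝ) × ℝ => F (y.1.1, y.1.2, y.2)) ((z₀, 0), 0) :=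
    ContDiffAt.comp ((z₀, 0), 0) (f := fun y : (Z × ℝ) × ℝ => (y.1.1, y.1.2, y.2)) hF
      (by fun_prop)
  exact (ContDiffAt.deriv_param_zero h1).deriv_param_zero

/-- Smoothness rules out that the outer `deriv` in `mixedDeriv` is only the default value `0`. -/
theorem ContDiffAt.hasDerivAt_mixedDeriv {f : ℝ × ℝ → V} (hf : ContDiffAt ℝ ∞ f 0) :
    HasDerivAt (fun s => deriv (fun t => f (s, t)) 0) (mixedDeriv f) 0 :=
  ((ContDiffAt.deriv_param_zero (z₀ := (0 : ℝ)) hf).differentiableAt (by simp)).hasDerivAt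

/-- In the preferred chart at `p` the curve `Ψ ∘ c` is `c` itself, so its velocity is the derivative
of `c` with no change of coordinates. -/
theorem hasVelocity_extChartAt_symm {p : N} {Ψ : V → N}
    (hΨ : Ψ =ᶠ[nhds (extChartAt 𝓘(ℝ, V) p p)] (extChartAt 𝓘(ℝ, V) p).symm)
    {c : ℝ → V} {v : V} (hc : HasDerivAt c v 0) (hc0 : c 0 = extChartAt 𝓘(ℝ, V) p p) :
    HasVelocity (V := V) (fun t : ℝ => Ψ (c t)) v := by
  have ht : Filter.Tendsto c (nhds 0) (nhds (extChartAt 𝓘(ℝ, V) p p)) := by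
    rw [← hc0]; exact hc.continuousAt
  have h1 : (fun t => Ψ (c t)) =ᶠ[nhds 0] fun t => (extChartAt 𝓘(ℝ, V) p).symm (c t) :=
    ht.eventually hΨ
  refine HasVelocity.congr ?_ h1
  rw [hasVelocity_iff (e := p) (by simp [hc0])]
  constructor
  · refine ContinuousAt.comp (g := (extChartAt 𝓘(ℝ, V) p).symm) ?_ hc.continuousAt
    rw [hc0]
    exact continuousAt_extChartAt_symm p
  · refine hc.congr_of_eventuallyEq ?_
    have h2 := (isOpen_extChartAt_target (I := 𝓘(ℝ, V)) p).mem_nhds (mem_extChartAt_target p)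
    filter_upwards [ht.eventually h2] with t ht
    exact (extChartAt 𝓘(ℝ, V) p).right_inv ht

theorem HasMixedDeriv.unique {u : ℝ → ℝ → N} {e : N} {b b' : V}
    (h : HasMixedDeriv (V := V) u e b) (h' : HasMixedDeriv (V := V) u e b') : b = b' := by
  obtain ⟨-, w, hw, hb⟩ := h
  obtain ⟨-, w', hw', hb'⟩ := h'
  have : w = w' := funext fun s => (hw s).unique (hw' s)
  subst this
  exact hb.unique hb'

theorem HasMixedDeriv.comp_mul {u : ℝ → ℝ → N} {e : N} {b : V}
    (h : HasMixedDeriv (V := V) u e b) (r q : ℝ) :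
    HasMixedDeriv (V := V) (fun s t => u (r * s) (q * t)) e ((r * q) • b : V) := by
  obtain ⟨h0, w, hw, hb⟩ := h
  refine ⟨fun s => by simp [h0], fun s => q • w (r * s), fun s => (hw _).comp_mul q, ?_⟩
  have hr : HasDerivAt (fun t : ℝ => r * t) r 0 := by simpa using (hasDerivAt_id (0 : ℝ)).const_mul r
  have hb' : HasDerivAt w b (r * 0) := by simpa using hb
  have := (hb'.scomp (0 : ℝ) hr).const_smul q
  convert! this using 1
  rw [smul_smul, mul_comm]

/-- Since `u s 0 = e` for all `s`, one fixed linear map carries every inner derivative, and no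
second derivative of `f` enters. -/
theorem HasMixedDeriv.comp_mfderiv {u : ℝ → ℝ → N} {e : N} {b : V}
    (h : HasMixedDeriv (V := V) u e b) {f : N → N'}
    (hf : MDifferentiableAt 𝓘(ℝ, V) 𝓘(ℝ, V') f e) :
    HasMixedDeriv (V := V') (fun s t => f (u s t)) (f e) (mfderiv 𝓘(ℝ, V) 𝓘(ℝ, V') f e b) := by
  obtain ⟨h0, w, hw, hb⟩ := h
  let L : V →L[ℝ] V' := mfderiv 𝓘(ℝ, V) 𝓘(ℝ, V') f e
  refine ⟨fun s => by simp [h0], fun s => L (w s), fun s => ?_, ?_⟩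
  · have h1 := (hw s).comp_mfderiv (f := f) (by rw [h0]; exact hf)
    have h2 : (mfderiv 𝓘(ℝ, V) 𝓘(ℝ, V') f (u s 0) (w s) : V') = L (w s) := by
      simp only [L]
      rw [h0 s]
      rfl
    exact (congrArg (HasVelocity (V := V') fun t => f (u s t)) h2).mp h1
  · exact L.hasFDerivAt.comp_hasDerivAt 0 hb

variable [IsManifold 𝓘(ℝ, V) ∞ N]

theorem ContMDiffAt.contDiffAt_extChartAt {f : Z → N} {z₀ : Z} {e : N}
    (hf : ContMDiffAt 𝓘(ℝ, Z) 𝓘(ℝ, V) ∞ f z₀) (he : f z₀ ∈ (extChartAt 𝓘(ℝ, V) e).source) :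
    ContDiffAt ℝ ∞ (fun z => extChartAt 𝓘(ℝ, V) e (f z)) z₀ := by
  rw [← contMDiffAt_iff_contDiffAt]
  exact ContMDiffAt.comp z₀ (contMDiffAt_extChartAt' (by simpa using he)) hf

theorem ContMDiffAt.hasVelocity {c : ℝ → N} {e : N} (hc : ContMDiffAt 𝓘(ℝ, ℝ) 𝓘(ℝ, V) ∞ c 0)
    (h0 : c 0 = e) :
    HasVelocity (V := V) c (deriv (fun t => extChartAt 𝓘(ℝ, V) e (c t)) 0) := by
  refine (hasVelocity_iff h0 _).2 ⟨hc.continuousAt, DifferentiableAt.hasDerivAt ?_⟩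
  exact (hc.contDiffAt_extChartAt (by rw [h0]; exact mem_extChartAt_source e)).differentiableAt
    (by simp)

/-- A global smooth map which near a given point is the inverse of a chart. -/
theorem exists_contMDiff_eq_extChartAt_symm [FiniteDimensional ℝ V] (p₀ : N) {z₀ : V}
    (hz₀ : z₀ ∈ (extChartAt 𝓘(ℝ, V) p₀).target) :
    ∃ Ψ : V → N, ContMDiff 𝓘(ℝ, V) 𝓘(ℝ, V) ∞ Ψ ∧
      Ψ =ᶠ[nhds z₀] (extChartAt 𝓘(ℝ, V) p₀).symm := by
  obtain ⟨ρ, hρ, hρU, hρ1⟩ := exists_contDiff_cutoff z₀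
    ((isOpen_extChartAt_target (I := 𝓘(ℝ, V)) p₀).mem_nhds hz₀)
  refine ⟨fun z => (extChartAt 𝓘(ℝ, V) p₀).symm (ρ z), fun z => ?_, ?_⟩
  · exact ((contMDiffOn_extChartAt_symm p₀).contMDiffAt
      ((isOpen_extChartAt_target (I := 𝓘(ℝ, V)) p₀).mem_nhds (hρU z))).comp z hρ.contMDiff.contMDiffAt
  · filter_upwards [hρ1] with z hz
    rw [hz, id]

/-- This translates components of forms in the chart at `p₀` into rates along straight coordinate
lines, at every `z` in the target and not only at the image of `p₀`. -/
theorem hasVelocity_chartVector {p₀ : N} {z : V} (hz : z ∈ (extChartAt 𝓘(ℝ, V) p₀).target)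
    {Ψ : V → N} (hΨ : Ψ =ᶠ[nhds z] (extChartAt 𝓘(ℝ, V) p₀).symm) (v : V) :
    HasVelocity (V := V) (fun t : ℝ => Ψ (z + t • v)) (chartVector p₀ z v) := by
  have hl : HasVelocity (V := V) (fun t : ℝ => z + t • v) v := by
    refine (hasVelocity_iff rfl _).2 ⟨by fun_prop, ?_⟩
    have h := ((hasDerivAt_id (0 : ℝ)).smul_const v).const_add z
    rw [one_smul] at h
    exact h
  have hz0 : (fun t : ℝ => z + t • v) 0 = z := by simp
  have hd : MDifferentiableAt 𝓘(ℝ, V) 𝓘(ℝ, V) (extChartAt 𝓘(ℝ, V) p₀).symm z :=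
    ((contMDiffOn_extChartAt_symm (n := ∞) p₀).contMDiffAt
      ((isOpen_extChartAt_target (I := 𝓘(ℝ, V)) p₀).mem_nhds hz)).mdifferentiableAt (by simp)
  have h1 := hl.comp_mfderiv (f := (extChartAt 𝓘(ℝ, V) p₀).symm) (by simpa using hd)
  have h2 : mfderiv 𝓘(ℝ, V) 𝓘(ℝ, V) (extChartAt 𝓘(ℝ, V) p₀).symm (z + (0 : ℝ) • v) v
     = (chartVector p₀ z v : V) := by
    unfold chartVector
    rw [zero_smul, add_zero]
  have h3 : HasVelocity (V := V) (fun t : ℝ => (extChartAt 𝓘(ℝ, V) p₀).symm (z + t • v))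
      (chartVector p₀ z v : V) := h2 ▸ h1
  refine h3.congr ?_
  have ht : Filter.Tendsto (fun t : ℝ => z + t • v) (nhds 0) (nhds z) := by
    have : Continuous fun t : ℝ => z + t • v := by fun_prop
    simpa using this.tendsto 0
  exact ht.eventually hΨ

/-- Local coordinates of a smooth map, cut off so as to be global. -/
theorem exists_contDiff_coordinates [FiniteDimensional ℝ Z] {p : N} {Ψ : V → N}
    (hΨ : Ψ =ᶠ[nhds (extChartAt 𝓘(ℝ, V) p p)] (extChartAt 𝓘(ℝ, V) p).symm)
    {f : Z → N} (hf : ContMDiff 𝓘(ℝ, Z) 𝓘(ℝ, V) ∞ f) (hf0 : f 0 = p) :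
    ∃ c : Z → V, ContDiff ℝ ∞ c ∧ c 0 = 0 ∧
      f =ᶠ[nhds 0] fun z => Ψ (extChartAt 𝓘(ℝ, V) p p + c z) := by
  obtain ⟨O, hO, hOo, hOp⟩ := mem_nhds_iff.1 hΨ
  -- The argument of `f` is cut off to the set where the chart is defined and `Ψ` inverts it.
  have hU : f ⁻¹' ((extChartAt 𝓘(ℝ, V) p).source ∩ extChartAt 𝓘(ℝ, V) p ⁻¹' O) ∈ nhds (0 : Z) := by
    refine hf.continuous.continuousAt.preimage_mem_nhds ?_
    rw [hf0]
    exact Filter.inter_mem (extChartAt_source_mem_nhds p)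
      ((continuousAt_extChartAt p).preimage_mem_nhds (hOo.mem_nhds hOp))
  obtain ⟨ρ, hρ, hρU, hρ1⟩ := exists_contDiff_cutoff (0 : Z) hU
  refine ⟨fun z => extChartAt 𝓘(ℝ, V) p (f (ρ z)) - extChartAt 𝓘(ℝ, V) p p, ?_, ?_, ?_⟩
  · refine ContDiff.sub ?_ contDiff_const
    rw [contDiff_iff_contDiffAt]
    intro z
    exact ContMDiffAt.contDiffAt_extChartAt ((hf.comp hρ.contMDiff).contMDiffAt) (hρU z).1
  · have : ρ 0 = 0 := hρ1.eq_of_nhds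
    simp [this, hf0]
  · filter_upwards [hρ1] with z hz
    have h1 := hρU z
    rw [hz, id] at h1 ⊢
    rw [add_sub_cancel, hO h1.2, (extChartAt 𝓘(ℝ, V) p).left_inv h1.1]

/-- There are smooth curves with any given velocity. -/
theorem exists_hasVelocity [FiniteDimensional ℝ V] (p : N) (X : V) :
    ∃ c : ℝ → N, ContMDiff 𝓘(ℝ, ℝ) 𝓘(ℝ, V) ∞ c ∧ c 0 = p ∧ HasVelocity (V := V) c X := by
  obtain ⟨Ψ, hΨs, hΨ⟩ := exists_contMDiff_eq_extChartAt_symm p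
    (mem_extChartAt_target (I := 𝓘(ℝ, V)) p)
  refine ⟨fun t => Ψ (extChartAt 𝓘(ℝ, V) p p + t • X),
    hΨs.comp (contDiff_const.add (contDiff_id.smul contDiff_const)).contMDiff, ?_, ?_⟩
  · simp only [zero_smul, add_zero]
    rw [hΨ.eq_of_nhds, extChartAt_to_inv]
  · have h : HasDerivAt (fun t : ℝ => extChartAt 𝓘(ℝ, V) p p + t • X) X 0 := by
      have := ((hasDerivAt_id (0 : ℝ)).smul_const X).const_add (extChartAt 𝓘(ℝ, V) p p)
      rwa [one_smul] at this
    exact hasVelocity_extChartAt_symm hΨ h (by simp)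

/-- All curves `u s` start at `e`, so a single chart computes all inner derivatives. -/
theorem ContMDiff.hasMixedDeriv {u : ℝ → ℝ → N} {e : N}
    (hu : ContMDiff 𝓘(ℝ, ℝ × ℝ) 𝓘(ℝ, V) ∞ (fun x : ℝ × ℝ => u x.1 x.2)) (h0 : ∀ s, u s 0 = e) :
    HasMixedDeriv (V := V) u e
      (mixedDeriv (V := V) fun x : ℝ × ℝ => extChartAt 𝓘(ℝ, V) e (u x.1 x.2)) := by
  refine ⟨h0, fun s => deriv (fun t => extChartAt 𝓘(ℝ, V) e (u s t)) 0, fun s => ?_, ?_⟩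
  · refine ContMDiffAt.hasVelocity ?_ (h0 s)
    exact (hu.comp (contDiff_const.prodMk contDiff_id : ContDiff ℝ ∞ fun t : ℝ =>
      (s, t)).contMDiff).contMDiffAt
  · refine ContDiffAt.hasDerivAt_mixedDeriv
      (f := fun x : ℝ × ℝ => extChartAt 𝓘(ℝ, V) e (u x.1 x.2)) ?_
    exact ContMDiffAt.contDiffAt_extChartAt (z₀ := (0 : ℝ × ℝ)) hu.contMDiffAt
      (by simp only [Prod.fst_zero, Prod.snd_zero, h0]; exact mem_extChartAt_source e)

end ManifoldCalculus

end

noncomputable section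

/-! ### Algebra of 2-torsors -/

section TorsorAlgebra

variable {EG : Type*} [NormedAddCommGroup EG] [NormedSpace ℝ EG]
  {EH : Type*} [NormedAddCommGroup EH] [NormedSpace ℝ EH]
  {G : Type*} [TopologicalSpace G] [ChartedSpace EG G] [Group G] [LieGroup 𝓘(ℝ, EG) ∞ G]
  {H : Type*} [TopologicalSpace H] [ChartedSpace EH H] [Group H] [LieGroup 𝓘(ℝ, EH) ∞ H]
  {C : SmoothCrossedModule EG EH G H}

namespace TwoTorsor

theorem act₀_div (X : TwoTorsor C) (q p : X.X₀) : X.act₀ p (X.div q p) = q :=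
  (X.free_transitive₀ p q).choose_spec.1

theorem act₀_injective (X : TwoTorsor C) (p : X.X₀) : Function.Injective (X.act₀ p) :=
  fun _ _ h => (X.free_transitive₀ p _).unique h rfl

theorem div_eq (X : TwoTorsor C) {q p : X.X₀} {g : G} (h : X.act₀ p g = q) : X.div q p = g :=
  X.act₀_injective p ((X.act₀_div q p).trans h.symm)

theorem act₁_injective (X : TwoTorsor C) (x : X.X₁) : Function.Injective (X.act₁ x) :=
  fun _ _ h => (X.free_transitive₁ x _).unique h rfl

/-- Comparing sources and using freeness on objects, the `G`-component of `x : id` is `1`, so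
nothing is lost in keeping only the `H`-component. -/
theorem act₁_hdiv (X : TwoTorsor C) (x : X.X₁) :
    X.act₁ (X.ident (X.src x)) ⟨X.hdiv x, 1⟩ = x := by
  have h : X.act₁ (X.ident (X.src x)) (X.div₁ x (X.ident (X.src x))) = x :=
    (X.free_transitive₁ _ _).choose_spec.1
  have h1 : (X.div₁ x (X.ident (X.src x))).right = 1 := by
    have h2 := congrArg X.src h
    rw [X.src_act, X.src_ident] at h2
    exact X.act₀_injective _ (h2.trans (X.act₀_one _).symm)
  have h3 : (⟨X.hdiv x, 1⟩ : H ⋊[C.α] G) = X.div₁ x (X.ident (X.src x)) :=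
    SemidirectProduct.ext rfl h1.symm
  rw [h3, h]

theorem hdiv_eq (X : TwoTorsor C) {x : X.X₁} {q : X.X₀} {h : H}
    (hx : X.act₁ (X.ident q) ⟨h, 1⟩ = x) : X.hdiv x = h := by
  have hq : X.src x = q := by
    rw [← hx, X.src_act, X.src_ident, X.act₀_one]
  have h1 := X.act₁_hdiv x
  rw [hq] at h1
  exact congrArg SemidirectProduct.left (X.act₁_injective _ (h1.trans hx.symm))

/-- The origin of fake-flatness: source and target of a morphism differ by `t` of its `H`-value. -/
theorem tgt_eq (X : TwoTorsor C) (x : X.X₁) : X.tgt x = X.act₀ (X.src x) (C.t (X.hdiv x)) := by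
  conv_lhs => rw [← X.act₁_hdiv x, X.tgt_act, X.tgt_ident, mul_one]

theorem hdiv_ident (X : TwoTorsor C) (p : X.X₀) : X.hdiv (X.ident p) = 1 :=
  X.hdiv_eq (X.act₁_one _)

/-- In the semidirect product `⟨h, 1⟩ ⟨1, g⟩ = ⟨1, g⟩ ⟨α g⁻¹ h, 1⟩`. -/
theorem hdiv_act (X : TwoTorsor C) (x : X.X₁) (g : G) :
    X.hdiv (X.act₁ x ⟨1, g⟩) = C.α g⁻¹ (X.hdiv x) := by
  refine X.hdiv_eq (q := X.act₀ (X.src x) g) ?_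
  conv_rhs => rw [← X.act₁_hdiv x]
  rw [X.ident_act, ← X.act₁_mul, ← X.act₁_mul]
  congr 1
  ext <;> simp

theorem hdiv_map (X Y : TwoTorsor C) (f : Hom X Y) (x : X.X₁) :
    Y.hdiv (f.map₁ x) = X.hdiv x := by
  refine Y.hdiv_eq (q := f.map₀ (X.src x)) ?_
  rw [← f.map_ident, ← f.map₁_act, X.act₁_hdiv]

theorem comp_congr (X : TwoTorsor C) {x x' y y' : X.X₁} (hx : x = x') (hy : y = y')
    (h : X.tgt x = X.src y) : X.comp x y h = X.comp x' y' (by rw [← hx, ← hy, h]) := by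
  subst hx hy; rfl

/-- Functoriality of the action applies once both morphisms are translates of the identity at the
source of `x`. With `h`, `h'` the values of `x`, `y`, this turns `h'` into `α (t h) h'`, and the
Peiffer identity gives `α (t h) h' * h = h * h'`. -/
theorem hdiv_comp (X : TwoTorsor C) (x y : X.X₁) (h : X.tgt x = X.src y) :
    X.hdiv (X.comp x y h) = X.hdiv x * X.hdiv y := by
  have hx : x = X.act₁ (X.ident (X.src x)) ⟨X.hdiv x, 1⟩ := (X.act₁_hdiv x).symm
  have hy : y = X.act₁ (X.ident (X.src x))
      ⟨C.α (C.t (X.hdiv x)) (X.hdiv y), C.t (X.hdiv x) * 1⟩ := by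
    conv_lhs => rw [← X.act₁_hdiv y, ← h, X.tgt_eq, X.ident_act, ← X.act₁_mul]
    congr 1
    ext <;> simp
  refine X.hdiv_eq (q := X.src x) ?_
  have h1 : X.tgt (X.ident (X.src x)) = X.src (X.ident (X.src x)) := by
    rw [X.tgt_ident, X.src_ident]
  rw [X.comp_congr hx hy h, X.comp_act _ _ h1]
  congr 1
  · have h2 := X.ident_comp (X.ident (X.src x))
    rw [← X.comp_congr (congrArg X.ident (X.src_ident (X.src x)).symm) rfl h1] at h2
    exact h2.symm
  · ext <;> simp [C.α_t]

end TwoTorsor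

end TorsorAlgebra

/-! ### Thin homotopies of paths and bigons -/

section PathAlgebra

variable {E : Type*} [NormedAddCommGroup E] [NormedSpace ℝ E]
  {M : Type*} [TopologicalSpace M] [ChartedSpace E M]

theorem SmoothPath.source {x y : M} (γ : SmoothPath E x y) {v : ℝ} (hv : v ≤ 0) :
    γ.toFun v = x := by
  obtain ⟨ε, hε, h0, -⟩ := γ.sitting
  exact h0 v (by linarith)

theorem SmoothPath.target {x y : M} (γ : SmoothPath E x y) {v : ℝ} (hv : 1 ≤ v) :
    γ.toFun v = y := by
  obtain ⟨ε, hε, -, h1⟩ := γ.sitting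
  exact h1 v (by linarith)

theorem SmoothPath.ext {x y : M} {γ γ' : SmoothPath E x y} (h : γ.toFun = γ'.toFun) : γ = γ' := by
  cases γ; cases γ'; cases h; rfl

theorem SmoothPath.reverse_reverse {x y : M} (γ : SmoothPath E x y) : γ.reverse.reverse = γ :=
  SmoothPath.ext (funext fun v => by simp [SmoothPath.reverse])

theorem Bigon.source_toFun {x y : M} {γ₀ γ₁ : SmoothPath E x y} (S : Bigon γ₀ γ₁) (v : ℝ) :
    S.toFun (0, v) = γ₀.toFun v := by
  obtain ⟨ε, hε, -, -, h, -⟩ := S.sitting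
  exact h 0 hε.le v

theorem Bigon.target_toFun {x y : M} {γ₀ γ₁ : SmoothPath E x y} (S : Bigon γ₀ γ₁) (v : ℝ) :
    S.toFun (1, v) = γ₁.toFun v := by
  obtain ⟨ε, hε, -, -, -, h⟩ := S.sitting
  exact h 1 (by linarith) v

theorem Bigon.ext {x y : M} {γ₀ γ₁ : SmoothPath E x y} {S S' : Bigon γ₀ γ₁}
    (h : S.toFun = S'.toFun) : S = S' := by
  cases S; cases S'; cases h; rfl

/-- A map factoring through the real line has rank at most one. -/
theorem rankAtMost_comp_real {V : Type*} [NormedAddCommGroup V] [NormedSpace ℝ V] {k : ℕ}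
    (hk : 1 ≤ k) {f : ℝ → M} (hf : ContMDiff 𝓘(ℝ, ℝ) 𝓘(ℝ, E) ∞ f) {m : V → ℝ}
    (hm : ContDiff ℝ ∞ m) : RankAtMost E k (fun z => f (m z)) := by
  intro z
  have h1 : mfderiv 𝓘(ℝ, V) 𝓘(ℝ, E) (fun z => f (m z)) z =
      (mfderiv 𝓘(ℝ, ℝ) 𝓘(ℝ, E) f (m z)).comp (mfderiv 𝓘(ℝ, V) 𝓘(ℝ, ℝ) m z) :=
    mfderiv_comp (I' := 𝓘(ℝ, ℝ)) z ((hf (m z)).mdifferentiableAt (by simp))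
      ((hm.contMDiff z).mdifferentiableAt (by simp))
  rw [h1]
  refine (LinearMap.rank_comp_le_left (mfderiv 𝓘(ℝ, V) 𝓘(ℝ, ℝ) m z).toLinearMap
    (mfderiv 𝓘(ℝ, ℝ) 𝓘(ℝ, E) f (m z)).toLinearMap).trans ?_
  have h2 := lift_rank_range_le (mfderiv 𝓘(ℝ, ℝ) 𝓘(ℝ, E) f (m z)).toLinearMap
  have h3 : Module.rank ℝ (TangentSpace 𝓘(ℝ, ℝ) (m z)) = 1 := Module.rank_self ℝ
  rw [h3, Cardinal.lift_one, Cardinal.lift_id'] at h2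
  exact h2.trans (by exact_mod_cast hk)

/-- The smooth step used for sitting instants. -/
def midStep (v : ℝ) : ℝ := Real.smoothTransition (3 * v - 1)

theorem contDiff_midStep : ContDiff ℝ ∞ midStep :=
  Real.smoothTransition.contDiff.comp ((contDiff_const.mul contDiff_id).sub contDiff_const)

theorem midStep_of_le {v : ℝ} (hv : v ≤ 1 / 3) : midStep v = 0 :=
  Real.smoothTransition.zero_of_nonpos (by linarith)

theorem midStep_of_ge {v : ℝ} (hv : 2 / 3 ≤ v) : midStep v = 1 :=
  Real.smoothTransition.one_of_one_le (by linarith)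

theorem midStep_nonneg (v : ℝ) : 0 ≤ midStep v := Real.smoothTransition.nonneg _

theorem midStep_le_one (v : ℝ) : midStep v ≤ 1 := Real.smoothTransition.le_one _

/-- Reparametrization of a path by the standard step. -/
def SmoothPath.reparam {x y : M} (γ : SmoothPath E x y) : SmoothPath E x y where
  toFun v := γ.toFun (midStep v)
  smooth := γ.smooth.comp contDiff_midStep.contMDiff
  sitting := ⟨1 / 3, by norm_num, fun v hv => by rw [midStep_of_le hv, γ.source le_rfl],
    fun v hv => by rw [midStep_of_ge (by linarith), γ.target le_rfl]⟩

/-- The bigon from a path to its reparametrization. -/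
def SmoothPath.reparamBigon {x y : M} (γ : SmoothPath E x y) : Bigon γ γ.reparam where
  toFun z := γ.toFun ((1 - midStep z.1) * z.2 + midStep z.1 * midStep z.2)
  smooth := γ.smooth.comp ((((contDiff_const.sub (contDiff_midStep.comp contDiff_fst)).mul
    contDiff_snd).add ((contDiff_midStep.comp contDiff_fst).mul
    (contDiff_midStep.comp contDiff_snd))).contMDiff)
  sitting := by
    obtain ⟨ε, hε, h0, h1⟩ := γ.sitting
    have e1 := min_le_left ε (1 / 3)
    have e2 := min_le_right ε (1 / 3)
    refine ⟨min ε (1 / 3), by positivity, fun u v hv => h0 _ ?_, fun u v hv => h1 _ ?_,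
      fun u hu v => ?_, fun u hu v => ?_⟩
    · rw [midStep_of_le (v := v) (by linarith)]
      nlinarith [midStep_nonneg u, midStep_le_one u]
    · rw [midStep_of_ge (v := v) (by linarith)]
      nlinarith [midStep_nonneg u, midStep_le_one u]
    · simp [midStep_of_le (v := u) (by linarith)]
    · simp [midStep_of_ge (v := u) (by linarith), SmoothPath.reparam]

/-- The homotopy only moves the parameter, hence factors through the real line. -/
theorem SmoothPath.thinHomotopic_reparam {x y : M} (γ : SmoothPath E x y) :
    γ.ThinHomotopic γ.reparam :=
  ⟨γ.reparamBigon, rankAtMost_comp_real le_rfl γ.smooth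
    (((contDiff_const.sub (contDiff_midStep.comp contDiff_fst)).mul
    contDiff_snd).add ((contDiff_midStep.comp contDiff_fst).mul
    (contDiff_midStep.comp contDiff_snd)))⟩

theorem SmoothPath.thinHomotopic_reparam_reverse {x y : M} (γ : SmoothPath E x y) :
    γ.reverse.ThinHomotopic γ.reparam.reverse := by
  have h : ContDiff ℝ ∞ fun z : ℝ × ℝ =>
      (1 - midStep z.1) * (1 - z.2) + midStep z.1 * midStep (1 - z.2) := by
    have h2 : ContDiff ℝ ∞ fun z : ℝ × ℝ => 1 - z.2 := contDiff_const.sub contDiff_snd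
    exact ((contDiff_const.sub (contDiff_midStep.comp contDiff_fst)).mul h2).add
      ((contDiff_midStep.comp contDiff_fst).mul (contDiff_midStep.comp h2))
  exact ⟨γ.reparamBigon.hinv, rankAtMost_comp_real le_rfl γ.smooth h⟩

/-- A path followed by its reverse can be contracted. -/
theorem SmoothPath.thinHomotopic_trans_reverse {x y : M} (γ : SmoothPath E x y) :
    (γ.reparam.trans γ.reparam.reverse).ThinHomotopic (SmoothPath.const E x) := by
  -- The parameter runs out by `midStep (2 v)` and back by `midStep (2 - 2 v)`. On each half of the
  -- interval one of the two factors is `1`, so their product is a smooth formula for going there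
  -- and back; scaling it to `0` contracts the path. This is why the path is reparametrized by
  -- `midStep`.
  have hm : ContDiff ℝ ∞ fun z : ℝ × ℝ => (1 - midStep z.1) * (midStep (2 * z.2) *
      midStep (2 - 2 * z.2)) :=
    (contDiff_const.sub (contDiff_midStep.comp contDiff_fst)).mul
      ((contDiff_midStep.comp (contDiff_const.mul contDiff_snd)).mul
        (contDiff_midStep.comp (contDiff_const.sub (contDiff_const.mul contDiff_snd))))
  refine ⟨⟨fun z => γ.toFun ((1 - midStep z.1) * (midStep (2 * z.2) * midStep (2 - 2 * z.2))),
    γ.smooth.comp hm.contMDiff, 1 / 6, by norm_num, fun u v hv => ?_, fun u v hv => ?_,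
    fun u hu v => ?_, fun u hu v => ?_⟩, rankAtMost_comp_real le_rfl γ.smooth hm⟩
  · simp [midStep_of_le (v := 2 * v) (by linarith), γ.source]
  · simp [midStep_of_le (v := 2 - 2 * v) (by linarith), γ.source]
  · simp only [midStep_of_le (v := u) (by linarith), SmoothPath.trans, SmoothPath.reverse,
      SmoothPath.reparam, sub_zero, one_mul]
    split_ifs with h
    · rw [midStep_of_ge (v := 2 - 2 * v) (by linarith), mul_one]
    · rw [midStep_of_ge (v := 2 * v) (by linarith), one_mul]
      congr 2
      ring
  · simp [midStep_of_ge (v := u) (by linarith), SmoothPath.const, γ.source]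

/-- A bigon factoring through the real line is thinly homotopic to an identity. -/
theorem Bigon.thinHomotopic_id {x y : M} {γ₀ γ₁ : SmoothPath E x y} (S : Bigon γ₀ γ₁)
    {a b : ℝ} {δ₀ δ₁ : SmoothPath ℝ a b} (T : Bigon δ₀ δ₁) {f : ℝ → M}
    (hf : ContMDiff 𝓘(ℝ, ℝ) 𝓘(ℝ, E) ∞ f) (hS : ∀ z, S.toFun z = f (T.toFun z)) :
    S.ThinHomotopic (Bigon.id γ₀) := by
  have hT : ContDiff ℝ ∞ T.toFun := contMDiff_iff_contDiff.1 T.smooth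
  -- Linear interpolation on the real line from `T` to its source path, pushed forward by `f`. The
  -- whole homotopy factors through the line, so all rank conditions hold, also on the face `u = 1`,
  -- which moves from `γ₁` to `γ₀`.
  have hm : ContDiff ℝ ∞ fun z : ℝ × ℝ × ℝ => (1 - midStep z.1) * T.toFun (z.2.1, z.2.2) +
      midStep z.1 * T.toFun (0, z.2.2) := by
    have h1 : ContDiff ℝ ∞ fun z : ℝ × ℝ × ℝ => T.toFun (z.2.1, z.2.2) := hT.comp (by fun_prop)
    have h2 : ContDiff ℝ ∞ fun z : ℝ × ℝ × ℝ => T.toFun (0, z.2.2) :=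
      hT.comp (by fun_prop : ContDiff ℝ ∞ fun z : ℝ × ℝ × ℝ => ((0 : ℝ), z.2.2))
    exact ((contDiff_const.sub (contDiff_midStep.comp contDiff_fst)).mul h1).add
      ((contDiff_midStep.comp contDiff_fst).mul h2)
  have hface : ∀ u : ℝ, ContDiff ℝ ∞ fun z : ℝ × ℝ => ((z.1, u, z.2) : ℝ × ℝ × ℝ) :=
    fun u => by fun_prop
  obtain ⟨ε, hε, h0, h1, h2, h3⟩ := T.sitting
  have e1 := min_le_left ε (1 / 3)
  have e2 := min_le_right ε (1 / 3)
  have ea : f a = x := by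
    rw [← h0 0 0 hε.le, ← hS, S.source_toFun, γ₀.source le_rfl]
  have eb : f b = y := by
    rw [← h1 0 1 (by linarith), ← hS, S.source_toFun, γ₀.target le_rfl]
  refine ⟨fun z => f ((1 - midStep z.1) * T.toFun (z.2.1, z.2.2) +
      midStep z.1 * T.toFun (0, z.2.2)), hf.comp hm.contMDiff,
    rankAtMost_comp_real (by norm_num) hf hm,
    rankAtMost_comp_real le_rfl hf (hm.comp (hface 0)),
    rankAtMost_comp_real le_rfl hf (hm.comp (hface 1)), min ε (1 / 3), by positivity,
    fun r hr u v => ?_, fun r hr u v => ?_, fun r u hu v => ?_, fun r u hu v => ?_,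
    fun r u v hv => ?_, fun r u v hv => ?_⟩ <;> dsimp only
  · rw [midStep_of_le (v := r) (by linarith), hS]
    congr 1; ring
  · rw [midStep_of_ge (v := r) (by linarith)]
    change _ = γ₀.toFun v
    rw [← S.source_toFun, hS]
    congr 1; ring
  · rw [h2 u (by linarith), h2 0 hε.le]
  · rw [h3 u (by linarith), h3 1 (by linarith)]
  · rw [h0 u v (by linarith), h0 0 v (by linarith), ← ea]
    congr 1; ring
  · rw [h1 u v (by linarith), h1 0 v (by linarith), ← eb]
    congr 1; ring

/-- The canonical path `(0,0) → (s,0) → (s,t)` is a concatenation. -/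
theorem southEastPath_eq (f : ℝ × ℝ → M) (hf : ContMDiff 𝓘(ℝ, ℝ × ℝ) 𝓘(ℝ, E) ∞ f) (s t : ℝ)
    (h₁ : ContMDiff 𝓘(ℝ, ℝ) 𝓘(ℝ, E) ∞ fun r => f (r, 0))
    (h₂ : ContMDiff 𝓘(ℝ, ℝ) 𝓘(ℝ, E) ∞ fun r => f (s, r)) :
    southEastPath f hf s t = (curvePath _ h₁ s).trans (curvePath _ h₂ t) := by
  refine SmoothPath.ext (funext fun v => ?_)
  simp only [southEastPath, SmoothPath.trans, curvePath, earlyStep, lateStep]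
  -- On the first half the late step is still `0`, on the second half the early step is already `1`;
  -- moreover `6v - 1 = 3(2v) - 1` and `6v - 4 = 3(2v - 1) - 1`.
  split_ifs with h
  · rw [Real.smoothTransition.zero_of_nonpos (x := 6 * v - 4) (by linarith), mul_zero]
    congr 4; ring
  · rw [Real.smoothTransition.one_of_one_le (x := 6 * v - 1) (by linarith), mul_one]
    congr 4; ring

/-- The canonical path `(0,0) → (0,t) → (s,t)` is a concatenation. -/
theorem westNorthPath_eq (f : ℝ × ℝ → M) (hf : ContMDiff 𝓘(ℝ, ℝ × ℝ) 𝓘(ℝ, E) ∞ f) (s t : ℝ)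
    (h₁ : ContMDiff 𝓘(ℝ, ℝ) 𝓘(ℝ, E) ∞ fun r => f (0, r))
    (h₂ : ContMDiff 𝓘(ℝ, ℝ) 𝓘(ℝ, E) ∞ fun r => f (r, t)) :
    westNorthPath f hf s t = (curvePath _ h₁ t).trans (curvePath _ h₂ s) := by
  refine SmoothPath.ext (funext fun v => ?_)
  simp only [westNorthPath, SmoothPath.trans, curvePath, earlyStep, lateStep]
  split_ifs with h
  · rw [Real.smoothTransition.zero_of_nonpos (x := 6 * v - 4) (by linarith), mul_zero]
    congr 4; ring
  · rw [Real.smoothTransition.one_of_one_le (x := 6 * v - 1) (by linarith), mul_one]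
    congr 4; ring

end PathAlgebra

/-! ### Algebraic consequences of functoriality -/

section FunctorAlgebra

variable {EG : Type*} [NormedAddCommGroup EG] [NormedSpace ℝ EG]
  {EH : Type*} [NormedAddCommGroup EH] [NormedSpace ℝ EH]
  {G : Type*} [TopologicalSpace G] [ChartedSpace EG G] [Group G] [LieGroup 𝓘(ℝ, EG) ∞ G]
  {H : Type*} [TopologicalSpace H] [ChartedSpace EH H] [Group H] [LieGroup 𝓘(ℝ, EH) ∞ H]
  {C : SmoothCrossedModule EG EH G H}
  {E : Type*} [NormedAddCommGroup E] [NormedSpace ℝ E]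
  {M : Type*} [TopologicalSpace M] [ChartedSpace E M]

namespace TransportTwoFunctor

variable (F : TransportTwoFunctor C E M)

theorem map₀_trans {x y z : M} (γ : SmoothPath E x y) (γ' : SmoothPath E y z)
    (p : (F.obj x).X₀) :
    (F.map (γ.trans γ')).map₀ p = (F.map γ').map₀ ((F.map γ).map₀ p) := by
  rw [F.map_trans]; rfl

theorem map₀_const (x : M) (p : (F.obj x).X₀) :
    (F.map (SmoothPath.const E x)).map₀ p = p := by
  rw [F.map_const]; rfl

/-- A path followed by its reverse is thinly contractible after reparametrization, and
reparametrization is itself a thin homotopy. -/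
theorem map₀_reverse_map₀ {x y : M} (γ : SmoothPath E x y) (p : (F.obj x).X₀) :
    (F.map γ.reverse).map₀ ((F.map γ).map₀ p) = p := by
  rw [F.map_thin γ.thinHomotopic_reparam, F.map_thin γ.thinHomotopic_reparam_reverse,
    ← F.map₀_trans, F.map_thin γ.thinHomotopic_trans_reverse, F.map₀_const]

theorem map₀_map₀_reverse {x y : M} (γ : SmoothPath E x y) (p : (F.obj y).X₀) :
    (F.map γ).map₀ ((F.map γ.reverse).map₀ p) = p := by
  have h := F.map₀_reverse_map₀ γ.reverse p
  rwa [γ.reverse_reverse] at h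

/-- Transport only depends on the function underlying a path. -/
theorem point_map₀_congr {x y x' y' : M} {γ : SmoothPath E x y} {γ' : SmoothPath E x' y'}
    (h : γ.toFun = γ'.toFun) {p : (F.obj x).X₀} {p' : (F.obj x').X₀}
    (hp : F.point x p = F.point x' p') :
    F.point y ((F.map γ).map₀ p) = F.point y' ((F.map γ').map₀ p') := by
  obtain rfl : x = x' := congrArg Sigma.fst hp
  obtain rfl : y = y' := by rw [← γ.target le_rfl, ← γ'.target le_rfl, h]
  obtain rfl := SmoothPath.ext h
  obtain rfl : p = p' := eq_of_heq (Sigma.mk.inj hp).2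
  rfl

/-- Surface transport only depends on the function underlying a bigon. -/
theorem hdiv_map₂_congr {x y x' y' : M} {γ₀ γ₁ : SmoothPath E x y} {γ₀' γ₁' : SmoothPath E x' y'}
    {S : Bigon γ₀ γ₁} {S' : Bigon γ₀' γ₁'} (h : S.toFun = S'.toFun) {p : (F.obj x).X₀}
    {p' : (F.obj x').X₀} (hp : F.point x p = F.point x' p') :
    (F.obj y).hdiv ((F.map₂ S).app p) = (F.obj y').hdiv ((F.map₂ S').app p') := by
  obtain rfl : x = x' := congrArg Sigma.fst hp
  obtain rfl : y = y' := by
    rw [← γ₀.target le_rfl, ← γ₀'.target le_rfl, ← S.source_toFun, ← S'.source_toFun, h]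
  obtain rfl : γ₀ = γ₀' := SmoothPath.ext (funext fun v => by
    rw [← S.source_toFun, ← S'.source_toFun, h])
  obtain rfl : γ₁ = γ₁' := SmoothPath.ext (funext fun v => by
    rw [← S.target_toFun, ← S'.target_toFun, h])
  obtain rfl := Bigon.ext h
  obtain rfl : p = p' := eq_of_heq (Sigma.mk.inj hp).2
  rfl

theorem hdiv_map₂_act {x y : M} {γ₀ γ₁ : SmoothPath E x y} (S : Bigon γ₀ γ₁) (p : (F.obj x).X₀)
    (g : G) : (F.obj y).hdiv ((F.map₂ S).app ((F.obj x).act₀ p g)) =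
      C.α g⁻¹ ((F.obj y).hdiv ((F.map₂ S).app p)) := by
  rw [(F.map₂ S).equivariant, TwoTorsor.hdiv_act]

theorem map₀_target {x y : M} {γ₀ γ₁ : SmoothPath E x y} (S : Bigon γ₀ γ₁) (p : (F.obj x).X₀) :
    (F.map γ₁).map₀ p = (F.obj y).act₀ ((F.map γ₀).map₀ p)
      (C.t ((F.obj y).hdiv ((F.map₂ S).app p))) := by
  rw [← (F.map₂ S).tgt_app, TwoTorsor.tgt_eq, (F.map₂ S).src_app]

theorem hdiv_map₂_factor {x y : M} {γ₀ γ₁ : SmoothPath E x y} (S : Bigon γ₀ γ₁)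
    {a b : ℝ} {δ₀ δ₁ : SmoothPath ℝ a b} (T : Bigon δ₀ δ₁) {f : ℝ → M}
    (hf : ContMDiff 𝓘(ℝ, ℝ) 𝓘(ℝ, E) ∞ f) (hS : ∀ z, S.toFun z = f (T.toFun z))
    (p : (F.obj x).X₀) : (F.obj y).hdiv ((F.map₂ S).app p) = 1 := by
  rw [F.map₂_thin _ _ (S.thinHomotopic_id T hf hS), F.map₂_id]
  exact TwoTorsor.hdiv_ident _ _

/-- The identity bigon contributes `1` to the product of `H`-values. Whiskering on the left
therefore only transports the base point, and whiskering on the right changes nothing, since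
equivariant functors preserve `H`-values. -/
theorem hdiv_map₂_whisker_left {x y z : M} (δ : SmoothPath E x y) {γ₀ γ₁ : SmoothPath E y z}
    (S : Bigon γ₀ γ₁) (p : (F.obj x).X₀) :
    (F.obj z).hdiv ((F.map₂ ((Bigon.id δ).hcomp S)).app p) =
      (F.obj z).hdiv ((F.map₂ S).app ((F.map δ).map₀ p)) := by
  rw [F.map₂_hcomp, TwoTorsor.TwoHom.hcompApp, TwoTorsor.hdiv_comp, F.map₂_id,
    TwoTorsor.hdiv_map]
  simp only [TwoTorsor.TwoHom.id]
  rw [TwoTorsor.hdiv_ident, one_mul]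

theorem hdiv_map₂_whisker_right {x y z : M} {γ₀ γ₁ : SmoothPath E x y} (S : Bigon γ₀ γ₁)
    (δ : SmoothPath E y z) (p : (F.obj x).X₀) :
    (F.obj z).hdiv ((F.map₂ (S.hcomp (Bigon.id δ))).app p) =
      (F.obj y).hdiv ((F.map₂ S).app p) := by
  rw [F.map₂_hcomp, TwoTorsor.TwoHom.hcompApp, TwoTorsor.hdiv_comp, F.map₂_id,
    TwoTorsor.hdiv_map]
  simp only [TwoTorsor.TwoHom.id]
  rw [TwoTorsor.hdiv_ident, mul_one]

end TransportTwoFunctor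

end FunctorAlgebra

end

noncomputable section

/-! ### Smooth families of paths and bigons -/

section Families

variable {E : Type*} [NormedAddCommGroup E] [NormedSpace ℝ E]
  {M : Type*} [TopologicalSpace M] [ChartedSpace E M]
  {Z : Type*} [NormedAddCommGroup Z] [NormedSpace ℝ Z]

/-- Agreement on one side of the slit suffices: where `l z > a` the glued map is `g` nearby, and
elsewhere `l z < 1 / 2` and it is `f` nearby. -/
theorem contMDiffOn_glue_left {f g : Z → M} {O : Set Z}
    (hf : ContMDiffOn 𝓘(ℝ, Z) 𝓘(ℝ, E) ∞ f O) (hg : ContMDiffOn 𝓘(ℝ, Z) 𝓘(ℝ, E) ∞ g O)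
    {l : Z → ℝ} (hl : Continuous l) {a : ℝ} (ha : a < 1 / 2)
    (hfg : ∀ z ∈ O, a < l z → l z ≤ 1 / 2 → f z = g z) :
    ContMDiffOn 𝓘(ℝ, Z) 𝓘(ℝ, E) ∞ (fun z => if l z ≤ 1 / 2 then f z else g z) O := by
  intro z hz
  by_cases h : a < l z
  · refine (hg z hz).congr_of_eventuallyEq_of_mem ?_ hz
    filter_upwards [self_mem_nhdsWithin, mem_nhdsWithin_of_mem_nhds
      ((isOpen_lt continuous_const hl).mem_nhds h)] with w hw hw'
    split_ifs with h1
    · exact hfg w hw hw' h1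
    · rfl
  · refine (hf z hz).congr_of_eventuallyEq_of_mem ?_ hz
    have h' : l z < 1 / 2 := by linarith [not_lt.1 h]
    filter_upwards [mem_nhdsWithin_of_mem_nhds
      ((isOpen_lt hl continuous_const).mem_nhds h')] with w hw
    exact if_pos (le_of_lt hw)

theorem contMDiffOn_glue_right {f g : Z → M} {O : Set Z}
    (hf : ContMDiffOn 𝓘(ℝ, Z) 𝓘(ℝ, E) ∞ f O) (hg : ContMDiffOn 𝓘(ℝ, Z) 𝓘(ℝ, E) ∞ g O)
    {l : Z → ℝ} (hl : Continuous l) {b : ℝ} (hb : 1 / 2 < b)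
    (hfg : ∀ z ∈ O, 1 / 2 ≤ l z → l z < b → f z = g z) :
    ContMDiffOn 𝓘(ℝ, Z) 𝓘(ℝ, E) ∞ (fun z => if l z ≤ 1 / 2 then f z else g z) O := by
  intro z hz
  by_cases h : l z < b
  · refine (hf z hz).congr_of_eventuallyEq_of_mem ?_ hz
    filter_upwards [self_mem_nhdsWithin, mem_nhdsWithin_of_mem_nhds
      ((isOpen_lt hl continuous_const).mem_nhds h)] with w hw hw'
    split_ifs with h1
    · rfl
    · exact (hfg w hw (not_le.1 h1).le hw').symm
  · refine (hg z hz).congr_of_eventuallyEq_of_mem ?_ hz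
    have h' : 1 / 2 < l z := by linarith [not_lt.1 h]
    filter_upwards [mem_nhdsWithin_of_mem_nhds
      ((isOpen_lt continuous_const hl).mem_nhds h')] with w hw
    exact if_neg (not_le.2 hw)

/-- The family of paths `γ` is jointly smooth over `U`. -/
def SmoothPathFamily {x y : Z → M} (U : Set Z) (γ : ∀ z, SmoothPath E (x z) (y z)) : Prop :=
  ContMDiffOn 𝓘(ℝ, Z × ℝ) 𝓘(ℝ, E) ∞ (fun z : Z × ℝ => (γ z.1).toFun z.2) (U ×ˢ Set.univ)

/-- The family of bigons `S` is jointly smooth over `U`. -/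
def SmoothBigonFamily {x y : Z → M} (U : Set Z) {γ₀ γ₁ : ∀ z, SmoothPath E (x z) (y z)}
    (S : ∀ z, Bigon (γ₀ z) (γ₁ z)) : Prop :=
  ContMDiffOn 𝓘(ℝ, Z × ℝ × ℝ) 𝓘(ℝ, E) ∞ (fun z : Z × ℝ × ℝ => (S z.1).toFun z.2) (U ×ˢ Set.univ)

theorem SmoothPathFamily.comp_right {x y : Z → M} {U : Set Z}
    {γ : ∀ z, SmoothPath E (x z) (y z)} (h : SmoothPathFamily U γ) {m : ℝ → ℝ}
    (hm : ContDiff ℝ ∞ m) :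
    ContMDiffOn 𝓘(ℝ, Z × ℝ) 𝓘(ℝ, E) ∞ (fun z : Z × ℝ => (γ z.1).toFun (m z.2))
      (U ×ˢ Set.univ) :=
  ContMDiffOn.comp h (contDiff_fst.prodMk (hm.comp contDiff_snd)).contMDiff.contMDiffOn
    fun _ hz => ⟨hz.1, trivial⟩

theorem SmoothPathFamily.reverse {x y : Z → M} {U : Set Z}
    {γ : ∀ z, SmoothPath E (x z) (y z)} (h : SmoothPathFamily U γ) :
    SmoothPathFamily U fun z => (γ z).reverse :=
  h.comp_right (contDiff_const.sub contDiff_id)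

/-- Sitting instants of a family need not be uniform in the parameter. It is enough that one of the
two families sits uniformly at the junction, because each member of the other is in any case
constant beyond the unit interval. -/
theorem SmoothPathFamily.trans_left {x y w : Z → M} {U : Set Z}
    {γ : ∀ z, SmoothPath E (x z) (y z)} {γ' : ∀ z, SmoothPath E (y z) (w z)}
    (h : SmoothPathFamily U γ) (h' : SmoothPathFamily U γ') {a : ℝ} (ha : a < 1)
    (hs : ∀ z ∈ U, ∀ v ≥ a, (γ z).toFun v = y z) :
    SmoothPathFamily U fun z => (γ z).trans (γ' z) := by
  refine contMDiffOn_glue_left (f := fun z : Z × ℝ => (γ z.1).toFun (2 * z.2))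
    (g := fun z : Z × ℝ => (γ' z.1).toFun (2 * z.2 - 1)) (l := Prod.snd)
    (h.comp_right (contDiff_const.mul contDiff_id))
    (h'.comp_right ((contDiff_const.mul contDiff_id).sub contDiff_const)) continuous_snd
    (a := a / 2) (by linarith) fun z hz hl hl' => ?_
  rw [hs z.1 hz.1 _ (by linarith), (γ' z.1).source (by linarith)]

theorem SmoothPathFamily.trans_right {x y w : Z → M} {U : Set Z}
    {γ : ∀ z, SmoothPath E (x z) (y z)} {γ' : ∀ z, SmoothPath E (y z) (w z)}
    (h : SmoothPathFamily U γ) (h' : SmoothPathFamily U γ') {b : ℝ} (hb : 0 < b)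
    (hs : ∀ z ∈ U, ∀ v ≤ b, (γ' z).toFun v = y z) :
    SmoothPathFamily U fun z => (γ z).trans (γ' z) := by
  refine contMDiffOn_glue_right (f := fun z : Z × ℝ => (γ z.1).toFun (2 * z.2))
    (g := fun z : Z × ℝ => (γ' z.1).toFun (2 * z.2 - 1)) (l := Prod.snd)
    (h.comp_right (contDiff_const.mul contDiff_id))
    (h'.comp_right ((contDiff_const.mul contDiff_id).sub contDiff_const)) continuous_snd
    (b := (b + 1) / 2) (by linarith) fun z hz hl hl' => ?_
  rw [hs z.1 hz.1 _ (by linarith), (γ z.1).target (by linarith)]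

theorem SmoothPathFamily.const_path {x y : M} (γ : SmoothPath E x y) (U : Set Z) :
    SmoothPathFamily U fun _ : Z => γ :=
  (γ.smooth.comp contDiff_snd.contMDiff).contMDiffOn

theorem SmoothBigonFamily.comp_right {x y : Z → M} {U : Set Z}
    {γ₀ γ₁ : ∀ z, SmoothPath E (x z) (y z)} {S : ∀ z, Bigon (γ₀ z) (γ₁ z)}
    (h : SmoothBigonFamily U S) {m : ℝ → ℝ} (hm : ContDiff ℝ ∞ m) :
    ContMDiffOn 𝓘(ℝ, Z × ℝ × ℝ) 𝓘(ℝ, E) ∞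
      (fun z : Z × ℝ × ℝ => (S z.1).toFun (z.2.1, m z.2.2)) (U ×ˢ Set.univ) :=
  ContMDiffOn.comp h (contDiff_fst.prodMk ((contDiff_fst.comp contDiff_snd).prodMk
    (hm.comp (contDiff_snd.comp contDiff_snd)))).contMDiff.contMDiffOn
    fun _ hz => ⟨hz.1, trivial⟩

theorem SmoothPathFamily.id_bigon {x y : Z → M} {U : Set Z}
    {γ : ∀ z, SmoothPath E (x z) (y z)} (h : SmoothPathFamily U γ) :
    SmoothBigonFamily U fun z => Bigon.id (γ z) :=
  ContMDiffOn.comp h (contDiff_fst.prodMk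
    (contDiff_snd.comp contDiff_snd)).contMDiff.contMDiffOn fun _ hz => ⟨hz.1, trivial⟩

theorem SmoothBigonFamily.whisker_left {x y w : Z → M} {U : Set Z}
    {δ : ∀ z, SmoothPath E (x z) (y z)} {γ₀ γ₁ : ∀ z, SmoothPath E (y z) (w z)}
    {S : ∀ z, Bigon (γ₀ z) (γ₁ z)} (h : SmoothBigonFamily U S) (h' : SmoothPathFamily U δ)
    {a : ℝ} (ha : a < 1) (hs : ∀ z ∈ U, ∀ v ≥ a, (δ z).toFun v = y z) :
    SmoothBigonFamily U fun z => (Bigon.id (δ z)).hcomp (S z) := by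
  refine contMDiffOn_glue_left (f := fun z : Z × ℝ × ℝ => (Bigon.id (δ z.1)).toFun (z.2.1, 2 * z.2.2))
    (g := fun z : Z × ℝ × ℝ => (S z.1).toFun (z.2.1, 2 * z.2.2 - 1)) (l := fun z => z.2.2)
    (h'.id_bigon.comp_right (contDiff_const.mul contDiff_id))
    (h.comp_right ((contDiff_const.mul contDiff_id).sub contDiff_const))
    (continuous_snd.comp continuous_snd)
    (a := a / 2) (by linarith) fun z hz hl hl' => ?_
  obtain ⟨ε, hε, h0, -, -, -⟩ := (S z.1).sitting
  rw [h0 _ _ (by linarith)]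
  exact hs z.1 hz.1 _ (by linarith)

theorem SmoothBigonFamily.whisker_right {x y w : Z → M} {U : Set Z}
    {γ₀ γ₁ : ∀ z, SmoothPath E (x z) (y z)} {δ : ∀ z, SmoothPath E (y z) (w z)}
    {S : ∀ z, Bigon (γ₀ z) (γ₁ z)} (h : SmoothBigonFamily U S) (h' : SmoothPathFamily U δ)
    {b : ℝ} (hb : 0 < b) (hs : ∀ z ∈ U, ∀ v ≤ b, (δ z).toFun v = y z) :
    SmoothBigonFamily U fun z => (S z).hcomp (Bigon.id (δ z)) := by
  refine contMDiffOn_glue_right (f := fun z : Z × ℝ × ℝ => (S z.1).toFun (z.2.1, 2 * z.2.2))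
    (g := fun z : Z × ℝ × ℝ => (Bigon.id (δ z.1)).toFun (z.2.1, 2 * z.2.2 - 1))
    (l := fun z => z.2.2)
    (h.comp_right (contDiff_const.mul contDiff_id))
    (h'.id_bigon.comp_right ((contDiff_const.mul contDiff_id).sub contDiff_const))
    (continuous_snd.comp continuous_snd)
    (b := (b + 1) / 2) (by linarith) fun z hz hl hl' => ?_
  obtain ⟨ε, hε, -, h1, -, -⟩ := (S z.1).sitting
  rw [h1 _ _ (by linarith)]
  exact (hs z.1 hz.1 _ (by linarith)).symm

/-- The path `v ↦ f (v z)` from `f 0` to `f z`, with sitting instants. -/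
def linePath (f : Z → M) (hf : ContMDiff 𝓘(ℝ, Z) 𝓘(ℝ, E) ∞ f) (z : Z) :
    SmoothPath E (f 0) (f z) where
  toFun v := f (midStep v • z)
  smooth := hf.comp (contDiff_midStep.smul contDiff_const).contMDiff
  sitting := ⟨1 / 3, by norm_num, fun v hv => by rw [midStep_of_le hv, zero_smul],
    fun v hv => by rw [midStep_of_ge (by linarith), one_smul]⟩

theorem smoothPathFamily_linePath (f : Z → M) (hf : ContMDiff 𝓘(ℝ, Z) 𝓘(ℝ, E) ∞ f)
    (U : Set Z) : SmoothPathFamily U (linePath f hf) :=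
  (hf.comp ((contDiff_midStep.comp contDiff_snd).smul contDiff_fst).contMDiff).contMDiffOn

theorem linePath_of_ge (f : Z → M) (hf : ContMDiff 𝓘(ℝ, Z) 𝓘(ℝ, E) ∞ f) (z : Z) {v : ℝ}
    (hv : 2 / 3 ≤ v) : (linePath f hf z).toFun v = f z := by
  simp [linePath, midStep_of_ge hv]

theorem linePath_reverse_of_le (f : Z → M) (hf : ContMDiff 𝓘(ℝ, Z) 𝓘(ℝ, E) ∞ f) (z : Z) {v : ℝ}
    (hv : v ≤ 1 / 3) : (linePath f hf z).reverse.toFun v = f z :=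
  linePath_of_ge f hf z (by linarith)

end Families

/-! ### Smoothness of transport with moving end points -/

section FamilyTransport

variable {EG : Type*} [NormedAddCommGroup EG] [NormedSpace ℝ EG]
  {EH : Type*} [NormedAddCommGroup EH] [NormedSpace ℝ EH]
  {G : Type*} [TopologicalSpace G] [ChartedSpace EG G] [Group G] [LieGroup 𝓘(ℝ, EG) ∞ G]
  {H : Type*} [TopologicalSpace H] [ChartedSpace EH H] [Group H] [LieGroup 𝓘(ℝ, EH) ∞ H]
  {C : SmoothCrossedModule EG EH G H}
  {E : Type*} [NormedAddCommGroup E] [NormedSpace ℝ E]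
  {M : Type*} [TopologicalSpace M] [ChartedSpace E M]
  {Z : Type*} [NormedAddCommGroup Z] [NormedSpace ℝ Z]

/-- A map is smooth if it is so after a linear change of coordinates. -/
theorem contMDiffOn_of_comp_toEuclidean [FiniteDimensional ℝ Z] {V : Type*}
    [NormedAddCommGroup V] [NormedSpace ℝ V] {N : Type*} [TopologicalSpace N] [ChartedSpace V N]
    {f : Z → N} {U : Set Z}
    (h : ContMDiffOn 𝓘(ℝ, EuclideanSpace ℝ (Fin (Module.finrank ℝ Z))) 𝓘(ℝ, V) ∞
      (fun a => f ((toEuclidean (E := Z)).symm a)) ((toEuclidean (E := Z)).symm ⁻¹' U)) :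
    ContMDiffOn 𝓘(ℝ, Z) 𝓘(ℝ, V) ∞ f U := by
  have h1 := ContMDiffOn.comp h
    (toEuclidean (E := Z)).contDiff.contMDiff.contMDiffOn (s := U)
    (fun z hz => by simpa using hz)
  refine h1.congr fun z _ => ?_
  simp

namespace TransportTwoFunctor

variable (F : TransportTwoFunctor C E M)

theorem contMDiffOn_loops [FiniteDimensional ℝ Z] {x : M} (p : (F.obj x).X₀) {U : Set Z}
    (hU : IsOpen U) {γ : Z → SmoothPath E x x} (hγ : SmoothPathFamily U γ) :
    ContMDiffOn 𝓘(ℝ, Z) 𝓘(ℝ, EG) ∞ (fun a => (F.obj x).div ((F.map (γ a)).map₀ p) p) U := by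
  refine contMDiffOn_of_comp_toEuclidean (F.smooth_loops x p _ _
    (hU.preimage (toEuclidean (E := Z)).symm.continuous)
    (fun a => γ ((toEuclidean (E := Z)).symm a)) ?_)
  exact ContMDiffOn.comp hγ ((toEuclidean (E := Z)).symm.contDiff.comp
    contDiff_fst |>.prodMk contDiff_snd).contMDiff.contMDiffOn fun z hz => ⟨hz.1, trivial⟩

theorem contMDiffOn_bigons [FiniteDimensional ℝ Z] {x y : M} (p : (F.obj x).X₀) {U : Set Z}
    (hU : IsOpen U) {γ₀ γ₁ : Z → SmoothPath E x y} {S : ∀ z, Bigon (γ₀ z) (γ₁ z)}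
    (hS : SmoothBigonFamily U S) :
    ContMDiffOn 𝓘(ℝ, Z) 𝓘(ℝ, EH) ∞ (fun a => (F.obj y).hdiv ((F.map₂ (S a)).app p)) U := by
  refine contMDiffOn_of_comp_toEuclidean (F.smooth_bigons x y p _ _
    (hU.preimage (toEuclidean (E := Z)).symm.continuous) _ _
    (fun a => S ((toEuclidean (E := Z)).symm a)) ?_)
  exact ContMDiffOn.comp hS ((toEuclidean (E := Z)).symm.contDiff.comp
    contDiff_fst |>.prodMk contDiff_snd).contMDiff.contMDiffOn fun z hz => ⟨hz.1, trivial⟩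

namespace Bundle

variable {F} (P : F.Bundle)

/-- The point `p` of the fibre over `x`, as a point of the manifold. -/
def mkPoint (x : M) (p : (F.obj x).X₀) : P.Space := F.point x p

theorem act_mkPoint (x : M) (p : (F.obj x).X₀) (g : G) :
    P.act (P.mkPoint x p) g = P.mkPoint x ((F.obj x).act₀ p g) := rfl

theorem mkPoint_proj_pt (p : P.Space) : P.mkPoint (P.proj p) (P.pt p) = p := rfl

theorem act_act (p : P.Space) (g g' : G) : P.act (P.act p g) g' = P.act p (g * g') :=
  congrArg (P.mkPoint (P.proj p)) (TwoTorsor.act₀_mul _ _ _ _).symm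

theorem act_one (p : P.Space) : P.act p 1 = p :=
  congrArg (P.mkPoint (P.proj p)) (TwoTorsor.act₀_one _ _)

theorem act_injective (p : P.Space) : Function.Injective (P.act p) := fun _ _ h =>
  TwoTorsor.act₀_injective _ _ (eq_of_heq (Sigma.mk.inj h).2)

theorem contMDiffOn_transport [FiniteDimensional ℝ Z] {x : M} (p : (F.obj x).X₀) {U : Set Z}
    (hU : IsOpen U) {y : Z → M} {γ : ∀ z, SmoothPath E x (y z)} (hγ : SmoothPathFamily U γ) :
    ContMDiffOn 𝓘(ℝ, Z) 𝓘(ℝ, E × EG) ∞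
      (fun a => P.mkPoint (y a) ((F.map (γ a)).map₀ p)) U := by
  refine contMDiffOn_of_comp_toEuclidean (N := P.Space) (P.smooth_transport x p _ _
    (hU.preimage (toEuclidean (E := Z)).symm.continuous) _
    (fun a => γ ((toEuclidean (E := Z)).symm a)) ?_)
  exact ContMDiffOn.comp hγ ((toEuclidean (E := Z)).symm.contDiff.comp
    contDiff_fst |>.prodMk contDiff_snd).contMDiff.contMDiffOn fun z hz => ⟨hz.1, trivial⟩

theorem contMDiff_act {f : Z → P.Space} {g : Z → G} (hf : ContMDiff 𝓘(ℝ, Z) 𝓘(ℝ, E × EG) ∞ f)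
    (hg : ContMDiff 𝓘(ℝ, Z) 𝓘(ℝ, EG) ∞ g) :
    ContMDiff 𝓘(ℝ, Z) 𝓘(ℝ, E × EG) ∞ (fun z => P.act (f z) (g z)) :=
  ContMDiff.comp (I' := 𝓘(ℝ, E × EG).prod 𝓘(ℝ, EG)) (M' := P.Space × G)
    (g := fun z : P.Space × G => P.act z.1 z.2) P.smooth_act (hf.prodMk hg)

/-- The quotient of two smooth maps to the bundle with the same projection is smooth. -/
theorem contMDiff_of_eq_act {f f' : Z → P.Space} {g : Z → G}
    (hf : ContMDiff 𝓘(ℝ, Z) 𝓘(ℝ, E × EG) ∞ f) (hf' : ContMDiff 𝓘(ℝ, Z) 𝓘(ℝ, E × EG) ∞ f')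
    (h : ∀ z, f z = P.act (f' z) (g z)) : ContMDiff 𝓘(ℝ, Z) 𝓘(ℝ, EG) ∞ g := by
  intro z₀
  obtain ⟨U, σ, hU, hz₀, -, hτ⟩ := P.local_triv (P.proj (f' z₀))
  let τ : P.Space → G := fun p => (F.obj (P.proj p)).div (P.pt p) (σ (P.proj p))
  have hτ' : ∀ p : P.Space, P.proj p ∈ U → ContMDiffAt 𝓘(ℝ, E × EG) 𝓘(ℝ, EG) ∞ τ p :=
    fun p hp => ContMDiffOn.contMDiffAt (M := P.Space) hτ
      ((hU.preimage P.contMDiff_proj.continuous).mem_nhds hp)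
  have hact : ∀ (p : P.Space) (a : G), τ (P.act p a) = τ p * a := by
    intro p a
    refine TwoTorsor.div_eq _ ?_
    rw [TwoTorsor.act₀_mul]
    exact congrArg (fun q => (F.obj (P.proj p)).act₀ q a) (TwoTorsor.act₀_div _ _ _)
  -- The fibre coordinate `τ` of a local trivialization is equivariant, so it recovers the quotient.
  have hg : g = fun z => (τ (f' z))⁻¹ * τ (f z) := by
    funext z
    rw [h z, hact, inv_mul_cancel_left]
  have hz : P.proj (f z₀) ∈ U := by
    rw [h z₀]
    exact hz₀
  rw [hg]
  exact (ContMDiffAt.comp z₀ (hτ' _ hz₀) hf'.contMDiffAt).inv.mul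
    (ContMDiffAt.comp z₀ (hτ' _ hz) hf.contMDiffAt)

variable [FiniteDimensional ℝ Z]

/-- A smooth map to the bundle, compared with the transport of its value at the origin. -/
theorem exists_eq_act_transport {p : Z → P.Space} (hp : ContMDiff 𝓘(ℝ, Z) 𝓘(ℝ, E × EG) ∞ p) :
    ∃ g : Z → G, ContMDiff 𝓘(ℝ, Z) 𝓘(ℝ, EG) ∞ g ∧ ∀ z, P.pt (p z) =
      (F.obj (P.proj (p z))).act₀
        ((F.map (linePath (fun z => P.proj (p z)) (P.contMDiff_proj.comp hp) z)).map₀ (P.pt (p 0)))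
        (g z) := by
  have h1 := P.contMDiffOn_transport (P.pt (p 0)) isOpen_univ
    (smoothPathFamily_linePath (fun z => P.proj (p z)) (P.contMDiff_proj.comp hp) Set.univ)
  refine ⟨fun z => (F.obj (P.proj (p z))).div (P.pt (p z)) ((F.map (linePath
    (fun z => P.proj (p z)) (P.contMDiff_proj.comp hp) z)).map₀ (P.pt (p 0))), ?_, fun z =>
      (TwoTorsor.act₀_div _ _ _).symm⟩
  refine P.contMDiff_of_eq_act hp (contMDiffOn_univ.1 h1) fun z => ?_
  rw [act_mkPoint, TwoTorsor.act₀_div, mkPoint_proj_pt]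

/-- Transport is smooth on smooth families of paths with varying end points. -/
theorem contMDiff_transport {p : Z → P.Space} (hp : ContMDiff 𝓘(ℝ, Z) 𝓘(ℝ, E × EG) ∞ p)
    {y : Z → M} {γ : ∀ z, SmoothPath E (P.proj (p z)) (y z)}
    (hγ : SmoothPathFamily Set.univ γ) :
    ContMDiff 𝓘(ℝ, Z) 𝓘(ℝ, E × EG) ∞
      (fun z => P.mkPoint (y z) ((F.map (γ z)).map₀ (P.pt (p z)))) := by
  obtain ⟨g, hg, hpg⟩ := P.exists_eq_act_transport hp
  -- Prefixing the ray path makes all paths start at the projection of `p 0`. The ray path has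
  -- arrived from time `2 / 3` on, uniformly in `z`. The remaining factor `g z` passes through
  -- transport by equivariance.
  have h1 := P.contMDiffOn_transport (P.pt (p 0)) isOpen_univ
    ((smoothPathFamily_linePath (fun z => P.proj (p z)) (P.contMDiff_proj.comp hp)
      Set.univ).trans_left hγ (a := 2 / 3) (by norm_num)
        fun z _ v hv => linePath_of_ge _ _ z hv)
  have h2 := P.contMDiff_act (contMDiffOn_univ.1 h1) hg
  convert! h2 using 2 with z
  rw [act_mkPoint, F.map₀_trans, ← (F.map (γ z)).map₀_act, ← hpg z]

/-- Surface transport is smooth on smooth families of bigons with varying end points. -/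
theorem contMDiff_hdiv {p : Z → P.Space} (hp : ContMDiff 𝓘(ℝ, Z) 𝓘(ℝ, E × EG) ∞ p)
    {y : Z → M} (hy : ContMDiff 𝓘(ℝ, Z) 𝓘(ℝ, E) ∞ y)
    {γ₀ γ₁ : ∀ z, SmoothPath E (P.proj (p z)) (y z)} {S : ∀ z, Bigon (γ₀ z) (γ₁ z)}
    (hS : SmoothBigonFamily Set.univ S) :
    ContMDiff 𝓘(ℝ, Z) 𝓘(ℝ, EH) ∞
      (fun z => (F.obj (y z)).hdiv ((F.map₂ (S z)).app (P.pt (p z)))) := by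
  obtain ⟨g, hg, hpg⟩ := P.exists_eq_act_transport hp
  -- Whiskering by ray paths on both sides fixes both end points. The `H`-value is unchanged except
  -- that the base point is off by `g z`, which acts through `α`.
  have h0 := (hS.whisker_right (smoothPathFamily_linePath y hy Set.univ).reverse (b := 1 / 3)
    (by norm_num) fun z _ v hv => linePath_reverse_of_le _ _ z hv).whisker_left
      (smoothPathFamily_linePath (fun z => P.proj (p z)) (P.contMDiff_proj.comp hp)
      Set.univ) (a := 2 / 3) (by norm_num) fun z _ v hv => linePath_of_ge _ _ z hv
  have h1 := contMDiffOn_univ.1 (F.contMDiffOn_bigons (P.pt (p 0)) isOpen_univ h0)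
  have h2 : ContMDiff 𝓘(ℝ, Z) 𝓘(ℝ, EH) ∞ fun z => C.α (g z)⁻¹ _ :=
    C.α_smooth.comp (hg.inv.prodMk h1)
  convert! h2 using 2 with z
  dsimp only
  rw [F.hdiv_map₂_whisker_left, F.hdiv_map₂_whisker_right, ← F.hdiv_map₂_act, ← hpg z]

end Bundle

end TransportTwoFunctor

end FamilyTransport

end

noncomputable section

/-! ### The connection form -/

section ConnectionForm

variable {EG : Type*} [NormedAddCommGroup EG] [NormedSpace ℝ EG]
  {EH : Type*} [NormedAddCommGroup EH] [NormedSpace ℝ EH]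
  {G : Type*} [TopologicalSpace G] [ChartedSpace EG G] [Group G] [LieGroup 𝓘(ℝ, EG) ∞ G]
  {H : Type*} [TopologicalSpace H] [ChartedSpace EH H] [Group H] [LieGroup 𝓘(ℝ, EH) ∞ H]
  {C : SmoothCrossedModule EG EH G H}
  {E : Type*} [NormedAddCommGroup E] [NormedSpace ℝ E]
  {M : Type*} [TopologicalSpace M] [ChartedSpace E M]
  {F : TransportTwoFunctor C E M}
  {Z : Type*} [NormedAddCommGroup Z] [NormedSpace ℝ Z]

namespace TransportTwoFunctor.Bundle

variable (P : F.Bundle)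

/-- This expresses holonomy by forward transport, as the quotient of two points over `c t`;
smoothness and explicit computations are derived from it. -/
theorem act_curveHolonomy (c : ℝ → P.Space) (hc : ContMDiff 𝓘(ℝ, ℝ) 𝓘(ℝ, E × EG) ∞ c) (t : ℝ) :
    P.act (P.mkPoint (P.proj (c t)) ((F.map (curvePath (fun r => P.proj (c r))
      (P.contMDiff_proj.comp hc) t)).map₀ (P.pt (c 0)))) (P.curveHolonomy c hc t) = c t := by
  rw [act_mkPoint, ← (F.map _).map₀_act, curveHolonomy, TwoTorsor.act₀_div,
    F.map₀_map₀_reverse, mkPoint_proj_pt]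

theorem curveHolonomy_eq {c : ℝ → P.Space} {hc : ContMDiff 𝓘(ℝ, ℝ) 𝓘(ℝ, E × EG) ∞ c} {t : ℝ}
    {g : G} (h : P.act (P.mkPoint (P.proj (c t)) ((F.map (curvePath (fun r => P.proj (c r))
      (P.contMDiff_proj.comp hc) t)).map₀ (P.pt (c 0)))) g = c t) :
    P.curveHolonomy c hc t = g :=
  P.act_injective _ ((P.act_curveHolonomy c hc t).trans h.symm)

/-- Holonomy only depends on the piece of the curve it is taken along. -/
theorem curveHolonomy_congr {c c' : ℝ → P.Space} {hc : ContMDiff 𝓘(ℝ, ℝ) 𝓘(ℝ, E × EG) ∞ c}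
    {hc' : ContMDiff 𝓘(ℝ, ℝ) 𝓘(ℝ, E × EG) ∞ c'} {t t' : ℝ}
    (h : ∀ r, 0 ≤ r → r ≤ 1 → c' (t' * r) = c (t * r)) :
    P.curveHolonomy c' hc' t' = P.curveHolonomy c hc t := by
  have h1 : c' t' = c t := by simpa using h 1 zero_le_one le_rfl
  have h0 : c' 0 = c 0 := by simpa using h 0 le_rfl zero_le_one
  refine P.curveHolonomy_eq ?_
  have h2 := P.act_curveHolonomy c hc t
  refine Eq.trans (congrArg (fun q => P.act q _) ?_) (h2.trans h1.symm)
  refine F.point_map₀_congr (funext fun v => ?_) ?_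
  · exact congrArg P.proj (h _ (Real.smoothTransition.nonneg _) (Real.smoothTransition.le_one _))
  · exact h0

/-- Holonomy along a curve in a fibre. -/
theorem curveHolonomy_of_act {c : ℝ → P.Space} {hc : ContMDiff 𝓘(ℝ, ℝ) 𝓘(ℝ, E × EG) ∞ c}
    {g : ℝ → G} (h : ∀ t, c t = P.act (c 0) (g t)) (t : ℝ) :
    P.curveHolonomy c hc t = g t := by
  refine P.curveHolonomy_eq ?_
  conv_rhs => rw [h t]
  congr 1
  have hp : ∀ r, P.proj (c r) = P.proj (c 0) := fun r => by rw [h r]; rfl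
  have h1 := F.map₀_const (P.proj (c 0)) (P.pt (c 0))
  conv_rhs => rw [← P.mkPoint_proj_pt (c 0), ← h1]
  exact F.point_map₀_congr (funext fun v => hp _) rfl

/-- At time `0` only the point `c 0` is seen, so `c` may be replaced by a constant curve. -/
theorem curveHolonomy_zero (c : ℝ → P.Space) (hc : ContMDiff 𝓘(ℝ, ℝ) 𝓘(ℝ, E × EG) ∞ c) :
    P.curveHolonomy c hc 0 = 1 := by
  have h1 : P.curveHolonomy c hc 0 = P.curveHolonomy (fun _ => c 0) contMDiff_const 0 :=
    P.curveHolonomy_congr (by simp)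
  rw [h1]
  exact P.curveHolonomy_of_act (g := fun _ => 1) (fun _ => (P.act_one _).symm) 0

theorem contMDiff_curveHolonomy [FiniteDimensional ℝ Z] {c : Z × ℝ → P.Space}
    (hc : ContMDiff 𝓘(ℝ, Z × ℝ) 𝓘(ℝ, E × EG) ∞ c)
    (hcz : ∀ z, ContMDiff 𝓘(ℝ, ℝ) 𝓘(ℝ, E × EG) ∞ fun t => c (z, t)) :
    ContMDiff 𝓘(ℝ, Z × ℝ) 𝓘(ℝ, EG) ∞
      (fun x : Z × ℝ => P.curveHolonomy (fun t => c (x.1, t)) (hcz x.1) x.2) := by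
  have h0 : ContMDiff 𝓘(ℝ, Z × ℝ) 𝓘(ℝ, E × EG) ∞ fun x : Z × ℝ => c (x.1, 0) :=
    hc.comp (contDiff_fst.prodMk contDiff_const).contMDiff
  have h1 := P.contMDiff_transport h0 (y := fun x => P.proj (c x))
    (γ := fun x => curvePath (fun r => P.proj (c (x.1, r)))
      (P.contMDiff_proj.comp (hcz x.1)) x.2) ?_
  · exact P.contMDiff_of_eq_act hc h1 fun x =>
      (P.act_curveHolonomy (fun t => c (x.1, t)) (hcz x.1) x.2).symm
  · refine ContMDiff.contMDiffOn ?_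
    refine (P.contMDiff_proj.comp hc).comp (f := fun y : (Z × ℝ) × ℝ =>
      (y.1.1, y.1.2 * Real.smoothTransition (3 * y.2 - 1))) (ContDiff.contMDiff ?_)
    exact (contDiff_fst.comp contDiff_fst).prodMk ((contDiff_snd.comp contDiff_fst).mul
      (contDiff_midStep.comp contDiff_snd))

theorem contMDiff_curveHolonomy_curve (c : ℝ → P.Space)
    (hc : ContMDiff 𝓘(ℝ, ℝ) 𝓘(ℝ, E × EG) ∞ c) :
    ContMDiff 𝓘(ℝ, ℝ) 𝓘(ℝ, EG) ∞ (P.curveHolonomy c hc) := by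
  have h1 := P.contMDiff_curveHolonomy (Z := ℝ) (c := fun x => c x.2)
    (hc.comp contDiff_snd.contMDiff) (fun _ => hc)
  exact h1.comp (contDiff_const.prodMk contDiff_id : ContDiff ℝ ∞ fun t : ℝ => ((0 : ℝ), t)).contMDiff

/-- The derivative at time `0` of the holonomy along a curve. -/
def holonomyRate (c : ℝ → P.Space) (hc : ContMDiff 𝓘(ℝ, ℝ) 𝓘(ℝ, E × EG) ∞ c) : EG :=
  deriv (fun t => extChartAt 𝓘(ℝ, EG) (1 : G) (P.curveHolonomy c hc t)) 0

theorem hasVelocity_curveHolonomy (c : ℝ → P.Space)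
    (hc : ContMDiff 𝓘(ℝ, ℝ) 𝓘(ℝ, E × EG) ∞ c) :
    HasVelocity (V := EG) (P.curveHolonomy c hc) (P.holonomyRate c hc) :=
  haveI : IsManifold 𝓘(ℝ, EG) ∞ G := LieGroup.toContMDiffMul.toIsManifold
  ContMDiffAt.hasVelocity (P.contMDiff_curveHolonomy_curve c hc).contMDiffAt
    (P.curveHolonomy_zero c hc)

theorem holonomyRate_eq {c : ℝ → P.Space} {hc : ContMDiff 𝓘(ℝ, ℝ) 𝓘(ℝ, E × EG) ∞ c} {a : EG}
    (h : HasVelocity (V := EG) (P.curveHolonomy c hc) a) : P.holonomyRate c hc = a :=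
  (P.hasVelocity_curveHolonomy c hc).unique h

theorem contDiff_holonomyRate [FiniteDimensional ℝ Z] {c : Z × ℝ → P.Space}
    (hc : ContMDiff 𝓘(ℝ, Z × ℝ) 𝓘(ℝ, E × EG) ∞ c)
    (hcz : ∀ z, ContMDiff 𝓘(ℝ, ℝ) 𝓘(ℝ, E × EG) ∞ fun t => c (z, t)) :
    ContDiff ℝ ∞ fun z => P.holonomyRate (fun t => c (z, t)) (hcz z) := by
  have : IsManifold 𝓘(ℝ, EG) ∞ G := LieGroup.toContMDiffMul.toIsManifold
  rw [contDiff_iff_contDiffAt]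
  intro z
  have h1 := ContMDiffAt.contDiffAt_extChartAt (e := (1 : G))
    ((P.contMDiff_curveHolonomy hc hcz).contMDiffAt (x := (z, 0)))
    (by rw [curveHolonomy_zero]; exact mem_extChartAt_source _)
  exact h1.deriv_param_zero

/-- The holonomy of `t ↦ c (r t)` at `t` is that of `c` at `r t`; this is the homogeneity from which
linearity is deduced. -/
theorem holonomyRate_comp_mul {c c' : ℝ → P.Space} {hc : ContMDiff 𝓘(ℝ, ℝ) 𝓘(ℝ, E × EG) ∞ c}
    {hc' : ContMDiff 𝓘(ℝ, ℝ) 𝓘(ℝ, E × EG) ∞ c'} {r : ℝ} (h : ∀ t, c' t = c (r * t)) :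
    P.holonomyRate c' hc' = r • P.holonomyRate c hc := by
  refine P.holonomyRate_eq ?_
  have h1 := (P.hasVelocity_curveHolonomy c hc).comp_mul r
  have h2 : P.curveHolonomy c' hc' = fun t => P.curveHolonomy c hc (r * t) :=
    funext fun t => P.curveHolonomy_congr fun q _ _ => by rw [h, mul_assoc]
  rw [h2]
  exact h1

theorem holonomyRate_congr {c c' : ℝ → P.Space} {hc : ContMDiff 𝓘(ℝ, ℝ) 𝓘(ℝ, E × EG) ∞ c}
    {hc' : ContMDiff 𝓘(ℝ, ℝ) 𝓘(ℝ, E × EG) ∞ c'} (h : c' =ᶠ[nhds 0] c) :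
    P.holonomyRate c' hc' = P.holonomyRate c hc := by
  refine Filter.EventuallyEq.deriv_eq ?_
  obtain ⟨ε, hε, hb⟩ := Metric.eventually_nhds_iff.1 h
  filter_upwards [Metric.ball_mem_nhds (0 : ℝ) hε] with t ht
  rw [P.curveHolonomy_congr (c := c) (hc := hc) (t := t)]
  intro r h0 h1
  refine hb ?_
  simp only [Metric.mem_ball, dist_zero_right, norm_mul, Real.norm_eq_abs] at ht ⊢
  rw [abs_of_nonneg h0]
  nlinarith [abs_nonneg t]

/-- The rate of holonomy only depends on the velocity of the curve, in a chart. -/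
theorem holonomyRate_eq_of_coordinates [FiniteDimensional ℝ E] [FiniteDimensional ℝ EG]
    {p : P.Space} {Ψ : E × EG → P.Space} (hΨs : ContMDiff 𝓘(ℝ, E × EG) 𝓘(ℝ, E × EG) ∞ Ψ)
    (hΨ : Ψ =ᶠ[nhds (extChartAt 𝓘(ℝ, E × EG) p p)] (extChartAt 𝓘(ℝ, E × EG) p).symm)
    (hl : ∀ X : E × EG, ContMDiff 𝓘(ℝ, ℝ) 𝓘(ℝ, E × EG) ∞
      fun t : ℝ => Ψ (extChartAt 𝓘(ℝ, E × EG) p p + t • X))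
    {c : ℝ → P.Space} (hc : ContMDiff 𝓘(ℝ, ℝ) 𝓘(ℝ, E × EG) ∞ c) (hc0 : c 0 = p) {X : E × EG}
    (hX : HasVelocity (V := E × EG) c X) :
    P.holonomyRate c hc = P.holonomyRate _ (hl X) := by
  set z₀ := extChartAt 𝓘(ℝ, E × EG) p p with hz₀
  -- In coordinates the curve is `k t = t • e (0, t)` with `e (0, 0) = X`; the first argument of `e`
  -- is a dummy.
  obtain ⟨k, hk, hk0, hck⟩ := exists_contDiff_coordinates hΨ hc hc0
  obtain ⟨e, he, hke, hkd⟩ := exists_contDiff_eq_smul (Z := ℝ) (f := fun x : ℝ × ℝ => k x.2)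
    (hk.comp contDiff_snd) (fun _ => hk0)
  have hXe : e (0, 0) = X := by
    refine (HasVelocity.congr ?_ hck).unique hX
    exact hasVelocity_extChartAt_symm hΨ ((hkd 0).const_add z₀) (by simp [hk0])
  have hkc : ContMDiff 𝓘(ℝ, ℝ) 𝓘(ℝ, E × EG) ∞ fun t => Ψ (z₀ + k t) :=
    hΨs.comp (contDiff_const.add hk).contMDiff
  rw [P.holonomyRate_congr (hc' := hc) (hc := hkc) hck]
  have hfam : ContMDiff 𝓘(ℝ, (ℝ × ℝ) × ℝ) 𝓘(ℝ, E × EG) ∞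
      fun x : (ℝ × ℝ) × ℝ => Ψ (z₀ + (x.1.1 * x.2) • e (0, x.1.2 * x.2)) := by
    refine hΨs.comp (ContDiff.contMDiff (contDiff_const.add (ContDiff.smul
      (by fun_prop : ContDiff ℝ ∞ fun x : (ℝ × ℝ) × ℝ => x.1.1 * x.2) ?_)))
    exact he.comp (by fun_prop : ContDiff ℝ ∞ fun x : (ℝ × ℝ) × ℝ => ((0 : ℝ), x.1.2 * x.2))
  have hfamz : ∀ x : ℝ × ℝ, ContMDiff 𝓘(ℝ, ℝ) 𝓘(ℝ, E × EG) ∞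
      fun t : ℝ => Ψ (z₀ + (x.1 * t) • e (0, x.2 * t)) := fun x =>
    hfam.comp (contDiff_const.prodMk contDiff_id : ContDiff ℝ ∞ fun t : ℝ => (x, t)).contMDiff
  -- At `(1, 1)` this is the rate of the given curve, at `(1, 0)` that of the straight line, at `(0,
  -- 1)` that of a constant curve. By rescaling, `φ` is homogeneous along these three rays, so it
  -- agrees there with its derivative at the origin, which is additive.
  let φ : ℝ × ℝ → EG := fun x => P.holonomyRate _ (hfamz x)
  have hφ : ContDiff ℝ ∞ φ := P.contDiff_holonomyRate hfam hfamz
  have hd : HasFDerivAt φ (fderiv ℝ φ 0) 0 := (hφ.differentiable (by simp) 0).hasFDerivAt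
  have key : ∀ (a b : ℝ) (w : EG), (∀ r : ℝ, φ (r * a, r * b) = r • w) →
      fderiv ℝ φ 0 (a, b) = w := by
    intro a b w hw
    have h1 : HasDerivAt (fun r : ℝ => (r * a, r * b)) (a, b) 0 := by
      simpa using ((hasDerivAt_id (0 : ℝ)).mul_const a).prodMk ((hasDerivAt_id (0 : ℝ)).mul_const b)
    have hd' : HasFDerivAt φ (fderiv ℝ φ 0) ((fun r : ℝ => (r * a, r * b)) 0) := by
      simp only [zero_mul]
      exact hd
    have h2 := hd'.comp_hasDerivAt (0 : ℝ) h1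
    have h3 : HasDerivAt (φ ∘ fun r : ℝ => (r * a, r * b)) w 0 := by
      have : (φ ∘ fun r : ℝ => (r * a, r * b)) = fun r : ℝ => r • w := funext hw
      rw [this]
      simpa using (hasDerivAt_id (0 : ℝ)).smul_const w
    exact h2.unique h3
  have k1 : fderiv ℝ φ 0 (1, 1) = P.holonomyRate _ hkc := by
    refine key 1 1 _ fun r => P.holonomyRate_comp_mul fun t => ?_
    have := hke 0 (r * t)
    simp only at this
    simp only [this, mul_one]
  have k2 : fderiv ℝ φ 0 (1, 0) = P.holonomyRate _ (hl X) := by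
    refine key 1 0 _ fun r => P.holonomyRate_comp_mul fun t => ?_
    simp [hXe]
  have k3 : fderiv ℝ φ 0 (0, 1) = 0 := by
    refine key 0 1 _ fun r => ?_
    rw [smul_zero]
    refine (P.holonomyRate_comp_mul (c := fun _ => Ψ z₀) (hc := contMDiff_const) (r := 0)
      fun t => ?_).trans (zero_smul _ _)
    simp
  rw [← k1, ← k2, ← add_zero (fderiv ℝ φ 0 (1, 0)), ← k3, ← map_add]
  simp

/-- The rate along straight lines of a chart is smooth and homogeneous in the direction, hence
linear, and every curve has the rate of the line with the same velocity. -/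
theorem exists_isTransportConnection [FiniteDimensional ℝ E] [FiniteDimensional ℝ EG] :
    ∃ A : P.OneForm, P.IsTransportConnection A := by
  have h : ∀ p : P.Space, ∃ A : TangentSpace 𝓘(ℝ, E × EG) p →L[ℝ] EG,
      ∀ (c : ℝ → P.Space) (hc : ContMDiff 𝓘(ℝ, ℝ) 𝓘(ℝ, E × EG) ∞ c) (X : E × EG),
      c 0 = p → HasVelocity (V := E × EG) c X → P.holonomyRate c hc = A X := by
    intro p
    obtain ⟨Ψ, hΨs, hΨ⟩ := exists_contMDiff_eq_extChartAt_symm p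
      (mem_extChartAt_target (I := 𝓘(ℝ, E × EG)) p)
    have hfam : ContMDiff 𝓘(ℝ, (E × EG) × ℝ) 𝓘(ℝ, E × EG) ∞ fun x : (E × EG) × ℝ =>
        Ψ (extChartAt 𝓘(ℝ, E × EG) p p + x.2 • x.1) :=
      hΨs.comp (contDiff_const.add (contDiff_snd.smul contDiff_fst)).contMDiff
    have hl : ∀ X : E × EG, ContMDiff 𝓘(ℝ, ℝ) 𝓘(ℝ, E × EG) ∞
        fun t : ℝ => Ψ (extChartAt 𝓘(ℝ, E × EG) p p + t • X) := fun X =>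
      hΨs.comp (contDiff_const.add (contDiff_id.smul contDiff_const)).contMDiff
    have ha := P.contDiff_holonomyRate hfam hl
    refine ⟨fderiv ℝ (fun X => P.holonomyRate _ (hl X)) 0, fun c hc X hc0 hX => ?_⟩
    rw [P.holonomyRate_eq_of_coordinates hΨs hΨ hl hc hc0 hX]
    refine eq_fderiv_of_homogeneous (f := fun X => P.holonomyRate _ (hl X))
      (ha.differentiable (by simp) 0) (fun r Y => ?_) X
    exact P.holonomyRate_comp_mul fun t => by rw [smul_smul, mul_comm]
  choose A hA using h
  refine ⟨A, fun c hc X hX => ⟨P.curveHolonomy_zero c hc, ?_⟩⟩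
  have h1 := P.hasVelocity_curveHolonomy c hc
  rw [hA (c 0) c hc X rfl hX] at h1
  exact h1

variable {P} in
theorem IsTransportConnection.holonomyRate_eq {A : P.OneForm} (hA : P.IsTransportConnection A)
    {c : ℝ → P.Space} (hc : ContMDiff 𝓘(ℝ, ℝ) 𝓘(ℝ, E × EG) ∞ c) {p : P.Space} (hc0 : c 0 = p)
    {X : E × EG} (hX : HasVelocity (V := E × EG) c X) : P.holonomyRate c hc = A p X := by
  subst hc0
  exact P.holonomyRate_eq (hA c hc X hX).2

theorem existsUnique_isTransportConnection [FiniteDimensional ℝ E] [FiniteDimensional ℝ EG] :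
    ∃! A : P.OneForm, P.IsTransportConnection A := by
  obtain ⟨A, hA⟩ := P.exists_isTransportConnection
  refine ⟨A, hA, fun A' hA' => funext fun p => ContinuousLinearMap.ext fun X => ?_⟩
  obtain ⟨c, hc, hc0, hX⟩ := exists_hasVelocity (V := E × EG) p X
  exact (hA'.holonomyRate_eq hc hc0 hX).symm.trans (hA.holonomyRate_eq hc hc0 hX)

variable {P}

/-- The component of `A` in direction `v` is the rate along the lines `z + t v`, a smooth family in
`z`. The inverse chart is replaced by a global map, which is harmless near a given point. -/
theorem IsTransportConnection.smoothOneForm [FiniteDimensional ℝ E] [FiniteDimensional ℝ EG]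
    {A : P.OneForm} (hA : P.IsTransportConnection A) : SmoothOneForm A := by
  intro p₀ v z₀ hz₀
  obtain ⟨Ψ, hΨs, hΨ⟩ := exists_contMDiff_eq_extChartAt_symm p₀ hz₀
  have hfam : ContMDiff 𝓘(ℝ, (E × EG) × ℝ) 𝓘(ℝ, E × EG) ∞ fun x : (E × EG) × ℝ =>
      Ψ (x.1 + x.2 • v) :=
    hΨs.comp (contDiff_fst.add (contDiff_snd.smul contDiff_const)).contMDiff
  have hl : ∀ z : E × EG, ContMDiff 𝓘(ℝ, ℝ) 𝓘(ℝ, E × EG) ∞ fun t : ℝ => Ψ (z + t • v) := fun X =>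
    hΨs.comp (contDiff_const.add (contDiff_id.smul contDiff_const)).contMDiff
  refine ContDiffAt.contDiffWithinAt ?_
  refine (P.contDiff_holonomyRate hfam hl).contDiffAt.congr_of_eventuallyEq ?_
  filter_upwards [eventually_eventually_nhds.2 hΨ,
    (isOpen_extChartAt_target (I := 𝓘(ℝ, E × EG)) p₀).mem_nhds hz₀] with z hz hzt
  exact (hA.holonomyRate_eq (hl z) (by simpa using hz.self_of_nhds)
    (hasVelocity_chartVector hzt hz v)).symm

theorem mdifferentiable_act_right (P : F.Bundle) (p : P.Space) :
    MDifferentiable 𝓘(ℝ, EG) 𝓘(ℝ, E × EG) (fun g : G => P.act p g) := by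
  have h : ContMDiff 𝓘(ℝ, EG) 𝓘(ℝ, E × EG) ∞ (fun g : G => P.act p g) :=
    ContMDiff.comp (I' := 𝓘(ℝ, E × EG).prod 𝓘(ℝ, EG)) (M' := P.Space × G)
      (g := fun z : P.Space × G => P.act z.1 z.2) P.smooth_act (contMDiff_const.prodMk contMDiff_id)
  exact h.mdifferentiable (by simp)

theorem contMDiff_rightMul (P : F.Bundle) {g : P.Space → G}
    (hg : ContMDiff 𝓘(ℝ, E × EG) 𝓘(ℝ, EG) ∞ g) :
    ContMDiff 𝓘(ℝ, E × EG) 𝓘(ℝ, E × EG) ∞ (P.rightMul g) :=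
  ContMDiff.comp (I' := 𝓘(ℝ, E × EG).prod 𝓘(ℝ, EG)) (M' := P.Space × G)
      (g := fun z : P.Space × G => P.act z.1 z.2) P.smooth_act (contMDiff_id.prodMk hg)

/-- The factor `g⁻¹⁻¹` keeps the shape of conjugation by `g⁻¹`, whose derivative is `lieAd g⁻¹`. -/
theorem curveHolonomy_act (P : F.Bundle) {c c' : ℝ → P.Space}
    {hc : ContMDiff 𝓘(ℝ, ℝ) 𝓘(ℝ, E × EG) ∞ c} {hc' : ContMDiff 𝓘(ℝ, ℝ) 𝓘(ℝ, E × EG) ∞ c'} {g : G}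
    (h : ∀ t, c' t = P.act (c t) g) (t : ℝ) :
    P.curveHolonomy c' hc' t = g⁻¹ * P.curveHolonomy c hc t * g⁻¹⁻¹ := by
  obtain rfl : c' = fun t => P.act (c t) g := funext h
  refine P.curveHolonomy_eq ?_
  have h1 := congrArg (fun q => P.act q g) (P.act_curveHolonomy c hc t)
  refine Eq.trans ?_ h1
  rw [act_act, inv_inv, mul_assoc, ← act_act, act_mkPoint, act_mkPoint, act_mkPoint]
  have h2 : P.pt (P.act (c 0) g) = (F.obj (P.proj (c 0))).act₀ (P.pt (c 0)) g := rfl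
  rw [h2]
  change P.mkPoint (P.proj (c t)) ((F.obj (P.proj (c t))).act₀ ((F.obj (P.proj (c t))).act₀
    ((F.map (curvePath (fun r => P.proj (c r)) _ t)).map₀ _) _) _) = _
  rw [← TwoTorsor.act₀_mul, ← (F.map _).map₀_act, ← TwoTorsor.act₀_mul, ← (F.map _).map₀_act]
  simp

theorem IsTransportConnection.isConnection [FiniteDimensional ℝ E] [FiniteDimensional ℝ EG]
    {A : P.OneForm} (hA : P.IsTransportConnection A) : P.IsConnection A := by
  have hGm : IsManifold 𝓘(ℝ, EG) ∞ G := LieGroup.toContMDiffMul.toIsManifold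
  refine ⟨hA.smoothOneForm, fun p ξ => ?_, fun g p X => ?_⟩
  · obtain ⟨c, hc, hc0, hX⟩ := exists_hasVelocity (V := EG) (1 : G) ξ
    have hcp : ContMDiff 𝓘(ℝ, ℝ) 𝓘(ℝ, E × EG) ∞ fun t => P.act p (c t) :=
      P.contMDiff_act contMDiff_const hc
    have hv := hX.comp_mfderiv (f := fun g : G => P.act p g) (P.mdifferentiable_act_right p _)
    rw [← hc0]
    refine (hA.holonomyRate_eq hcp rfl hv).symm.trans (P.holonomyRate_eq ?_)
    -- Along a curve in a fibre, holonomy is the curve in `G` itself.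
    have h1 : P.curveHolonomy _ hcp = c := funext fun t =>
      P.curveHolonomy_of_act (fun t => by rw [hc0, act_act, one_mul]) t
    rw [h1]
    exact hX
  · obtain ⟨c, hc, rfl, hX⟩ := exists_hasVelocity (V := E × EG) p X
    have hcp : ContMDiff 𝓘(ℝ, ℝ) 𝓘(ℝ, E × EG) ∞ fun t => P.act (c t) g :=
      P.contMDiff_act hc contMDiff_const
    have hv := hX.comp_mfderiv (f := fun q : P.Space => P.act q g)
      ((P.contMDiff_rightMul (g := fun _ => g) contMDiff_const).mdifferentiable (by simp) _)
    refine (hA.holonomyRate_eq hcp rfl hv).symm.trans (P.holonomyRate_eq ?_)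
    have h1 : P.curveHolonomy _ hcp = fun t => g⁻¹ * P.curveHolonomy c hc t * g⁻¹⁻¹ := funext fun t =>
      P.curveHolonomy_act (fun _ => rfl) t
    have h2 : ContMDiff 𝓘(ℝ, EG) 𝓘(ℝ, EG) ∞ fun a : G => g⁻¹ * a * g⁻¹⁻¹ :=
      (contMDiff_const.mul contMDiff_id).mul contMDiff_const
    have h3 := (hA c hc X hX).2.comp_mfderiv (f := fun a : G => g⁻¹ * a * g⁻¹⁻¹)
      (h2.mdifferentiable (by simp) _)
    rw [h1]
    rw [P.curveHolonomy_zero] at h3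
    exact h3

end TransportTwoFunctor.Bundle

end ConnectionForm

end

noncomputable section

/-! ### Mixed derivatives on the diagonal and alternating forms -/

section BilinearCalculus

variable {V : Type*} [NormedAddCommGroup V] [NormedSpace ℝ V]
  {W : Type*} [NormedAddCommGroup W] [NormedSpace ℝ W]

/-- The mixed derivative of a function restricted to the diagonal, if the function is constant
along the axes in its second variable. -/
theorem mixedDeriv_diag {Q : (ℝ × ℝ) × (ℝ × ℝ) → V} (hQ : ContDiffAt ℝ ∞ Q 0) {y : V}
    (h₁ : ∀ z s, Q (z, (s, 0)) = y) (h₂ : ∀ z t, Q (z, (0, t)) = y) :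
    mixedDeriv (fun x => Q (x, x)) = mixedDeriv (fun x => Q (0, x)) := by
  have hd : ∀ᶠ x in nhds (0 : (ℝ × ℝ) × (ℝ × ℝ)), DifferentiableAt ℝ Q x :=
    ((hQ.of_le (m := 1) (by norm_cast)).eventually (by simp)).mono
      fun x hx => hx.differentiableAt (by simp)
  -- The `t`-derivative with the first argument of `Q` frozen at `(x.1, 0)`. By `h₁`, letting the
  -- first argument also move with `t` does not change it. By `h₂` it vanishes for `x.2 = 0`, so the
  -- derivative of `g` at the origin is the same in directions `(1, 1)` and `(0, 1)`.
  let g : ℝ × ℝ → V := fun x => fderiv ℝ Q ((x.1, 0), (x.2, 0)) (0, (0, 1))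
  have hg : ContDiffAt ℝ ∞ g 0 := by
    refine ContDiffAt.clm_apply ?_ contDiffAt_const
    exact ContDiffAt.comp (0 : ℝ × ℝ) (f := fun x : ℝ × ℝ => ((x.1, (0 : ℝ)), (x.2, (0 : ℝ))))
      (hQ.fderiv_right (m := ∞) (by simp)) (by fun_prop)
  have hev : ∀ᶠ x : ℝ × ℝ in nhds 0, DifferentiableAt ℝ Q ((x.1, 0), (x.2, 0)) :=
    (by fun_prop : Continuous fun x : ℝ × ℝ => ((x.1, (0 : ℝ)), (x.2, (0 : ℝ)))).tendsto 0
      |>.eventually hd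
  have hgd : ∀ᶠ x : ℝ × ℝ in nhds 0, HasDerivAt (fun t => Q ((x.1, 0), (x.2, t))) (g x) 0 ∧
      HasDerivAt (fun t => Q ((x.1, t), (x.2, t))) (g x) 0 := by
    filter_upwards [hev] with x hx
    have e1 : HasDerivAt (fun t : ℝ => (((x.1, 0), (x.2, t)) : (ℝ × ℝ) × (ℝ × ℝ)))
        (0, (0, 1)) 0 :=
      (hasDerivAt_const _ _).prodMk ((hasDerivAt_const _ _).prodMk (hasDerivAt_id _))
    have e2 : HasDerivAt (fun t : ℝ => (((x.1, t), (x.2, 0)) : (ℝ × ℝ) × (ℝ × ℝ)))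
        ((0, 1), 0) 0 :=
      ((hasDerivAt_const _ _).prodMk (hasDerivAt_id _)).prodMk (hasDerivAt_const _ _)
    have e3 : HasDerivAt (fun t : ℝ => (((x.1, t), (x.2, t)) : (ℝ × ℝ) × (ℝ × ℝ)))
        ((0, 1), (0, 1)) 0 :=
      ((hasDerivAt_const _ _).prodMk (hasDerivAt_id _)).prodMk
        ((hasDerivAt_const _ _).prodMk (hasDerivAt_id _))
    have d1 := hx.hasFDerivAt.comp_hasDerivAt (0 : ℝ) e1
    have d2 := hx.hasFDerivAt.comp_hasDerivAt (0 : ℝ) e2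
    have d3 := hx.hasFDerivAt.comp_hasDerivAt (0 : ℝ) e3
    have z2 : fderiv ℝ Q ((x.1, 0), (x.2, 0)) ((0, 1), 0) = 0 := by
      refine d2.unique ?_
      have : (Q ∘ fun t : ℝ => ((x.1, t), (x.2, 0))) = fun _ => y := funext fun t => h₁ _ _
      rw [this]
      exact hasDerivAt_const _ _
    refine ⟨d1, ?_⟩
    have z3 : fderiv ℝ Q ((x.1, 0), (x.2, 0)) ((0, 1), (0, 1)) = g x := by
      have : (((0, 1), (0, 1)) : (ℝ × ℝ) × (ℝ × ℝ)) = ((0, 1), 0) + (0, (0, 1)) := by simp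
      rw [this, map_add, z2, zero_add]
    rw [← z3]
    exact d3
  have hg0 : ∀ᶠ r : ℝ in nhds 0, g (r, 0) = 0 := by
    filter_upwards [((by fun_prop : Continuous fun r : ℝ => (r, (0 : ℝ))).tendsto 0).eventually hgd]
      with r hr
    refine hr.1.unique ?_
    simp only [h₂]
    exact hasDerivAt_const _ _
  have hgF : HasFDerivAt g (fderiv ℝ g 0) 0 := (hg.differentiableAt (by simp)).hasFDerivAt
  have a1 : mixedDeriv (fun x => Q (x, x)) = fderiv ℝ g 0 (1, 1) := by
    have e : HasDerivAt (fun s : ℝ => (s, s)) ((1, 1) : ℝ × ℝ) 0 :=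
      (hasDerivAt_id _).prodMk (hasDerivAt_id _)
    have := HasFDerivAt.comp_hasDerivAt (f := fun s : ℝ => (s, s)) (0 : ℝ) hgF e
    rw [← this.deriv]
    refine Filter.EventuallyEq.deriv_eq ?_
    filter_upwards [((by fun_prop : Continuous fun r : ℝ => (r, r)).tendsto 0).eventually hgd]
      with s hs
    exact hs.2.deriv
  have a2 : mixedDeriv (fun x => Q (0, x)) = fderiv ℝ g 0 (0, 1) := by
    have e : HasDerivAt (fun s : ℝ => ((0 : ℝ), s)) ((0, 1) : ℝ × ℝ) 0 :=
      (hasDerivAt_const _ _).prodMk (hasDerivAt_id _)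
    have := HasFDerivAt.comp_hasDerivAt (f := fun s : ℝ => ((0 : ℝ), s)) (0 : ℝ) hgF e
    rw [← this.deriv]
    refine Filter.EventuallyEq.deriv_eq ?_
    filter_upwards [((by fun_prop : Continuous fun r : ℝ => ((0 : ℝ), r)).tendsto 0).eventually hgd]
      with s hs
    exact hs.1.deriv
  have a3 : fderiv ℝ g 0 (1, 0) = 0 := by
    have e : HasDerivAt (fun s : ℝ => (s, (0 : ℝ))) ((1, 0) : ℝ × ℝ) 0 :=
      (hasDerivAt_id _).prodMk (hasDerivAt_const _ _)
    have := HasFDerivAt.comp_hasDerivAt (f := fun s : ℝ => (s, (0 : ℝ))) (0 : ℝ) hgF e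
    refine this.unique ((hasDerivAt_const (0 : ℝ) (0 : V)).congr_of_eventuallyEq ?_)
    exact hg0
  rw [a1, a2, show ((1, 1) : ℝ × ℝ) = (1, 0) + (0, 1) by simp, map_add, a3, zero_add]

/-- A smooth function of two vectors, homogeneous in each of them and vanishing on the diagonal,
is an alternating form. -/
theorem exists_alternating_of_homogeneous {b : V × V → W}
    (hb : ContDiff ℝ ∞ b) (h₁ : ∀ (r : ℝ) X Y, b (r • X, Y) = r • b (X, Y))
    (h₂ : ∀ (r : ℝ) X Y, b (X, r • Y) = r • b (X, Y)) (h₀ : ∀ X, b (X, X) = 0) :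
    ∃ B : V [⋀^Fin 2]→L[ℝ] W, ∀ X Y, B ![X, Y] = b (X, Y) := by
  have a₁ : ∀ X X' Y, b (X + X', Y) = b (X, Y) + b (X', Y) := by
    intro X X' Y
    have h := eq_fderiv_of_homogeneous (f := fun X => b (X, Y))
      ((hb.comp (by fun_prop : ContDiff ℝ ∞ fun X : V => (X, Y))).differentiable (by simp) 0)
      (fun r X => h₁ r X Y)
    exact (h _).trans ((map_add _ _ _).trans (congrArg₂ _ (h _).symm (h _).symm))
  have a₂ : ∀ X Y Y', b (X, Y + Y') = b (X, Y) + b (X, Y') := by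
    intro X Y Y'
    have h := eq_fderiv_of_homogeneous (f := fun Y => b (X, Y))
      ((hb.comp (by fun_prop : ContDiff ℝ ∞ fun Y : V => (X, Y))).differentiable (by simp) 0)
      (fun r Y => h₂ r X Y)
    exact (h _).trans ((map_add _ _ _).trans (congrArg₂ _ (h _).symm (h _).symm))
  refine ⟨{ toFun := fun v => b (v 0, v 1)
            map_update_add' := ?_
            map_update_smul' := ?_
            cont := hb.continuous.comp (by fun_prop)
            map_eq_zero_of_eq' := ?_ }, fun X Y => rfl⟩
  · intro _ m i x y
    fin_cases i <;> simp [a₁, a₂]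
  · intro _ m i c x
    fin_cases i <;> simp [h₁, h₂]
  · intro v i j hij hne
    have : v 0 = v 1 := by
      fin_cases i <;> fin_cases j <;> simp_all
    change b (v 0, v 1) = 0
    rw [this, h₀]

end BilinearCalculus

/-! ### The transport 2-form -/

section SurfaceForm

variable {EG : Type*} [NormedAddCommGroup EG] [NormedSpace ℝ EG]
  {EH : Type*} [NormedAddCommGroup EH] [NormedSpace ℝ EH]
  {G : Type*} [TopologicalSpace G] [ChartedSpace EG G] [Group G] [LieGroup 𝓘(ℝ, EG) ∞ G]
  {H : Type*} [TopologicalSpace H] [ChartedSpace EH H] [Group H] [LieGroup 𝓘(ℝ, EH) ∞ H]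
  {C : SmoothCrossedModule EG EH G H}
  {E : Type*} [NormedAddCommGroup E] [NormedSpace ℝ E]
  {M : Type*} [TopologicalSpace M] [ChartedSpace E M]
  {F : TransportTwoFunctor C E M}
  {Z : Type*} [NormedAddCommGroup Z] [NormedSpace ℝ Z]

namespace TransportTwoFunctor.Bundle

variable (P : F.Bundle)

theorem convexCombination_mem {a x y : ℝ} (ha : 0 ≤ a) (ha' : a ≤ 1) (hx : 0 ≤ x) (hx' : x ≤ 1)
    (hy : 0 ≤ y) (hy' : y ≤ 1) : 0 ≤ (1 - a) * x + a * y ∧ (1 - a) * x + a * y ≤ 1 :=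
  ⟨by nlinarith, by nlinarith⟩

/-- Surface holonomy only depends on the piece of the surface it is taken along. -/
theorem surfaceHolonomy_congr {S S' : ℝ × ℝ → P.Space}
    {hS : ContMDiff 𝓘(ℝ, ℝ × ℝ) 𝓘(ℝ, E × EG) ∞ S}
    {hS' : ContMDiff 𝓘(ℝ, ℝ × ℝ) 𝓘(ℝ, E × EG) ∞ S'} {s t s' t' : ℝ}
    (h : ∀ a b, 0 ≤ a → a ≤ 1 → 0 ≤ b → b ≤ 1 → S' (s' * a, t' * b) = S (s * a, t * b)) :
    P.surfaceHolonomy S' hS' s' t' = P.surfaceHolonomy S hS s t := by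
  have h1 : S' (s', t') = S (s, t) := by
    simpa using h 1 1 zero_le_one le_rfl zero_le_one le_rfl
  refine F.hdiv_map₂_congr (funext fun z => ?_) h1
  have n := Real.smoothTransition.nonneg
  have l := Real.smoothTransition.le_one
  have c1 := convexCombination_mem (n (3 * z.1 - 1)) (l (3 * z.1 - 1)) (n (6 * (1 - z.2) - 4))
    (l (6 * (1 - z.2) - 4)) (n (6 * (1 - z.2) - 1)) (l (6 * (1 - z.2) - 1))
  have c2 := convexCombination_mem (n (3 * z.1 - 1)) (l (3 * z.1 - 1)) (n (6 * (1 - z.2) - 1))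
    (l (6 * (1 - z.2) - 1)) (n (6 * (1 - z.2) - 4)) (l (6 * (1 - z.2) - 4))
  exact congrArg P.proj (h _ _ c1.1 c1.2 c2.1 c2.2)

/-- Surface holonomy is trivial on maps factoring through the real line. -/
theorem surfaceHolonomy_factor {S : ℝ × ℝ → P.Space}
    {hS : ContMDiff 𝓘(ℝ, ℝ × ℝ) 𝓘(ℝ, E × EG) ∞ S} {c : ℝ → P.Space}
    (hc : ContMDiff 𝓘(ℝ, ℝ) 𝓘(ℝ, E × EG) ∞ c) {m : ℝ × ℝ → ℝ} (hm : ContDiff ℝ ∞ m)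
    (h : ∀ x, S x = c (m x)) (s t : ℝ) : P.surfaceHolonomy S hS s t = 1 :=
  -- The bigon is the image under the projected curve of the canonical bigon of `m` in the real
  -- line.
  F.hdiv_map₂_factor _ (canonicalBigon m hm.contMDiff s t).hinv
    (P.contMDiff_proj.comp hc) (fun _ => congrArg P.proj (h _)) _

/-- On a degenerate rectangle `S` can be replaced by `(s, t) ↦ S (s, 0)`, which factors through the
real line. -/
theorem surfaceHolonomy_zero_right (S : ℝ × ℝ → P.Space)
    (hS : ContMDiff 𝓘(ℝ, ℝ × ℝ) 𝓘(ℝ, E × EG) ∞ S) (s : ℝ) : P.surfaceHolonomy S hS s 0 = 1 := by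
  have hc : ContMDiff 𝓘(ℝ, ℝ) 𝓘(ℝ, E × EG) ∞ fun r : ℝ => S (r, 0) :=
    hS.comp (contDiff_id.prodMk contDiff_const).contMDiff
  have h := P.surfaceHolonomy_factor (hS := hc.comp contDiff_fst.contMDiff) hc contDiff_fst
    (fun _ => rfl) s 0
  rw [← h]
  exact P.surfaceHolonomy_congr (by simp)

theorem surfaceHolonomy_zero_left (S : ℝ × ℝ → P.Space)
    (hS : ContMDiff 𝓘(ℝ, ℝ × ℝ) 𝓘(ℝ, E × EG) ∞ S) (t : ℝ) : P.surfaceHolonomy S hS 0 t = 1 := by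
  have hc : ContMDiff 𝓘(ℝ, ℝ) 𝓘(ℝ, E × EG) ∞ fun r : ℝ => S (0, r) :=
    hS.comp (contDiff_const.prodMk contDiff_id).contMDiff
  have h := P.surfaceHolonomy_factor (hS := hc.comp contDiff_snd.contMDiff) hc contDiff_snd
    (fun _ => rfl) 0 t
  rw [← h]
  exact P.surfaceHolonomy_congr (by simp)

/-- The inverted bigons run from the projection of `K (z, s, t)` to that of `K (z, 0, 0)`: both ends
move, which is why `contMDiff_hdiv` allows this. -/
theorem contMDiff_surfaceHolonomy [FiniteDimensional ℝ Z] {K : Z × ℝ × ℝ → P.Space}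
    (hK : ContMDiff 𝓘(ℝ, Z × ℝ × ℝ) 𝓘(ℝ, E × EG) ∞ K)
    (hKz : ∀ z, ContMDiff 𝓘(ℝ, ℝ × ℝ) 𝓘(ℝ, E × EG) ∞ fun x => K (z, x)) :
    ContMDiff 𝓘(ℝ, Z × ℝ × ℝ) 𝓘(ℝ, EH) ∞
      (fun y : Z × ℝ × ℝ => P.surfaceHolonomy (fun x => K (y.1, x)) (hKz y.1) y.2.1 y.2.2) := by
  have hy : ContMDiff 𝓘(ℝ, Z × ℝ × ℝ) 𝓘(ℝ, E) ∞ fun y : Z × ℝ × ℝ => P.proj (K (y.1, (0, 0))) :=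
    P.contMDiff_proj.comp (hK.comp (contDiff_fst.prodMk contDiff_const).contMDiff)
  refine P.contMDiff_hdiv (p := K) hK hy (S := fun y => (canonicalBigon
    (fun x => P.proj (K (y.1, x))) (P.contMDiff_proj.comp (hKz y.1)) y.2.1 y.2.2).hinv) ?_
  refine ContMDiff.contMDiffOn ?_
  have hb : ContDiff ℝ ∞ fun y : (Z × ℝ × ℝ) × ℝ × ℝ => Real.smoothTransition (3 * y.2.1 - 1) :=
    contDiff_midStep.comp (contDiff_fst.comp contDiff_snd)
  have hr : ContDiff ℝ ∞ fun y : (Z × ℝ × ℝ) × ℝ × ℝ => 1 - y.2.2 := by fun_prop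
  have he : ContDiff ℝ ∞ fun y : (Z × ℝ × ℝ) × ℝ × ℝ => earlyStep (1 - y.2.2) :=
    contDiff_earlyStep.comp hr
  have hl : ContDiff ℝ ∞ fun y : (Z × ℝ × ℝ) × ℝ × ℝ => lateStep (1 - y.2.2) :=
    contDiff_lateStep.comp hr
  have hs : ContDiff ℝ ∞ fun y : (Z × ℝ × ℝ) × ℝ × ℝ => y.1.2.1 := by fun_prop
  have ht : ContDiff ℝ ∞ fun y : (Z × ℝ × ℝ) × ℝ × ℝ => y.1.2.2 := by fun_prop
  have hz : ContDiff ℝ ∞ fun y : (Z × ℝ × ℝ) × ℝ × ℝ => y.1.1 := by fun_prop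
  exact (P.contMDiff_proj.comp hK).comp (hz.prodMk
    ((hs.mul (((contDiff_const.sub hb).mul hl).add (hb.mul he))).prodMk
      (ht.mul (((contDiff_const.sub hb).mul he).add (hb.mul hl))))).contMDiff

theorem contMDiff_surfaceHolonomy_surface (S : ℝ × ℝ → P.Space)
    (hS : ContMDiff 𝓘(ℝ, ℝ × ℝ) 𝓘(ℝ, E × EG) ∞ S) :
    ContMDiff 𝓘(ℝ, ℝ × ℝ) 𝓘(ℝ, EH) ∞
      (fun x : ℝ × ℝ => P.surfaceHolonomy S hS x.1 x.2) := by
  have h1 := P.contMDiff_surfaceHolonomy (Z := ℝ) (K := fun x => S x.2)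
    (hS.comp contDiff_snd.contMDiff) (fun _ => hS)
  exact h1.comp (contDiff_const.prodMk contDiff_id :
    ContDiff ℝ ∞ fun x : ℝ × ℝ => ((0 : ℝ), x)).contMDiff

/-- The mixed derivative at the origin of the surface holonomy. -/
def surfaceRate (S : ℝ × ℝ → P.Space) (hS : ContMDiff 𝓘(ℝ, ℝ × ℝ) 𝓘(ℝ, E × EG) ∞ S) : EH :=
  mixedDeriv fun x : ℝ × ℝ => extChartAt 𝓘(ℝ, EH) (1 : H) (P.surfaceHolonomy S hS x.1 x.2)

theorem hasMixedDeriv_surfaceHolonomy (S : ℝ × ℝ → P.Space)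
    (hS : ContMDiff 𝓘(ℝ, ℝ × ℝ) 𝓘(ℝ, E × EG) ∞ S) :
    HasMixedDeriv (V := EH) (P.surfaceHolonomy S hS) 1 (P.surfaceRate S hS) :=
  haveI : IsManifold 𝓘(ℝ, EH) ∞ H := LieGroup.toContMDiffMul.toIsManifold
  ContMDiff.hasMixedDeriv (P.contMDiff_surfaceHolonomy_surface S hS)
    (P.surfaceHolonomy_zero_right S hS)

theorem surfaceRate_eq {S : ℝ × ℝ → P.Space} {hS : ContMDiff 𝓘(ℝ, ℝ × ℝ) 𝓘(ℝ, E × EG) ∞ S}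
    {b : EH} (h : HasMixedDeriv (V := EH) (P.surfaceHolonomy S hS) 1 b) :
    P.surfaceRate S hS = b :=
  (P.hasMixedDeriv_surfaceHolonomy S hS).unique h

theorem contDiff_surfaceRate [FiniteDimensional ℝ Z] {K : Z × ℝ × ℝ → P.Space}
    (hK : ContMDiff 𝓘(ℝ, Z × ℝ × ℝ) 𝓘(ℝ, E × EG) ∞ K)
    (hKz : ∀ z, ContMDiff 𝓘(ℝ, ℝ × ℝ) 𝓘(ℝ, E × EG) ∞ fun x => K (z, x)) :
    ContDiff ℝ ∞ fun z => P.surfaceRate (fun x => K (z, x)) (hKz z) := by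
  have : IsManifold 𝓘(ℝ, EH) ∞ H := LieGroup.toContMDiffMul.toIsManifold
  rw [contDiff_iff_contDiffAt]
  intro z
  have h1 := ContMDiffAt.contDiffAt_extChartAt (e := (1 : H))
    ((P.contMDiff_surfaceHolonomy hK hKz).contMDiffAt (x := (z, 0, 0)))
    (by rw [surfaceHolonomy_zero_right]; exact mem_extChartAt_source _)
  exact h1.mixedDeriv_param

theorem surfaceRate_comp_mul {S S' : ℝ × ℝ → P.Space}
    {hS : ContMDiff 𝓘(ℝ, ℝ × ℝ) 𝓘(ℝ, E × EG) ∞ S}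
    {hS' : ContMDiff 𝓘(ℝ, ℝ × ℝ) 𝓘(ℝ, E × EG) ∞ S'} {r q : ℝ}
    (h : ∀ s t, S' (s, t) = S (r * s, q * t)) :
    P.surfaceRate S' hS' = (r * q) • P.surfaceRate S hS := by
  refine P.surfaceRate_eq ?_
  have h1 := (P.hasMixedDeriv_surfaceHolonomy S hS).comp_mul r q
  have h2 : P.surfaceHolonomy S' hS' = fun s t => P.surfaceHolonomy S hS (r * s) (q * t) :=
    funext fun s => funext fun t => P.surfaceHolonomy_congr fun a b _ _ _ _ => by
      rw [h, mul_assoc, mul_assoc]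
  rw [h2]
  exact h1

theorem surfaceRate_congr {S S' : ℝ × ℝ → P.Space}
    {hS : ContMDiff 𝓘(ℝ, ℝ × ℝ) 𝓘(ℝ, E × EG) ∞ S}
    {hS' : ContMDiff 𝓘(ℝ, ℝ × ℝ) 𝓘(ℝ, E × EG) ∞ S'} (h : S' =ᶠ[nhds 0] S) :
    P.surfaceRate S' hS' = P.surfaceRate S hS := by
  refine Filter.EventuallyEq.mixedDeriv_eq ?_
  obtain ⟨ε, hε, hb⟩ := Metric.eventually_nhds_iff.1 h
  filter_upwards [Metric.ball_mem_nhds (0 : ℝ × ℝ) hε] with x hx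
  rw [P.surfaceHolonomy_congr (S := S) (hS := hS) (s := x.1) (t := x.2)]
  intro a b ha ha' hb0 hb'
  refine hb ?_
  simp only [Metric.mem_ball, dist_zero_right, Prod.norm_def, Real.norm_eq_abs,
    sup_lt_iff, abs_mul] at hx ⊢
  rw [abs_of_nonneg ha, abs_of_nonneg hb0]
  constructor <;> nlinarith [abs_nonneg x.1, abs_nonneg x.2]

theorem surfaceRate_factor {S : ℝ × ℝ → P.Space}
    {hS : ContMDiff 𝓘(ℝ, ℝ × ℝ) 𝓘(ℝ, E × EG) ∞ S} {c : ℝ → P.Space}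
    (hc : ContMDiff 𝓘(ℝ, ℝ) 𝓘(ℝ, E × EG) ∞ c) {m : ℝ × ℝ → ℝ} (hm : ContDiff ℝ ∞ m)
    (h : ∀ x, S x = c (m x)) : P.surfaceRate S hS = 0 := by
  simp [surfaceRate, P.surfaceHolonomy_factor hc hm h, mixedDeriv]

/-- The rate of surface holonomy only depends on the two velocities of the surface. -/
theorem surfaceRate_eq_of_coordinates [FiniteDimensional ℝ E] [FiniteDimensional ℝ EG]
    [CompleteSpace EH]
    {p : P.Space} {Ψ : E × EG → P.Space} (hΨs : ContMDiff 𝓘(ℝ, E × EG) 𝓘(ℝ, E × EG) ∞ Ψ)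
    (hΨ : Ψ =ᶠ[nhds (extChartAt 𝓘(ℝ, E × EG) p p)] (extChartAt 𝓘(ℝ, E × EG) p).symm)
    (hl : ∀ X : (E × EG) × (E × EG), ContMDiff 𝓘(ℝ, ℝ × ℝ) 𝓘(ℝ, E × EG) ∞
      fun x : ℝ × ℝ => Ψ (extChartAt 𝓘(ℝ, E × EG) p p + (x.1 • X.1 + x.2 • X.2)))
    {S : ℝ × ℝ → P.Space} (hS : ContMDiff 𝓘(ℝ, ℝ × ℝ) 𝓘(ℝ, E × EG) ∞ S) (hS0 : S 0 = p)
    {X Y : E × EG} (hX : HasVelocity (V := E × EG) (fun s => S (s, 0)) X)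
    (hY : HasVelocity (V := E × EG) (fun t => S (0, t)) Y) :
    P.surfaceRate S hS = P.surfaceRate _ (hl (X, Y)) := by
  set z₀ := extChartAt 𝓘(ℝ, E × EG) p p with hz₀
  obtain ⟨k, hk, hk0, hSk⟩ := exists_contDiff_coordinates hΨ hS hS0
  have hk0' : k (0, 0) = 0 := hk0
  -- Hadamard's lemma in each variable: `k (s, t) = s e₁(t, s) + t e₂(0, t)`, where `e₁(0, 0) = X`
  -- and `e₂(0, 0) = Y`.
  obtain ⟨e₁, he₁, hke₁, hkd₁⟩ := exists_contDiff_eq_smul (Z := ℝ)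
    (f := fun x : ℝ × ℝ => k (x.2, x.1) - k (0, x.1))
    ((hk.comp (by fun_prop : ContDiff ℝ ∞ fun x : ℝ × ℝ => (x.2, x.1))).sub
      (hk.comp (by fun_prop : ContDiff ℝ ∞ fun x : ℝ × ℝ => ((0 : ℝ), x.1)))) (by simp)
  obtain ⟨e₂, he₂, hke₂, hkd₂⟩ := exists_contDiff_eq_smul (Z := ℝ)
    (f := fun x : ℝ × ℝ => k (0, x.2))
    (hk.comp (by fun_prop : ContDiff ℝ ∞ fun x : ℝ × ℝ => ((0 : ℝ), x.2))) (fun _ => hk0')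
  simp only at hke₁ hke₂
  have hk₁₂ : ∀ s t, s • e₁ (t, s) + t • e₂ (0, t) = k (s, t) := by
    intro s t
    rw [← hke₁, ← hke₂, sub_add_cancel]
  have hXe : e₁ (0, 0) = X := by
    have he : (fun s => S (s, 0)) =ᶠ[nhds 0] fun s => Ψ (z₀ + k (s, 0)) :=
      ((by fun_prop : Continuous fun s : ℝ => (s, (0 : ℝ))).tendsto' 0 0 rfl).eventually hSk
    refine (HasVelocity.congr ?_ he).unique hX
    refine hasVelocity_extChartAt_symm hΨ (c := fun s => z₀ + k (s, 0)) ?_ (by simp [hk0', hz₀])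
    have := hkd₁ 0
    simp only [hk0', sub_zero] at this
    exact this.const_add z₀
  have hYe : e₂ (0, 0) = Y := by
    have he : (fun s => S (0, s)) =ᶠ[nhds 0] fun s => Ψ (z₀ + k (0, s)) :=
      ((by fun_prop : Continuous fun s : ℝ => ((0 : ℝ), s)).tendsto' 0 0 rfl).eventually hSk
    refine (HasVelocity.congr ?_ he).unique hY
    exact hasVelocity_extChartAt_symm hΨ (c := fun s => z₀ + k (0, s)) ((hkd₂ 0).const_add z₀)
      (by simp [hk0', hz₀])
  have hkS : ContMDiff 𝓘(ℝ, ℝ × ℝ) 𝓘(ℝ, E × EG) ∞ fun x => Ψ (z₀ + k x) :=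
    hΨs.comp (contDiff_const.add hk).contMDiff
  rw [P.surfaceRate_congr (hS' := hS) (hS := hkS) hSk]
  -- This is `k (ε s, ε t) / ε`, extended smoothly to `ε = 0` by the linear surface `s X + t Y`.
  let κ : ℝ × ℝ × ℝ → E × EG := fun y =>
    y.2.1 • e₁ (y.1 * y.2.2, y.1 * y.2.1) + y.2.2 • e₂ (0, y.1 * y.2.2)
  have hκ : ContDiff ℝ ∞ κ := by
    have h1 : ContDiff ℝ ∞ fun y : ℝ × ℝ × ℝ => e₁ (y.1 * y.2.2, y.1 * y.2.1) :=
      he₁.comp (by fun_prop)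
    have h2 : ContDiff ℝ ∞ fun y : ℝ × ℝ × ℝ => e₂ (0, y.1 * y.2.2) :=
      he₂.comp (by fun_prop : ContDiff ℝ ∞ fun y : ℝ × ℝ × ℝ => ((0 : ℝ), y.1 * y.2.2))
    exact (ContDiff.smul (by fun_prop : ContDiff ℝ ∞ fun y : ℝ × ℝ × ℝ => y.2.1) h1).add
      (ContDiff.smul (by fun_prop : ContDiff ℝ ∞ fun y : ℝ × ℝ × ℝ => y.2.2) h2)
  have hκε : ∀ ε : ℝ, ContDiff ℝ ∞ fun x : ℝ × ℝ => κ (ε, x) := fun ε =>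
    hκ.comp (by fun_prop)
  have hfam : ContMDiff 𝓘(ℝ, (((E × EG) →L[ℝ] (E × EG)) × ℝ) × ℝ × ℝ) 𝓘(ℝ, E × EG) ∞
      fun y : (((E × EG) →L[ℝ] (E × EG)) × ℝ) × ℝ × ℝ => Ψ (z₀ + y.1.1 (κ (y.1.2, y.2))) := by
    refine hΨs.comp (ContDiff.contMDiff (contDiff_const.add (ContDiff.clm_apply (by fun_prop) ?_)))
    exact hκ.comp (by fun_prop)
  have hfamz : ∀ w : ((E × EG) →L[ℝ] (E × EG)) × ℝ, ContMDiff 𝓘(ℝ, ℝ × ℝ) 𝓘(ℝ, E × EG) ∞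
      fun x : ℝ × ℝ => Ψ (z₀ + w.1 (κ (w.2, x))) := fun w =>
    hΨs.comp (contDiff_const.add (w.1.contDiff.comp (hκε w.2))).contMDiff
  -- The auxiliary parameter `L` allows degenerations: for `L` of rank one the surface lies on a
  -- line in the chart, and its holonomy is trivial.
  let Φ : ((E × EG) →L[ℝ] (E × EG)) × ℝ → EH := fun w => P.surfaceRate _ (hfamz w)
  have hΦ : ContDiff ℝ ∞ Φ := P.contDiff_surfaceRate hfam hfamz
  have hrank : ∀ (ℓ : (E × EG) →L[ℝ] ℝ) (v : E × EG) (r ε : ℝ), Φ (r • ℓ.smulRight v, ε) = 0 := by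
    intro ℓ v r ε
    refine P.surfaceRate_factor (c := fun τ : ℝ => Ψ (z₀ + τ • v))
      (hΨs.comp (contDiff_const.add (contDiff_id.smul contDiff_const)).contMDiff)
      (m := fun x => r * ℓ (κ (ε, x))) (contDiff_const.mul (ℓ.contDiff.comp (hκε ε))) fun x => ?_
    simp [smul_smul]
  have hdir : ∀ (L : (E × EG) →L[ℝ] (E × EG)) (ε : ℝ),
      HasDerivAt (fun r : ℝ => Φ (r • L, ε)) (fderiv ℝ Φ (0, ε) (L, 0)) 0 := by
    intro L ε
    have h1 : HasDerivAt (fun r : ℝ => (r • L, ε)) (L, (0 : ℝ)) 0 := by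
      have h2 := (hasDerivAt_id (0 : ℝ)).smul_const L
      rw [one_smul] at h2
      exact h2.prodMk (hasDerivAt_const _ _)
    have h3 : HasFDerivAt Φ (fderiv ℝ Φ (0, ε)) ((0 : ℝ) • L, ε) := by
      rw [zero_smul]
      exact (hΦ.differentiable (by simp) _).hasFDerivAt
    exact h3.comp_hasDerivAt (0 : ℝ) h1
  -- The identity is a sum of rank one maps, and the derivative of `Φ` at `L = 0` vanishes on each
  -- of them.
  have hid : ∀ ε : ℝ, fderiv ℝ Φ (0, ε) (ContinuousLinearMap.id ℝ (E × EG), 0) = 0 := by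
    intro ε
    let B := Module.finBasis ℝ (E × EG)
    have h1 : ContinuousLinearMap.id ℝ (E × EG) =
        ∑ i, (LinearMap.toContinuousLinearMap (B.coord i)).smulRight (B i) := by
      refine ContinuousLinearMap.ext fun v => ?_
      simp only [sum_apply, ContinuousLinearMap.smulRight_apply,
        LinearMap.coe_toContinuousLinearMap', Module.Basis.coord_apply]
      exact (B.sum_repr v).symm
    have h2 : (ContinuousLinearMap.id ℝ (E × EG), (0 : ℝ)) =
        ∑ i, (((LinearMap.toContinuousLinearMap (B.coord i)).smulRight (B i), 0) :
          ((E × EG) →L[ℝ] (E × EG)) × ℝ) := by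
      refine Prod.ext ?_ ?_
      · rw [Prod.fst_sum]; exact h1
      · simp [Prod.snd_sum]
    rw [h2, map_sum]
    refine Finset.sum_eq_zero fun i _ => ?_
    refine (hdir _ ε).unique ?_
    simp only [hrank]
    exact hasDerivAt_const _ _
  let φ : ℝ × ℝ → EH := fun x => Φ (x.1 • ContinuousLinearMap.id ℝ (E × EG), x.2)
  have hφ : ContDiff ℝ ∞ φ := hΦ.comp
    (by fun_prop : ContDiff ℝ ∞ fun x : ℝ × ℝ =>
      (x.1 • ContinuousLinearMap.id ℝ (E × EG), x.2))
  -- Rescaling gives `φ (ε, ε) = ε²` times the rate of the given surface, since `ε κ(ε, x) = k (ε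
  -- x)`, and `φ (d, 0) = d²` times the rate of the linear one.
  refine eq_of_quadratic hφ (fun ε => ?_) (fun ε => ?_) (fun ε => ?_) (fun d => ?_)
  · have := hrank 0 0 0 ε
    simpa [φ] using this
  · rw [← hid ε]
    exact hdir _ ε
  · rw [sq]
    refine P.surfaceRate_comp_mul fun s t => ?_
    simp only [κ, smul_apply, ContinuousLinearMap.id_apply]
    rw [smul_add, smul_smul, smul_smul, hk₁₂]
  · rw [sq]
    refine P.surfaceRate_comp_mul fun s t => ?_
    simp only [κ, smul_apply, ContinuousLinearMap.id_apply, zero_mul, hXe, hYe]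
    rw [smul_add, smul_smul, smul_smul]

/-- The rate of `s X + t Y` in a chart is smooth in `(X, Y)`, homogeneous in each variable by
rescaling `s` or `t`, and zero for `X = Y`, where the surface depends only on `s + t`. -/
theorem exists_isTransportTwoForm [FiniteDimensional ℝ E] [FiniteDimensional ℝ EG]
    [CompleteSpace EH] : ∃ B : P.TwoForm, P.IsTransportTwoForm B := by
  have h : ∀ p : P.Space, ∃ B : (E × EG) [⋀^Fin 2]→L[ℝ] EH,
      ∀ (S : ℝ × ℝ → P.Space) (hS : ContMDiff 𝓘(ℝ, ℝ × ℝ) 𝓘(ℝ, E × EG) ∞ S) (X Y : E × EG),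
      S 0 = p → HasVelocity (V := E × EG) (fun s => S (s, 0)) X →
      HasVelocity (V := E × EG) (fun t => S (0, t)) Y → P.surfaceRate S hS = B ![X, Y] := by
    intro p
    obtain ⟨Ψ, hΨs, hΨ⟩ := exists_contMDiff_eq_extChartAt_symm p
      (mem_extChartAt_target (I := 𝓘(ℝ, E × EG)) p)
    have hfam : ContMDiff 𝓘(ℝ, ((E × EG) × (E × EG)) × ℝ × ℝ) 𝓘(ℝ, E × EG) ∞
        fun y : ((E × EG) × (E × EG)) × ℝ × ℝ =>
        Ψ (extChartAt 𝓘(ℝ, E × EG) p p + (y.2.1 • y.1.1 + y.2.2 • y.1.2)) := by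
      refine hΨs.comp (ContDiff.contMDiff (contDiff_const.add ?_))
      fun_prop
    have hl : ∀ X : (E × EG) × (E × EG), ContMDiff 𝓘(ℝ, ℝ × ℝ) 𝓘(ℝ, E × EG) ∞
        fun x : ℝ × ℝ => Ψ (extChartAt 𝓘(ℝ, E × EG) p p + (x.1 • X.1 + x.2 • X.2)) := by
      refine fun X => hΨs.comp (ContDiff.contMDiff (contDiff_const.add ?_))
      fun_prop
    have hb := P.contDiff_surfaceRate hfam hl
    have h₁ : ∀ (r : ℝ) X Y, P.surfaceRate _ (hl (r • X, Y)) = r • P.surfaceRate _ (hl (X, Y)) := by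
      intro r X Y
      refine (P.surfaceRate_comp_mul (r := r) (q := 1) (hS := hl (X, Y)) fun s t => ?_).trans
        (by rw [mul_one])
      simp [smul_smul, mul_comm]
    have h₂ : ∀ (r : ℝ) X Y, P.surfaceRate _ (hl (X, r • Y)) = r • P.surfaceRate _ (hl (X, Y)) := by
      intro r X Y
      refine (P.surfaceRate_comp_mul (r := 1) (q := r) (hS := hl (X, Y)) fun s t => ?_).trans
        (by rw [one_mul])
      simp [smul_smul, mul_comm]
    have h₀ : ∀ X, P.surfaceRate _ (hl (X, X)) = 0 := by
      intro X
      refine P.surfaceRate_factor (m := fun x => x.1 + x.2)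
        (c := fun r : ℝ => Ψ (extChartAt 𝓘(ℝ, E × EG) p p + r • X))
        (hΨs.comp (contDiff_const.add (contDiff_id.smul contDiff_const)).contMDiff)
        (by fun_prop) fun x => ?_
      simp only [add_smul]
    obtain ⟨B, hB⟩ := exists_alternating_of_homogeneous hb h₁ h₂ h₀
    refine ⟨B, fun S hS X Y hS0 hX hY => ?_⟩
    rw [hB, P.surfaceRate_eq_of_coordinates hΨs hΨ hl hS hS0 hX hY]
  choose B hB using h
  refine ⟨B, fun S hS X Y hX hY => ?_⟩
  have h1 := P.hasMixedDeriv_surfaceHolonomy S hS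
  rw [hB (S 0) S hS X Y rfl hX hY] at h1
  exact h1

variable {P}

theorem IsTransportTwoForm.surfaceRate_eq {B : P.TwoForm} (hB : P.IsTransportTwoForm B)
    {S : ℝ × ℝ → P.Space} (hS : ContMDiff 𝓘(ℝ, ℝ × ℝ) 𝓘(ℝ, E × EG) ∞ S) {p : P.Space}
    (hS0 : S (0, 0) = p) {X Y : TangentSpace 𝓘(ℝ, E × EG) p}
    (hX : HasVelocity (V := E × EG) (fun s => S (s, 0)) X)
    (hY : HasVelocity (V := E × EG) (fun t => S (0, t)) Y) :
    P.surfaceRate S hS = B p ![X, Y] := by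
  subst hS0
  exact P.surfaceRate_eq (hB S hS X Y hX hY)

/-- There are smooth surfaces with any given velocities. -/
theorem _root_.exists_hasVelocity_surface {V : Type*} [NormedAddCommGroup V] [NormedSpace ℝ V]
    [FiniteDimensional ℝ V] {N : Type*} [TopologicalSpace N] [ChartedSpace V N]
    [IsManifold 𝓘(ℝ, V) ∞ N] (p : N) (X Y : V) :
    ∃ S : ℝ × ℝ → N, ContMDiff 𝓘(ℝ, ℝ × ℝ) 𝓘(ℝ, V) ∞ S ∧ S (0, 0) = p ∧
      HasVelocity (V := V) (fun s => S (s, 0)) X ∧ HasVelocity (V := V) (fun t => S (0, t)) Y := by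
  obtain ⟨Ψ, hΨs, hΨ⟩ := exists_contMDiff_eq_extChartAt_symm p
    (mem_extChartAt_target (I := 𝓘(ℝ, V)) p)
  have hl : ∀ X : V, HasDerivAt (fun t : ℝ => extChartAt 𝓘(ℝ, V) p p + t • X) X 0 := fun X => by
    have := ((hasDerivAt_id (0 : ℝ)).smul_const X).const_add (extChartAt 𝓘(ℝ, V) p p)
    rwa [one_smul] at this
  refine ⟨fun x => Ψ (extChartAt 𝓘(ℝ, V) p p + (x.1 • X + x.2 • Y)),
    hΨs.comp (contDiff_const.add (by fun_prop)).contMDiff, ?_, ?_, ?_⟩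
  · simp only [zero_smul, add_zero]
    rw [hΨ.eq_of_nhds, extChartAt_to_inv]
  · refine hasVelocity_extChartAt_symm hΨ
      (c := fun s : ℝ => extChartAt 𝓘(ℝ, V) p p + (s • X + (0 : ℝ) • Y)) ?_ (by simp)
    simpa only [zero_smul, add_zero] using hl X
  · refine hasVelocity_extChartAt_symm hΨ
      (c := fun s : ℝ => extChartAt 𝓘(ℝ, V) p p + ((0 : ℝ) • X + s • Y)) ?_ (by simp)
    simpa only [zero_smul, zero_add] using hl Y

theorem existsUnique_isTransportTwoForm [FiniteDimensional ℝ E] [FiniteDimensional ℝ EG]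
    [CompleteSpace EH] (P : F.Bundle) : ∃! B : P.TwoForm, P.IsTransportTwoForm B := by
  obtain ⟨B, hB⟩ := P.exists_isTransportTwoForm
  refine ⟨B, hB, fun B' hB' => funext fun p => ContinuousAlternatingMap.ext fun v => ?_⟩
  obtain ⟨S, hS, hS0, hX, hY⟩ := exists_hasVelocity_surface (V := E × EG) p (v 0) (v 1)
  have h := (hB'.surfaceRate_eq hS hS0 hX hY).symm.trans (hB.surfaceRate_eq hS hS0 hX hY)
  have hv : v = ![v 0, v 1] := by
    funext i
    fin_cases i <;> rfl
  rw [hv]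
  exact h

theorem IsTransportTwoForm.smoothTwoForm [FiniteDimensional ℝ E] [FiniteDimensional ℝ EG]
    {B : P.TwoForm} (hB : P.IsTransportTwoForm B) : SmoothTwoForm B := by
  intro p₀ v v' z₀ hz₀
  obtain ⟨Ψ, hΨs, hΨ⟩ := exists_contMDiff_eq_extChartAt_symm p₀ hz₀
  have hfam : ContMDiff 𝓘(ℝ, (E × EG) × ℝ × ℝ) 𝓘(ℝ, E × EG) ∞ fun x : (E × EG) × ℝ × ℝ =>
      Ψ (x.1 + (x.2.1 • v + x.2.2 • v')) :=
    hΨs.comp (ContDiff.contMDiff (by fun_prop))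
  have hl : ∀ z : E × EG, ContMDiff 𝓘(ℝ, ℝ × ℝ) 𝓘(ℝ, E × EG) ∞
      fun x : ℝ × ℝ => Ψ (z + (x.1 • v + x.2 • v')) := fun z =>
    hΨs.comp (ContDiff.contMDiff (by fun_prop))
  refine ContDiffAt.contDiffWithinAt ?_
  refine (P.contDiff_surfaceRate hfam hl).contDiffAt.congr_of_eventuallyEq ?_
  filter_upwards [eventually_eventually_nhds.2 hΨ,
    (isOpen_extChartAt_target (I := 𝓘(ℝ, E × EG)) p₀).mem_nhds hz₀] with z hz hzt
  refine (hB.surfaceRate_eq (hl z) (by simpa using hz.self_of_nhds) ?_ ?_).symm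
  · refine HasVelocity.congr (hasVelocity_chartVector hzt hz v) (Filter.EventuallyEq.of_eq ?_)
    simp only [zero_smul, add_zero]
  · refine HasVelocity.congr (hasVelocity_chartVector hzt hz v') (Filter.EventuallyEq.of_eq ?_)
    simp only [zero_smul, zero_add]

/-- Equivariance turns the holonomy of `R_g ∘ S` at `x` into `α (g (S x))⁻¹` applied to that of `S`
at `x`. The two occurrences of `x` are separated. As surface holonomy is `1` on both axes,
`mixedDeriv_diag` freezes `g` at the origin, so `g` may be an arbitrary smooth map. -/
theorem IsTransportTwoForm.pullbackEq [FiniteDimensional ℝ E] [FiniteDimensional ℝ EG]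
    {B : P.TwoForm} (hB : P.IsTransportTwoForm B) {g : P.Space → G}
    (hg : ContMDiff 𝓘(ℝ, E × EG) 𝓘(ℝ, EG) ∞ g) : P.PullbackEq B g := by
  have : IsManifold 𝓘(ℝ, EH) ∞ H := LieGroup.toContMDiffMul.toIsManifold
  intro p X Y
  obtain ⟨S, hS, rfl, hX, hY⟩ := exists_hasVelocity_surface (V := E × EG) p X Y
  have hR := P.contMDiff_rightMul hg
  have hS' : ContMDiff 𝓘(ℝ, ℝ × ℝ) 𝓘(ℝ, E × EG) ∞ fun x => P.rightMul g (S x) := hR.comp hS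
  have hX' := hX.comp_mfderiv (f := P.rightMul g) (hR.mdifferentiable (by simp) _)
  have hY' := hY.comp_mfderiv (f := P.rightMul g) (hR.mdifferentiable (by simp) _)
  refine (hB.surfaceRate_eq hS' rfl hX' hY').symm.trans ?_
  have hα : ∀ a : G, ContMDiff 𝓘(ℝ, EH) 𝓘(ℝ, EH) ∞ fun h => C.α a h := fun a =>
    C.α_smooth.comp (contMDiff_const.prodMk contMDiff_id)
  have hQ : ContMDiff 𝓘(ℝ, (ℝ × ℝ) × (ℝ × ℝ)) 𝓘(ℝ, EH) ∞ fun y : (ℝ × ℝ) × (ℝ × ℝ) =>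
      C.α (g (S y.1))⁻¹ (P.surfaceHolonomy S hS y.2.1 y.2.2) :=
    C.α_smooth.comp ((((hg.comp hS).comp contDiff_fst.contMDiff).inv).prodMk
      ((P.contMDiff_surfaceHolonomy_surface S hS).comp contDiff_snd.contMDiff))
  have hQ' := ContMDiffAt.contDiffAt_extChartAt (e := (1 : H)) (z₀ := 0) hQ.contMDiffAt (by
    simp only [Prod.snd_zero, Prod.fst_zero, surfaceHolonomy_zero_right, map_one]
    exact mem_extChartAt_source _)
  have h1 := mixedDeriv_diag hQ' (y := extChartAt 𝓘(ℝ, EH) (1 : H) 1)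
    (fun z s => by simp only [surfaceHolonomy_zero_right, map_one])
    (fun z t => by simp only [surfaceHolonomy_zero_left, map_one])
  refine Eq.trans (Eq.trans ?_ h1) ?_
  · refine congrArg mixedDeriv (funext fun x => congrArg _ ?_)
    exact F.hdiv_map₂_act _ _ _
  · have h2 := (hB S hS X Y hX hY).comp_mfderiv (f := fun h => C.α (g (S (0, 0)))⁻¹ h)
      ((hα _).mdifferentiable (by simp) _)
    have h3 : ContMDiff 𝓘(ℝ, ℝ × ℝ) 𝓘(ℝ, EH) ∞ fun x : ℝ × ℝ =>
        C.α (g (S (0, 0)))⁻¹ (P.surfaceHolonomy S hS x.1 x.2) :=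
      (hα _).comp (P.contMDiff_surfaceHolonomy_surface S hS)
    have h4 := ContMDiff.hasMixedDeriv (u := fun s t =>
      C.α (g (S (0, 0)))⁻¹ (P.surfaceHolonomy S hS s t)) (e := 1) h3
      (fun s => by simp only [surfaceHolonomy_zero_right, map_one])
    rw [map_one] at h2
    exact h4.unique h2

end TransportTwoFunctor.Bundle

end SurfaceForm

end

noncomputable section

/-! ### Rules for mixed derivatives -/

section MixedDeriv

variable {V : Type*} [NormedAddCommGroup V] [NormedSpace ℝ V]
  {W : Type*} [NormedAddCommGroup W] [NormedSpace ℝ W]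

/-- The chain rule for mixed derivatives. -/
theorem mixedDeriv_comp {φ : V → W} {k : ℝ × ℝ → V} (hk : ContDiffAt ℝ ∞ k 0) {x : V}
    (hφ : ContDiffAt ℝ ∞ φ x) (hx : k 0 = x) {ks kt : V}
    (hs : HasDerivAt (fun s => k (s, 0)) ks 0) (ht : HasDerivAt (fun t => k (0, t)) kt 0) :
    mixedDeriv (fun z => φ (k z)) =
      fderiv ℝ (fderiv ℝ φ) x ks kt + fderiv ℝ φ x (mixedDeriv k) := by
  have hs0 : Filter.Tendsto (fun s : ℝ => (s, (0 : ℝ))) (nhds 0) (nhds 0) :=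
    (by fun_prop : Continuous fun s : ℝ => (s, (0 : ℝ))).tendsto 0
  have hks : Filter.Tendsto (fun s : ℝ => k (s, 0)) (nhds 0) (nhds x) := by
    rw [← hx]
    exact hk.continuousAt.tendsto.comp hs0
  have h1 : (fun s => deriv (fun t => φ (k (s, t))) 0) =ᶠ[nhds 0]
      fun s => fderiv ℝ φ (k (s, 0)) (deriv (fun t => k (s, t)) 0) := by
    filter_upwards [hs0.eventually ((hk.of_le (m := 1) (by simp)).eventually (by simp)),
      hks.eventually ((hφ.of_le (m := 1) (by simp)).eventually (by simp))] with s h2 h3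
    have h4 : DifferentiableAt ℝ (fun t : ℝ => k (s, t)) 0 :=
      DifferentiableAt.comp (g := k) (0 : ℝ) (h2.differentiableAt (by simp)) (by fun_prop)
    exact ((h3.differentiableAt (by simp)).hasFDerivAt.comp_hasDerivAt (0 : ℝ) h4.hasDerivAt).deriv
  have h5 : HasDerivAt (fun s => fderiv ℝ φ (k (s, 0))) (fderiv ℝ (fderiv ℝ φ) x ks) 0 := by
    have h6 : HasFDerivAt (fderiv ℝ φ) (fderiv ℝ (fderiv ℝ φ) x) (k (0, 0)) := by
      rw [show k (0, 0) = x from hx]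
      exact ((hφ.fderiv_right (m := ∞) (by simp)).differentiableAt (by simp)).hasFDerivAt
    exact h6.comp_hasDerivAt (0 : ℝ) hs
  have h7 := (h5.clm_apply hk.hasDerivAt_mixedDeriv).congr_of_eventuallyEq h1
  rw [ht.deriv, show k (0, 0) = x from hx] at h7
  exact h7.deriv

theorem mixedDeriv_prodMk {f : ℝ × ℝ → V} {g : ℝ × ℝ → W} (hf : ContDiffAt ℝ ∞ f 0)
    (hg : ContDiffAt ℝ ∞ g 0) :
    mixedDeriv (fun x => (f x, g x)) = (mixedDeriv f, mixedDeriv g) := by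
  refine ((hf.hasDerivAt_mixedDeriv.prodMk hg.hasDerivAt_mixedDeriv).congr_of_eventuallyEq
    ?_).deriv
  have hs0 : Filter.Tendsto (fun s : ℝ => (s, (0 : ℝ))) (nhds 0) (nhds 0) :=
    (by fun_prop : Continuous fun s : ℝ => (s, (0 : ℝ))).tendsto 0
  filter_upwards [hs0.eventually ((hf.of_le (m := 1) (by simp)).eventually (by simp)),
    hs0.eventually ((hg.of_le (m := 1) (by simp)).eventually (by simp))] with s h2 h3
  have h4 : DifferentiableAt ℝ (fun t : ℝ => f (s, t)) 0 :=
    DifferentiableAt.comp (g := f) (0 : ℝ) (h2.differentiableAt (by simp)) (by fun_prop)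
  have h5 : DifferentiableAt ℝ (fun t : ℝ => g (s, t)) 0 :=
    DifferentiableAt.comp (g := g) (0 : ℝ) (h3.differentiableAt (by simp)) (by fun_prop)
  exact (h4.hasDerivAt.prodMk h5.hasDerivAt).deriv

/-- The chain rule for the linear maps `(s, t)` and `(t, s)`, whose own mixed derivatives vanish,
reduces this to symmetry of the second derivative. -/
theorem mixedDeriv_swap {f : ℝ × ℝ → V} (hf : ContDiffAt ℝ ∞ f 0) :
    mixedDeriv (fun x => f (x.2, x.1)) = mixedDeriv f := by
  have hc : ∀ c : ℝ, HasDerivAt (fun _ : ℝ => c) 0 0 := fun c => hasDerivAt_const _ _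
  have hi : HasDerivAt (fun s : ℝ => s) 1 0 := hasDerivAt_id _
  have h1 := mixedDeriv_comp (k := fun x : ℝ × ℝ => (x.1, x.2)) (φ := f) (by fun_prop) hf rfl
    (hi.prodMk (hc 0)) ((hc 0).prodMk hi)
  have h2 := mixedDeriv_comp (k := fun x : ℝ × ℝ => (x.2, x.1)) (φ := f) (by fun_prop) hf rfl
    ((hc 0).prodMk hi) (hi.prodMk (hc 0))
  have h3 : mixedDeriv (fun x : ℝ × ℝ => (x.1, x.2)) = 0 := by
    refine (mixedDeriv_prodMk (f := fun x : ℝ × ℝ => x.1) (g := fun x : ℝ × ℝ => x.2)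
      (by fun_prop) (by fun_prop)).trans ?_
    simp [mixedDeriv]
  have h4 : mixedDeriv (fun x : ℝ × ℝ => (x.2, x.1)) = 0 := by
    refine (mixedDeriv_prodMk (f := fun x : ℝ × ℝ => x.2) (g := fun x : ℝ × ℝ => x.1)
      (by fun_prop) (by fun_prop)).trans ?_
    simp [mixedDeriv]
  rw [h4] at h2
  rw [h3] at h1
  refine h2.trans (Eq.trans ?_ h1.symm)
  rw [(hf.isSymmSndFDerivAt (by simpa using WithTop.coe_le_coe.2 (le_top (a := (2 : ℕ∞))))).eq]

end MixedDeriv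

/-! ### Multiplication and Lie bracket in a chart at the identity -/

section GroupChart

theorem HasVelocity.comp_mfderiv_of_eq {V : Type*} [NormedAddCommGroup V] [NormedSpace ℝ V]
    {N : Type*} [TopologicalSpace N] [ChartedSpace V N]
    {V' : Type*} [NormedAddCommGroup V'] [NormedSpace ℝ V']
    {N' : Type*} [TopologicalSpace N'] [ChartedSpace V' N']
    {c : ℝ → N} {v : V} (h : HasVelocity (V := V) c v) {f : N → N'} {e : N} (he : c 0 = e)
    (hf : MDifferentiableAt 𝓘(ℝ, V) 𝓘(ℝ, V') f e) :
    HasVelocity (V := V') (fun t => f (c t)) (mfderiv 𝓘(ℝ, V) 𝓘(ℝ, V') f e v : V') := by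
  subst he
  exact h.comp_mfderiv hf

variable {V : Type*} [NormedAddCommGroup V] [NormedSpace ℝ V]
  (G : Type*) [TopologicalSpace G] [ChartedSpace V G] [Group G]

/-- Multiplication in the preferred chart at the identity. -/
def chartMul (z : V × V) : V :=
  extChartAt 𝓘(ℝ, V) (1 : G) ((extChartAt 𝓘(ℝ, V) (1 : G)).symm z.1 *
    (extChartAt 𝓘(ℝ, V) (1 : G)).symm z.2)

/-- The second derivative of the multiplication in the preferred chart at the identity, in a
direction of the first factor and a direction of the second factor. -/
def chartMulSnd (a b : V) : V :=
  fderiv ℝ (fderiv ℝ (chartMul (V := V) G))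
    (extChartAt 𝓘(ℝ, V) (1 : G) 1, extChartAt 𝓘(ℝ, V) (1 : G) 1) (a, 0) (0, b)

theorem chartMulSnd_zero_right (a : V) : chartMulSnd G a 0 = 0 := by
  rw [chartMulSnd, Prod.mk_zero_zero, map_zero]

theorem chartMul_right : ∀ᶠ x in nhds (extChartAt 𝓘(ℝ, V) (1 : G) 1),
    chartMul G (x, extChartAt 𝓘(ℝ, V) (1 : G) 1) = x := by
  filter_upwards [(isOpen_extChartAt_target (I := 𝓘(ℝ, V)) (1 : G)).mem_nhds
    (mem_extChartAt_target _)] with x hx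
  simp only [chartMul, extChartAt_to_inv, mul_one]
  exact (extChartAt 𝓘(ℝ, V) (1 : G)).right_inv hx

theorem chartMul_left : ∀ᶠ x in nhds (extChartAt 𝓘(ℝ, V) (1 : G) 1),
    chartMul G (extChartAt 𝓘(ℝ, V) (1 : G) 1, x) = x := by
  filter_upwards [(isOpen_extChartAt_target (I := 𝓘(ℝ, V)) (1 : G)).mem_nhds
    (mem_extChartAt_target _)] with x hx
  simp only [chartMul, extChartAt_to_inv, one_mul]
  exact (extChartAt 𝓘(ℝ, V) (1 : G)).right_inv hx

variable [LieGroup 𝓘(ℝ, V) ∞ G]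

theorem contDiffAt_chartMul : ContDiffAt ℝ ∞ (chartMul (V := V) G)
    (extChartAt 𝓘(ℝ, V) (1 : G) 1, extChartAt 𝓘(ℝ, V) (1 : G) 1) := by
  have : IsManifold 𝓘(ℝ, V) ∞ G := LieGroup.toContMDiffMul.toIsManifold
  have h : ContMDiffAt 𝓘(ℝ, V) 𝓘(ℝ, V) ∞ (extChartAt 𝓘(ℝ, V) (1 : G)).symm
      (extChartAt 𝓘(ℝ, V) (1 : G) 1) :=
    (contMDiffOn_extChartAt_symm 1).contMDiffAt
      ((isOpen_extChartAt_target (I := 𝓘(ℝ, V)) (1 : G)).mem_nhds (mem_extChartAt_target _))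
  refine ContMDiffAt.contDiffAt_extChartAt (e := (1 : G)) (ContMDiffAt.mul
    (ContMDiffAt.comp _ h contDiff_fst.contMDiff.contMDiffAt)
    (ContMDiffAt.comp _ h contDiff_snd.contMDiff.contMDiffAt)) ?_
  simp

theorem eventually_hasFDerivAt_chartMul : ∀ᶠ z in nhds
    (extChartAt 𝓘(ℝ, V) (1 : G) 1, extChartAt 𝓘(ℝ, V) (1 : G) 1),
    HasFDerivAt (chartMul (V := V) G) (fderiv ℝ (chartMul G) z) z := by
  filter_upwards [((contDiffAt_chartMul (V := V) G).of_le (m := 1) (by simp)).eventually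
    (by simp)] with z hz
  exact (hz.differentiableAt (by simp)).hasFDerivAt

/-- The derivative of `x * 1 = x`, on a neighbourhood so that it can be differentiated once more. -/
theorem fderiv_chartMul_right : ∀ᶠ x in nhds (extChartAt 𝓘(ℝ, V) (1 : G) 1), ∀ a : V,
    fderiv ℝ (chartMul G) (x, extChartAt 𝓘(ℝ, V) (1 : G) 1) (a, 0) = a := by
  have ht : Filter.Tendsto (fun x : V => (x, extChartAt 𝓘(ℝ, V) (1 : G) 1))
      (nhds (extChartAt 𝓘(ℝ, V) (1 : G) 1)) (nhds (_, _)) := Continuous.tendsto (by fun_prop) _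
  filter_upwards [(chartMul_right (V := V) G).eventually_nhds,
    ht.eventually (eventually_hasFDerivAt_chartMul G)] with x hx hd a
  have h1 := HasFDerivAt.comp (f := fun x => (x, extChartAt 𝓘(ℝ, V) (1 : G) 1)) x hd
    (hasFDerivAt_prodMk_left (𝕜 := ℝ) x _)
  have h2 := h1.unique ((hasFDerivAt_id x).congr_of_eventuallyEq hx)
  simpa using DFunLike.congr_fun h2 a

theorem fderiv_chartMul_left : ∀ᶠ x in nhds (extChartAt 𝓘(ℝ, V) (1 : G) 1), ∀ a : V,
    fderiv ℝ (chartMul G) (extChartAt 𝓘(ℝ, V) (1 : G) 1, x) (0, a) = a := by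
  have ht : Filter.Tendsto (fun x : V => (extChartAt 𝓘(ℝ, V) (1 : G) 1, x))
      (nhds (extChartAt 𝓘(ℝ, V) (1 : G) 1)) (nhds (_, _)) := Continuous.tendsto (by fun_prop) _
  filter_upwards [(chartMul_left (V := V) G).eventually_nhds,
    ht.eventually (eventually_hasFDerivAt_chartMul G)] with x hx hd a
  have h1 := HasFDerivAt.comp (f := fun x => (extChartAt 𝓘(ℝ, V) (1 : G) 1, x)) x hd
    (hasFDerivAt_prodMk_right (𝕜 := ℝ) _ x)
  have h2 := h1.unique ((hasFDerivAt_id x).congr_of_eventuallyEq hx)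
  simpa using DFunLike.congr_fun h2 a

theorem hasFDerivAt_fderiv_chartMul : HasFDerivAt (fderiv ℝ (chartMul (V := V) G))
    (fderiv ℝ (fderiv ℝ (chartMul G))
      (extChartAt 𝓘(ℝ, V) (1 : G) 1, extChartAt 𝓘(ℝ, V) (1 : G) 1))
    (extChartAt 𝓘(ℝ, V) (1 : G) 1, extChartAt 𝓘(ℝ, V) (1 : G) 1) :=
  (((contDiffAt_chartMul (V := V) G).fderiv_right (m := ∞) (by simp)).differentiableAt
    (by simp)).hasFDerivAt

/-- Differentiating an expression that is constant near the identity. With the analogous statement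
for the other factor, only the cross block of the second derivative survives. -/
theorem sndFDeriv_chartMul_right (a a' : V) : fderiv ℝ (fderiv ℝ (chartMul G))
    (extChartAt 𝓘(ℝ, V) (1 : G) 1, extChartAt 𝓘(ℝ, V) (1 : G) 1) (a, 0) (a', 0) = 0 := by
  have h1 := (HasFDerivAt.comp (f := fun x => (x, extChartAt 𝓘(ℝ, V) (1 : G) 1)) _
    (hasFDerivAt_fderiv_chartMul (V := V) G) (hasFDerivAt_prodMk_left (𝕜 := ℝ) _ _)).clm_apply
    (hasFDerivAt_const ((a', 0) : V × V) _)
  have h2 := h1.unique ((hasFDerivAt_const a' _).congr_of_eventuallyEq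
    ((fderiv_chartMul_right (V := V) G).mono fun x hx => hx a'))
  simpa using DFunLike.congr_fun h2 a

theorem sndFDeriv_chartMul_left (a a' : V) : fderiv ℝ (fderiv ℝ (chartMul G))
    (extChartAt 𝓘(ℝ, V) (1 : G) 1, extChartAt 𝓘(ℝ, V) (1 : G) 1) (0, a) (0, a') = 0 := by
  have h1 := (HasFDerivAt.comp (f := fun x => (extChartAt 𝓘(ℝ, V) (1 : G) 1, x)) _
    (hasFDerivAt_fderiv_chartMul (V := V) G) (hasFDerivAt_prodMk_right (𝕜 := ℝ) _ _)).clm_apply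
    (hasFDerivAt_const ((0, a') : V × V) _)
  have h2 := h1.unique ((hasFDerivAt_const a' _).congr_of_eventuallyEq
    ((fderiv_chartMul_left (V := V) G).mono fun x hx => hx a'))
  simpa using DFunLike.congr_fun h2 a

variable {G}

/-- The product rule for mixed derivatives in a Lie group. -/
theorem mixedDeriv_mul {f g : ℝ × ℝ → G} (hf : ContMDiff 𝓘(ℝ, ℝ × ℝ) 𝓘(ℝ, V) ∞ f)
    (hg : ContMDiff 𝓘(ℝ, ℝ × ℝ) 𝓘(ℝ, V) ∞ g) (hf0 : f 0 = 1) (hg0 : g 0 = 1) {fs ft gs gt : V}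
    (hfs : HasDerivAt (fun s => extChartAt 𝓘(ℝ, V) (1 : G) (f (s, 0))) fs 0)
    (hft : HasDerivAt (fun t => extChartAt 𝓘(ℝ, V) (1 : G) (f (0, t))) ft 0)
    (hgs : HasDerivAt (fun s => extChartAt 𝓘(ℝ, V) (1 : G) (g (s, 0))) gs 0)
    (hgt : HasDerivAt (fun t => extChartAt 𝓘(ℝ, V) (1 : G) (g (0, t))) gt 0) :
    mixedDeriv (fun x => extChartAt 𝓘(ℝ, V) (1 : G) (f x * g x)) =
      mixedDeriv (fun x => extChartAt 𝓘(ℝ, V) (1 : G) (f x)) +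
        mixedDeriv (fun x => extChartAt 𝓘(ℝ, V) (1 : G) (g x)) +
        chartMulSnd G fs gt + chartMulSnd G ft gs := by
  have : IsManifold 𝓘(ℝ, V) ∞ G := LieGroup.toContMDiffMul.toIsManifold
  have hF := ContMDiffAt.contDiffAt_extChartAt (e := (1 : G)) (hf.contMDiffAt (x := 0))
    (by rw [hf0]; exact mem_extChartAt_source _)
  have hG := ContMDiffAt.contDiffAt_extChartAt (e := (1 : G)) (hg.contMDiffAt (x := 0))
    (by rw [hg0]; exact mem_extChartAt_source _)
  have h1 : (fun x => extChartAt 𝓘(ℝ, V) (1 : G) (f x * g x)) =ᶠ[nhds 0]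
      fun x => chartMul G (extChartAt 𝓘(ℝ, V) (1 : G) (f x), extChartAt 𝓘(ℝ, V) (1 : G) (g x)) := by
    have hf' := hf.continuous.continuousAt.preimage_mem_nhds (x := 0)
      (t := (extChartAt 𝓘(ℝ, V) (1 : G)).source)
      (by rw [hf0]; exact extChartAt_source_mem_nhds _)
    have hg' := hg.continuous.continuousAt.preimage_mem_nhds (x := 0)
      (t := (extChartAt 𝓘(ℝ, V) (1 : G)).source)
      (by rw [hg0]; exact extChartAt_source_mem_nhds _)
    filter_upwards [hf', hg'] with x hx hx'
    simp only [chartMul]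
    rw [(extChartAt 𝓘(ℝ, V) (1 : G)).left_inv hx, (extChartAt 𝓘(ℝ, V) (1 : G)).left_inv hx']
  rw [h1.mixedDeriv_eq, mixedDeriv_comp (φ := chartMul G) (hF.prodMk hG) (contDiffAt_chartMul G)
    (by rw [hf0, hg0]) (hfs.prodMk hgs) (hft.prodMk hgt), mixedDeriv_prodMk hF hG]
  have e : ∀ a b : V, (a, b) = (a, 0) + (0, b) := fun a b => by simp
  have hs := ((contDiffAt_chartMul (V := V) G).isSymmSndFDerivAt
    (by simpa using WithTop.coe_le_coe.2 (le_top (a := (2 : ℕ∞))))).eq (0, gs) (ft, 0)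
  rw [e fs gs, e ft gt, e (mixedDeriv _)]
  simp only [map_add, add_apply]
  rw [sndFDeriv_chartMul_left, sndFDeriv_chartMul_right, hs,
    (fderiv_chartMul_left (V := V) G).self_of_nhds, (fderiv_chartMul_right (V := V) G).self_of_nhds]
  simp only [chartMulSnd]
  abel

/-- Invariant vector fields in the preferred chart at the identity. -/
theorem mpullback_mulInvariantVectorField_chart (v : V) :
    ∀ᶠ x in nhds (extChartAt 𝓘(ℝ, V) (1 : G) 1),
      VectorField.mpullbackWithin 𝓘(ℝ, V) 𝓘(ℝ, V) (extChartAt 𝓘(ℝ, V) (1 : G)).symm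
        (mulInvariantVectorField (I := 𝓘(ℝ, V)) (G := G) v) (Set.range 𝓘(ℝ, V)) x =
      fderiv ℝ (chartMul G) (x, extChartAt 𝓘(ℝ, V) (1 : G) 1) (0, v) := by
  have : IsManifold 𝓘(ℝ, V) ∞ G := LieGroup.toContMDiffMul.toIsManifold
  have : IsManifold 𝓘(ℝ, V) 1 G := IsManifold.of_le (n := ∞) (by simp)
  have ht : Filter.Tendsto (fun x : V => (x, extChartAt 𝓘(ℝ, V) (1 : G) 1))
      (nhds (extChartAt 𝓘(ℝ, V) (1 : G) 1)) (nhds (_, _)) := Continuous.tendsto (by fun_prop) _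
  filter_upwards [(isOpen_extChartAt_target (I := 𝓘(ℝ, V)) (1 : G)).mem_nhds
    (mem_extChartAt_target _), ht.eventually (eventually_hasFDerivAt_chartMul G)] with x hx hd
  set g := (extChartAt 𝓘(ℝ, V) (1 : G)).symm x with hg
  have hgs : g ∈ (extChartAt 𝓘(ℝ, V) (1 : G)).source :=
    (extChartAt 𝓘(ℝ, V) (1 : G)).map_target hx
  have h1 : (mfderivWithin 𝓘(ℝ, V) 𝓘(ℝ, V) (extChartAt 𝓘(ℝ, V) (1 : G)).symm
      (Set.range 𝓘(ℝ, V)) x).inverse = mfderiv 𝓘(ℝ, V) 𝓘(ℝ, V) (extChartAt 𝓘(ℝ, V) (1 : G)) g :=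
    ContinuousLinearMap.inverse_eq (mfderivWithin_extChartAt_symm_comp_mfderiv_extChartAt hx)
      (mfderiv_extChartAt_comp_mfderivWithin_extChartAt_symm hx)
  rw [VectorField.mpullbackWithin_apply, h1]
  have hl : HasDerivAt (fun t : ℝ => extChartAt 𝓘(ℝ, V) (1 : G) 1 + t • v) v 0 := by
    have := ((hasDerivAt_id (0 : ℝ)).smul_const v).const_add (extChartAt 𝓘(ℝ, V) (1 : G) 1)
    rwa [one_smul] at this
  -- Let `c` be this curve, which passes through `1` with velocity `v`. Both sides of the claim are
  -- the derivative at `0` of `g * c t` read in the chart.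
  have hv : HasVelocity (V := V) (fun t : ℝ => (extChartAt 𝓘(ℝ, V) (1 : G)).symm
      (extChartAt 𝓘(ℝ, V) (1 : G) 1 + t • v)) v :=
    hasVelocity_extChartAt_symm Filter.EventuallyEq.rfl hl (by simp)
  have h2 := hv.comp_mfderiv_of_eq (e := (1 : G)) (by simp)
    ((contMDiff_mul_left (I := 𝓘(ℝ, V)) (n := ∞) (a := g)).mdifferentiableAt (by simp))
  have h3 := h2.comp_mfderiv_of_eq (e := g * 1) (by simp)
    (mdifferentiableAt_extChartAt (by rw [mul_one]; simpa using hgs))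
  have h4 : HasDerivAt (fun t : ℝ => chartMul G (x, extChartAt 𝓘(ℝ, V) (1 : G) 1 + t • v))
      (fderiv ℝ (chartMul G) (x, extChartAt 𝓘(ℝ, V) (1 : G) 1) (0, v)) 0 := by
    have h6 : HasFDerivAt (chartMul G) (fderiv ℝ (chartMul G) (x, extChartAt 𝓘(ℝ, V) (1 : G) 1))
        (x, extChartAt 𝓘(ℝ, V) (1 : G) 1 + (0 : ℝ) • v) := by
      rw [zero_smul, add_zero]
      exact hd
    exact h6.comp_hasDerivAt (0 : ℝ) ((hasDerivAt_const (0 : ℝ) x).prodMk hl)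
  -- Passes from the tangent space at `g * 1` to the one at `g`.
  have h7 : ∀ g' : G, g' = g → ∀ w : V,
      (mfderiv 𝓘(ℝ, V) 𝓘(ℝ, V) (extChartAt 𝓘(ℝ, V) (1 : G)) g' w : V) =
        mfderiv 𝓘(ℝ, V) 𝓘(ℝ, V) (extChartAt 𝓘(ℝ, V) (1 : G)) g w := by
    rintro _ rfl w
    rfl
  exact (h7 (g * 1) (mul_one g) _).symm.trans
    (h3.unique ((hasVelocity_iff rfl _).2 ⟨h4.continuousAt, h4⟩))

/-- The Lie bracket is the antisymmetric part of the second derivative of the multiplication. -/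
theorem bracket_eq_chartMulSnd (a b : GroupLieAlgebra 𝓘(ℝ, V) G) :
    (⁅a, b⁆ : GroupLieAlgebra 𝓘(ℝ, V) G) =
      (chartMulSnd (V := V) G a b - chartMulSnd (V := V) G b a : V) := by
  have : IsManifold 𝓘(ℝ, V) ∞ G := LieGroup.toContMDiffMul.toIsManifold
  have : IsManifold 𝓘(ℝ, V) 1 G := IsManifold.of_le (n := ∞) (by simp)
  -- The derivative at the identity, in direction `w`, of the invariant field of `v`.
  have hd : ∀ v w : V, fderiv ℝ (fun x => fderiv ℝ (chartMul G)
      (x, extChartAt 𝓘(ℝ, V) (1 : G) 1) (0, v)) (extChartAt 𝓘(ℝ, V) (1 : G) 1) w =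
        chartMulSnd G w v := by
    intro v w
    have h1 := (HasFDerivAt.comp (f := fun x => (x, extChartAt 𝓘(ℝ, V) (1 : G) 1)) _
      (hasFDerivAt_fderiv_chartMul (V := V) G) (hasFDerivAt_prodMk_left (𝕜 := ℝ) _ _)).clm_apply
      (hasFDerivAt_const ((0, v) : V × V) _)
    refine (DFunLike.congr_fun h1.fderiv w).trans ?_
    simp [chartMulSnd]
  have h1 : VectorField.mlieBracketWithin 𝓘(ℝ, V) (mulInvariantVectorField (G := G) a)
      (mulInvariantVectorField (G := G) b) Set.univ (1 : G) = _ :=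
    VectorField.mlieBracketWithin_apply
  -- The preferred chart has identity derivative at its base point, so transporting the bracket back
  -- from the chart changes nothing.
  have h2 : ∀ L : V →L[ℝ] V, L = ContinuousLinearMap.id ℝ V → ∀ w : V, L.inverse w = w := by
    rintro _ rfl w
    rw [ContinuousLinearMap.inverse_id]
    rfl
  refine h1.trans ((h2 _ mfderiv_extChartAt_self _).trans ?_)
  refine (Filter.EventuallyEq.lieBracketWithin_vectorField_eq_nhds
    (mpullback_mulInvariantVectorField_chart (V := V) a)
    (mpullback_mulInvariantVectorField_chart (V := V) b)).trans ?_
  simp only [Set.preimage_univ, Set.univ_inter, modelWithCornersSelf_coe, Set.range_id,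
    VectorField.lieBracketWithin_univ]
  have h3 := (fderiv_chartMul_left (V := V) G).self_of_nhds
  exact congrArg₂ (· - ·) ((congrArg _ (h3 a)).trans (hd b a)) ((congrArg _ (h3 b)).trans (hd a b))

end GroupChart

end

noncomputable section

/-! ### Fake-flatness -/

section FakeFlatness

variable {EG : Type*} [NormedAddCommGroup EG] [NormedSpace ℝ EG]
  {EH : Type*} [NormedAddCommGroup EH] [NormedSpace ℝ EH]
  {G : Type*} [TopologicalSpace G] [ChartedSpace EG G] [Group G] [LieGroup 𝓘(ℝ, EG) ∞ G]
  {H : Type*} [TopologicalSpace H] [ChartedSpace EH H] [Group H] [LieGroup 𝓘(ℝ, EH) ∞ H]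
  {C : SmoothCrossedModule EG EH G H}
  {E : Type*} [NormedAddCommGroup E] [NormedSpace ℝ E]
  {M : Type*} [TopologicalSpace M] [ChartedSpace E M]
  {F : TransportTwoFunctor C E M}

namespace TransportTwoFunctor.Bundle

variable (P : F.Bundle)

theorem map₀_curvePath (c : ℝ → P.Space) (hc : ContMDiff 𝓘(ℝ, ℝ) 𝓘(ℝ, E × EG) ∞ c) (t : ℝ) :
    (F.map (curvePath (fun r => P.proj (c r)) (P.contMDiff_proj.comp hc) t)).map₀
      ((F.obj (P.proj (c 0))).act₀ (P.pt (c 0)) (P.curveHolonomy c hc t)) = P.pt (c t) := by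
  rw [curveHolonomy, TwoTorsor.act₀_div, F.map₀_map₀_reverse]

/-- Surface holonomy compares the holonomies along the two boundary paths. -/
theorem curveHolonomy_mul_surfaceHolonomy {S : ℝ × ℝ → P.Space}
    (hS : ContMDiff 𝓘(ℝ, ℝ × ℝ) 𝓘(ℝ, E × EG) ∞ S)
    (h₁ : ∀ t, ContMDiff 𝓘(ℝ, ℝ) 𝓘(ℝ, E × EG) ∞ fun r => S (r, t))
    (h₂ : ∀ s, ContMDiff 𝓘(ℝ, ℝ) 𝓘(ℝ, E × EG) ∞ fun r => S (s, r)) (s t : ℝ) :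
    P.curveHolonomy (fun r => S (0, r)) (h₂ 0) t * P.curveHolonomy (fun r => S (r, t)) (h₁ t) s *
      C.t (P.surfaceHolonomy S hS s t) =
    P.curveHolonomy (fun r => S (r, 0)) (h₁ 0) s *
      P.curveHolonomy (fun r => S (s, r)) (h₂ s) t := by
  have hp := P.contMDiff_proj
  -- Verified by transporting forward: each of the two legs absorbs its own holonomy factor.
  have hw : (F.map (westNorthPath (fun z => P.proj (S z)) (hp.comp hS) s t).reverse).map₀
      (P.pt (S (s, t))) = (F.obj (P.proj (S (0, 0)))).act₀ (P.pt (S (0, 0)))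
        (P.curveHolonomy (fun r => S (0, r)) (h₂ 0) t *
          P.curveHolonomy (fun r => S (r, t)) (h₁ t) s) := by
    rw [← F.map₀_reverse_map₀ (westNorthPath (fun z => P.proj (S z)) (hp.comp hS) s t)
      ((F.obj _).act₀ _ _)]
    rw [westNorthPath_eq (fun z => P.proj (S z)) (hp.comp hS) s t (hp.comp (h₂ 0))
      (hp.comp (h₁ t)), F.map₀_trans, TwoTorsor.act₀_mul, (F.map _).map₀_act,
      P.map₀_curvePath (fun r => S (0, r)) (h₂ 0) t, P.map₀_curvePath (fun r => S (r, t)) (h₁ t) s]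
  have he : (F.map (southEastPath (fun z => P.proj (S z)) (hp.comp hS) s t).reverse).map₀
      (P.pt (S (s, t))) = (F.obj (P.proj (S (0, 0)))).act₀ (P.pt (S (0, 0)))
        (P.curveHolonomy (fun r => S (r, 0)) (h₁ 0) s *
          P.curveHolonomy (fun r => S (s, r)) (h₂ s) t) := by
    rw [← F.map₀_reverse_map₀ (southEastPath (fun z => P.proj (S z)) (hp.comp hS) s t)
      ((F.obj _).act₀ _ _)]
    rw [southEastPath_eq (fun z => P.proj (S z)) (hp.comp hS) s t (hp.comp (h₁ 0))
      (hp.comp (h₂ s)), F.map₀_trans, TwoTorsor.act₀_mul, (F.map _).map₀_act,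
      P.map₀_curvePath (fun r => S (r, 0)) (h₁ 0) s, P.map₀_curvePath (fun r => S (s, r)) (h₂ s) t]
  -- The inverted bigon goes from the reversed west-north path to the reversed south-east path, so
  -- `t` of its value relates the two products.
  have h := F.map₀_target (canonicalBigon (fun z => P.proj (S z)) (hp.comp hS) s t).hinv
    (P.pt (S (s, t)))
  rw [he, hw, ← TwoTorsor.act₀_mul] at h
  exact (TwoTorsor.act₀_injective _ _ h).symm

theorem hasDerivAt_curveHolonomy (c : ℝ → P.Space) (hc : ContMDiff 𝓘(ℝ, ℝ) 𝓘(ℝ, E × EG) ∞ c) :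
    HasDerivAt (fun t => extChartAt 𝓘(ℝ, EG) (1 : G) (P.curveHolonomy c hc t))
      (P.holonomyRate c hc) 0 :=
  ((hasVelocity_iff (P.curveHolonomy_zero c hc) _).1 (P.hasVelocity_curveHolonomy c hc)).2

variable {P}

/-- The rate along the `Y`-line through `z₀ + s X` is the `Y`-component of `A` there; its
`s`-derivative is one of the two terms of `dA`. -/
theorem IsTransportConnection.hasDerivAt_holonomyRate [FiniteDimensional ℝ E]
    [FiniteDimensional ℝ EG] {A : P.OneForm} (hA : P.IsTransportConnection A) {p : P.Space}
    {Ψ : E × EG → P.Space}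
    (hΨ : Ψ =ᶠ[nhds (extChartAt 𝓘(ℝ, E × EG) p p)] (extChartAt 𝓘(ℝ, E × EG) p).symm)
    (X Y : E × EG) (h : ∀ s : ℝ, ContMDiff 𝓘(ℝ, ℝ) 𝓘(ℝ, E × EG) ∞
      fun r : ℝ => Ψ (extChartAt 𝓘(ℝ, E × EG) p p + s • X + r • Y)) :
    HasDerivAt (fun s => P.holonomyRate _ (h s))
      (fderiv ℝ (fun z => A ((extChartAt 𝓘(ℝ, E × EG) p).symm z) (chartVector p z Y))
        (extChartAt 𝓘(ℝ, E × EG) p p) X) 0 := by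
  set z₀ := extChartAt 𝓘(ℝ, E × EG) p p with hz₀
  have hto : z₀ ∈ (extChartAt 𝓘(ℝ, E × EG) p).target := mem_extChartAt_target p
  have hopen := (isOpen_extChartAt_target (I := 𝓘(ℝ, E × EG)) p).mem_nhds hto
  have hl : HasDerivAt (fun s : ℝ => z₀ + s • X) X 0 := by
    have := ((hasDerivAt_id (0 : ℝ)).smul_const X).const_add z₀
    rwa [one_smul] at this
  have ht : Filter.Tendsto (fun s : ℝ => z₀ + s • X) (nhds 0) (nhds z₀) := by
    simpa using hl.continuousAt.tendsto
  have hd : HasFDerivAt (fun z => A ((extChartAt 𝓘(ℝ, E × EG) p).symm z) (chartVector p z Y))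
      (fderiv ℝ (fun z => A ((extChartAt 𝓘(ℝ, E × EG) p).symm z) (chartVector p z Y)) z₀)
      (z₀ + (0 : ℝ) • X) := by
    rw [zero_smul, add_zero]
    exact (((hA.smoothOneForm p Y).contDiffAt hopen).differentiableAt (by simp)).hasFDerivAt
  refine (hd.comp_hasDerivAt (0 : ℝ) hl).congr_of_eventuallyEq ?_
  filter_upwards [ht.eventually hΨ.eventually_nhds, ht.eventually hopen] with s hs hs'
  exact hA.holonomyRate_eq (h s) (by simpa using hs.self_of_nhds)
    (hasVelocity_chartVector hs' hs Y)

/-- The transport 2-form is fake-flat: `t_* B` is the curvature of the connection. -/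
theorem IsTransportTwoForm.tStar_eq_curvature [FiniteDimensional ℝ E] [FiniteDimensional ℝ EG]
    {A : P.OneForm} {B : P.TwoForm} (hA : P.IsTransportConnection A) (hB : P.IsTransportTwoForm B)
    (p : P.Space) (X Y : TangentSpace 𝓘(ℝ, E × EG) p) :
    C.tStar (B p ![X, Y]) = P.curvature A p X Y := by
  have : IsManifold 𝓘(ℝ, EG) ∞ G := LieGroup.toContMDiffMul.toIsManifold
  have : IsManifold 𝓘(ℝ, EH) ∞ H := LieGroup.toContMDiffMul.toIsManifold
  have : IsManifold 𝓘(ℝ, E × EG) 1 P.Space := IsManifold.of_le (n := ∞) (by simp)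
  obtain ⟨Ψ, hΨs, hΨ⟩ := exists_contMDiff_eq_extChartAt_symm p
    (mem_extChartAt_target (I := 𝓘(ℝ, E × EG)) p)
  let z₀ : E × EG := extChartAt 𝓘(ℝ, E × EG) p p
  let X' : E × EG := X
  let Y' : E × EG := Y
  let S : ℝ × ℝ → P.Space := fun x => Ψ (z₀ + x.1 • X' + x.2 • Y')
  have hS : ContMDiff 𝓘(ℝ, ℝ × ℝ) 𝓘(ℝ, E × EG) ∞ S :=
    hΨs.comp (ContDiff.contMDiff (by fun_prop))
  have h₁ : ∀ t, ContMDiff 𝓘(ℝ, ℝ) 𝓘(ℝ, E × EG) ∞ fun r => S (r, t) := fun t =>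
    hS.comp (ContDiff.contMDiff (by fun_prop))
  have h₂ : ∀ s, ContMDiff 𝓘(ℝ, ℝ) 𝓘(ℝ, E × EG) ∞ fun r => S (s, r) := fun s =>
    hS.comp (ContDiff.contMDiff (by fun_prop))
  have hS0 : S (0, 0) = p := by
    simp only [S, zero_smul, add_zero]
    exact hΨ.eq_of_nhds.trans (extChartAt_to_inv p)
  have hl : ∀ X : E × EG, HasDerivAt (fun t : ℝ => z₀ + t • X) X 0 := fun X => by
    have := ((hasDerivAt_id (0 : ℝ)).smul_const X).const_add z₀
    rwa [one_smul] at this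
  have hX : HasVelocity (V := E × EG) (fun s => S (s, 0)) X' := by
    refine hasVelocity_extChartAt_symm hΨ (c := fun s : ℝ => z₀ + s • X' + (0 : ℝ) • Y') ?_
      (by simp [z₀])
    simpa only [zero_smul, add_zero] using hl X'
  have hY : HasVelocity (V := E × EG) (fun t => S (0, t)) Y' := by
    refine hasVelocity_extChartAt_symm hΨ (c := fun t : ℝ => z₀ + (0 : ℝ) • X' + t • Y') ?_
      (by simp [z₀])
    simpa only [zero_smul, add_zero] using hl Y'
  let κ := extChartAt 𝓘(ℝ, EG) (1 : G)
  -- At `(s, t)`: `n` is the holonomy from `(0, t)` to `(s, t)`, `e` the one from `(s, 0)` to `(s,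
  -- t)`, and `u` is `t` of the surface holonomy.
  let n : ℝ × ℝ → G := fun x => P.curveHolonomy (fun r => S (r, x.2)) (h₁ x.2) x.1
  let e : ℝ × ℝ → G := fun x => P.curveHolonomy (fun r => S (x.1, r)) (h₂ x.1) x.2
  let u : ℝ × ℝ → G := fun x => C.t (P.surfaceHolonomy S hS x.1 x.2)
  have he : ContMDiff 𝓘(ℝ, ℝ × ℝ) 𝓘(ℝ, EG) ∞ e := P.contMDiff_curveHolonomy (Z := ℝ) hS h₂
  have hn : ContMDiff 𝓘(ℝ, ℝ × ℝ) 𝓘(ℝ, EG) ∞ n :=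
    (P.contMDiff_curveHolonomy (Z := ℝ) (c := fun x => S (x.2, x.1))
      (hS.comp (contDiff_snd.prodMk contDiff_fst).contMDiff) h₁).comp
      (contDiff_snd.prodMk contDiff_fst).contMDiff
  have hu : ContMDiff 𝓘(ℝ, ℝ × ℝ) 𝓘(ℝ, EG) ∞ u :=
    C.t_smooth.comp (P.contMDiff_surfaceHolonomy_surface S hS)
  have he0 : ∀ s, e (s, 0) = 1 := fun s => P.curveHolonomy_zero _ _
  have hn0 : ∀ t, n (0, t) = 1 := fun t => P.curveHolonomy_zero _ _
  have hu0 : ∀ s, u (s, 0) = 1 := fun s => by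
    simp only [u, surfaceHolonomy_zero_right, map_one]
  have hu0' : ∀ t, u (0, t) = 1 := fun t => by
    simp only [u, surfaceHolonomy_zero_left, map_one]
  let a : EG := A p X'
  let b : EG := A p Y'
  have hc : ∀ g : G, HasDerivAt (fun _ : ℝ => κ g) 0 0 := fun g => hasDerivAt_const _ _
  have hes : HasDerivAt (fun s => κ (e (s, 0))) 0 0 := by simpa only [he0] using hc 1
  have het : HasDerivAt (fun t => κ (e (0, t))) b 0 := by
    have := P.hasDerivAt_curveHolonomy (fun r => S (0, r)) (h₂ 0)
    rwa [hA.holonomyRate_eq (h₂ 0) hS0 hY] at this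
  have hns : HasDerivAt (fun s => κ (n (s, 0))) a 0 := by
    have := P.hasDerivAt_curveHolonomy (fun r => S (r, 0)) (h₁ 0)
    rwa [hA.holonomyRate_eq (h₁ 0) hS0 hX] at this
  have hnt : HasDerivAt (fun t => κ (n (0, t))) 0 0 := by simpa only [hn0] using hc 1
  have hus : HasDerivAt (fun s => κ (u (s, 0))) 0 0 := by simpa only [hu0] using hc 1
  have hut : HasDerivAt (fun t => κ (u (0, t))) 0 0 := by simpa only [hu0'] using hc 1
  have hew : ContMDiff 𝓘(ℝ, ℝ × ℝ) 𝓘(ℝ, EG) ∞ fun x : ℝ × ℝ => e (0, x.2) :=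
    he.comp (contDiff_const.prodMk contDiff_snd).contMDiff
  have hns' : ContMDiff 𝓘(ℝ, ℝ × ℝ) 𝓘(ℝ, EG) ∞ fun x : ℝ × ℝ => n (x.1, 0) :=
    hn.comp (contDiff_fst.prodMk contDiff_const).contMDiff
  have hid : ∀ x : ℝ × ℝ, e (0, x.2) * n x * u x = n (x.1, 0) * e x := fun x =>
    P.curveHolonomy_mul_surfaceHolonomy hS h₁ h₂ x.1 x.2
  -- The product rule on both sides of `hid`. The surviving cross terms are `chartMulSnd b a` from
  -- `m₁` and `chartMulSnd a b` from `m₃`; there is none in `m₂`, as both first derivatives of `u`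
  -- vanish.
  have m₁ := mixedDeriv_mul hew hn (he0 0) (hn0 0) (hc (e (0, 0))) het hns hnt
  have m₂ := mixedDeriv_mul (f := fun x => e (0, x.2) * n x) (fs := a) (ft := b) (hew.mul hn) hu
    (by simp only [Prod.snd_zero, he0, one_mul]; exact hn0 0) (hu0 0)
    (by simpa only [he0, one_mul] using hns) (by simpa only [hn0, mul_one] using het) hus hut
  have m₃ := mixedDeriv_mul hns' he (hn0 0) (he0 0) hns (hc (n (0, 0))) hes het
  have z₁ : mixedDeriv (fun x : ℝ × ℝ => extChartAt 𝓘(ℝ, EG) (1 : G) (e (0, x.2))) = 0 := by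
    simp [mixedDeriv]
  have z₂ : mixedDeriv (fun x : ℝ × ℝ => extChartAt 𝓘(ℝ, EG) (1 : G) (n (x.1, 0))) = 0 := by
    simp [mixedDeriv]
  have de : mixedDeriv (fun x => extChartAt 𝓘(ℝ, EG) (1 : G) (e x)) =
      fderiv ℝ (fun z => A ((extChartAt 𝓘(ℝ, E × EG) p).symm z) (chartVector p z Y')) z₀ X' :=
    (hA.hasDerivAt_holonomyRate hΨ X' Y' h₂).deriv
  have h₁' : ∀ t : ℝ, ContMDiff 𝓘(ℝ, ℝ) 𝓘(ℝ, E × EG) ∞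
      fun r : ℝ => Ψ (z₀ + t • Y' + r • X') := fun t =>
    hΨs.comp (ContDiff.contMDiff (by fun_prop))
  have dn : mixedDeriv (fun x => extChartAt 𝓘(ℝ, EG) (1 : G) (n x)) =
      fderiv ℝ (fun z => A ((extChartAt 𝓘(ℝ, E × EG) p).symm z) (chartVector p z X')) z₀ Y' := by
    -- For `n` the rate is the derivative in `s`, whereas `mixedDeriv` differentiates in `t` first.
    rw [← (hA.hasDerivAt_holonomyRate hΨ Y' X' h₁').deriv, ← mixedDeriv_swap
      (ContMDiffAt.contDiffAt_extChartAt (e := (1 : G)) (hn.contMDiffAt (x := 0))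
        (by rw [show n 0 = 1 from hn0 0]; exact mem_extChartAt_source _))]
    refine congrArg (fun f : ℝ → EG => deriv f 0) (funext fun t => ?_)
    have : (fun r => S (r, t)) = fun r : ℝ => Ψ (z₀ + t • Y' + r • X') := by
      funext r
      simp only [S, add_right_comm]
    simp only [n, holonomyRate, this]
    rfl
  have dt : mixedDeriv (fun x => extChartAt 𝓘(ℝ, EG) (1 : G) (u x)) = C.tStar (B p ![X, Y]) := by
    have h1 := (P.hasMixedDeriv_surfaceHolonomy S hS).comp_mfderiv (f := C.t)
      (C.t_smooth.mdifferentiableAt (by simp))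
    have h2 := ContMDiff.hasMixedDeriv (u := fun s t => u (s, t)) (e := C.t 1) hu
      (fun s => (hu0 s).trans (map_one C.t).symm)
    have h3 := h2.unique h1
    rw [hB.surfaceRate_eq hS hS0 hX hY] at h3
    refine Eq.trans ?_ h3
    rw [map_one C.t]
  have hX' : (mfderiv 𝓘(ℝ, E × EG) 𝓘(ℝ, E × EG) (extChartAt 𝓘(ℝ, E × EG) p) p X : E × EG) = X' := by
    rw [mfderiv_extChartAt_self]
    rfl
  have hY' : (mfderiv 𝓘(ℝ, E × EG) 𝓘(ℝ, E × EG) (extChartAt 𝓘(ℝ, E × EG) p) p Y : E × EG) = Y' := by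
    rw [mfderiv_extChartAt_self]
    rfl
  have hdA : extDerivOneForm A p X Y =
      fderiv ℝ (fun z => A ((extChartAt 𝓘(ℝ, E × EG) p).symm z) (chartVector p z Y')) z₀ X' -
      fderiv ℝ (fun z => A ((extChartAt 𝓘(ℝ, E × EG) p).symm z) (chartVector p z X')) z₀ Y' := by
    simp only [extDerivOneForm, hX', hY']
    rfl
  have hbr : P.curvature A p X Y =
      extDerivOneForm A p X Y + (chartMulSnd G a b - chartMulSnd G b a) :=
    congrArg (extDerivOneForm A p X Y + ·) (bracket_eq_chartMulSnd (G := G) (V := EG) a b)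
  refine dt.symm.trans (Eq.trans ?_ hbr.symm)
  rw [hdA, ← de, ← dn]
  simp only [hid, chartMulSnd_zero_right, add_zero, zero_add, z₁, z₂] at m₁ m₂ m₃
  rw [m₃, m₁] at m₂
  rw [← sub_eq_iff_eq_add'.2 m₂]
  abel

end TransportTwoFunctor.Bundle

end FakeFlatness

end

noncomputable section

/-! ### Local sections by transport along rays -/

section LocalSections

variable {EG : Type*} [NormedAddCommGroup EG] [NormedSpace ℝ EG]
  {EH : Type*} [NormedAddCommGroup EH] [NormedSpace ℝ EH]
  {G : Type*} [TopologicalSpace G] [ChartedSpace EG G] [Group G] [LieGroup 𝓘(ℝ, EG) ∞ G]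
  {H : Type*} [TopologicalSpace H] [ChartedSpace EH H] [Group H] [LieGroup 𝓘(ℝ, EH) ∞ H]
  {C : SmoothCrossedModule EG EH G H}
  {E : Type*} [NormedAddCommGroup E] [NormedSpace ℝ E]
  {M : Type*} [TopologicalSpace M] [ChartedSpace E M]
  {Z : Type*} [NormedAddCommGroup Z] [NormedSpace ℝ Z] [FiniteDimensional ℝ Z]

namespace TransportTwoFunctor

variable (F : TransportTwoFunctor C E M)

theorem div_act₀_left {x : M} (q p : (F.obj x).X₀) (g : G) :
    (F.obj x).div ((F.obj x).act₀ q g) p = (F.obj x).div q p * g := by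
  refine TwoTorsor.div_eq _ ?_
  rw [TwoTorsor.act₀_mul, TwoTorsor.act₀_div]

/-- Transports along two families of paths with the same end points differ smoothly. -/
theorem contMDiff_div_transport {x x' : M} (p : (F.obj x).X₀) (p' : (F.obj x').X₀) {y : Z → M}
    {γ : ∀ a, SmoothPath E x (y a)} {δ : ∀ a, SmoothPath E x' (y a)}
    (hγ : SmoothPathFamily Set.univ γ) (hδ : SmoothPathFamily Set.univ δ) {b : ℝ} (hb : b < 1)
    (hs : ∀ a, ∀ v ≥ b, (δ a).toFun v = y a) :
    ContMDiff 𝓘(ℝ, Z) 𝓘(ℝ, EG) ∞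
      (fun a => (F.obj (y a)).div ((F.map (γ a)).map₀ p) ((F.map (δ a)).map₀ p')) := by
  -- A fixed path that closes `γ a` followed by the reverse of `δ a` to a loop at `x`; it
  -- contributes only a constant factor.
  obtain ⟨η⟩ : Nonempty (SmoothPath E x' x) := ⟨(δ 0).trans (γ 0).reverse⟩
  obtain ⟨ε, hε, hη, -⟩ := η.sitting
  have hL : SmoothPathFamily Set.univ fun a => ((γ a).trans (δ a).reverse).trans η :=
    (hγ.trans_right hδ.reverse (b := 1 - b) (by linarith)
      fun a _ v hv => hs a _ (by linarith)).trans_right (SmoothPathFamily.const_path η _) hε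
      fun a _ v hv => hη v hv
  have h1 := contMDiffOn_univ.1 (F.contMDiffOn_loops p isOpen_univ hL)
  have h2 := (contMDiff_const (I := 𝓘(ℝ, Z)) (n := ∞)
    (c := ((F.obj x).div ((F.map η).map₀ p') p)⁻¹)).mul h1
  convert! h2 using 1
  funext a
  rw [Pi.mul_apply]
  have h3 : (F.obj x').act₀ p' ((F.obj (y a)).div ((F.map (γ a)).map₀ p)
      ((F.map (δ a)).map₀ p')) = (F.map (δ a).reverse).map₀ ((F.map (γ a)).map₀ p) := by
    rw [← F.map₀_reverse_map₀ (δ a) ((F.obj x').act₀ p' _), (F.map (δ a)).map₀_act,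
      TwoTorsor.act₀_div]
  rw [eq_inv_mul_iff_mul_eq, ← F.div_act₀_left, ← (F.map η).map₀_act, h3, F.map₀_trans,
    F.map₀_trans]

/-- Local sections given by transport along the rays of a chart. -/
structure LocalSection where
  dom : Set M
  sec : ∀ y : M, (F.obj y).X₀
  param : E → M
  contMDiff_param : ContMDiff 𝓘(ℝ, E) 𝓘(ℝ, E) ∞ param
  base : (F.obj (param 0)).X₀
  coord : M → E
  isOpen_dom : IsOpen dom
  contMDiffOn_coord : ContMDiffOn 𝓘(ℝ, E) 𝓘(ℝ, E) ∞ coord dom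
  -- An equality in the total space, since the two fibres are over points not definitionally equal;
  -- it also contains `param (coord y) = y`.
  point_sec : ∀ y ∈ dom, F.point y (sec y) = F.point (param (coord y))
    ((F.map (linePath param contMDiff_param (coord y))).map₀ base)

theorem exists_localSection [FiniteDimensional ℝ E] [IsManifold 𝓘(ℝ, E) ∞ M] (x : M) :
    ∃ s : F.LocalSection, x ∈ s.dom := by
  obtain ⟨Ψ, hΨs, hΨ⟩ := exists_contMDiff_eq_extChartAt_symm x
    (mem_extChartAt_target (I := 𝓘(ℝ, E)) x)
  obtain ⟨O, hO, hOo, hOp⟩ := mem_nhds_iff.1 hΨ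
  let k : M → E := fun y => extChartAt 𝓘(ℝ, E) x y - extChartAt 𝓘(ℝ, E) x x
  let f : E → M := fun z => Ψ (extChartAt 𝓘(ℝ, E) x x + z)
  have hf : ContMDiff 𝓘(ℝ, E) 𝓘(ℝ, E) ∞ f :=
    hΨs.comp (contDiff_const.add contDiff_id).contMDiff
  let U : Set M := (extChartAt 𝓘(ℝ, E) x).source ∩ extChartAt 𝓘(ℝ, E) x ⁻¹' O
  have hfk : ∀ y ∈ U, f (k y) = y := by
    intro y hy
    simp only [f, k, add_sub_cancel]
    rw [hO hy.2, (extChartAt 𝓘(ℝ, E) x).left_inv hy.1]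
  obtain ⟨p₀⟩ := (F.obj (f 0)).nonempty
  -- Outside `U` the section takes arbitrary values.
  have hex : ∀ y, ∃ s : (F.obj y).X₀, y ∈ U → F.point y s = F.point (f (k y))
      ((F.map (linePath f hf (k y))).map₀ p₀) := by
    intro y
    by_cases hy : y ∈ U
    · have : ∀ y', y' = y → ∀ q : (F.obj y').X₀, ∃ s : (F.obj y).X₀, F.point y s = F.point y' q := by
        rintro _ rfl q
        exact ⟨q, rfl⟩
      obtain ⟨s, hs⟩ := this _ (hfk y hy) ((F.map (linePath f hf (k y))).map₀ p₀)
      exact ⟨s, fun _ => hs⟩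
    · obtain ⟨s⟩ := (F.obj y).nonempty
      exact ⟨s, fun h => absurd h hy⟩
  choose σ hσ using hex
  refine ⟨⟨U, σ, f, hf, p₀, k, isOpen_extChartAt_preimage' x hOo, ?_, hσ⟩,
    mem_extChartAt_source x, hOp⟩
  have hc : ContMDiffOn 𝓘(ℝ, E) 𝓘(ℝ, E) ∞ (extChartAt 𝓘(ℝ, E) x) U :=
    contMDiffOn_extChartAt.mono fun y hy => by simpa using hy.1
  exact hc.sub contMDiffOn_const

namespace LocalSection

variable {F} (s s' : F.LocalSection)

theorem param_coord {y : M} (hy : y ∈ s.dom) : s.param (s.coord y) = y :=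
  (congrArg Sigma.fst (s.point_sec y hy)).symm

/-- Transport compared with a local section is smooth. -/
theorem contMDiffOn_div_transport {x : M} (p : (F.obj x).X₀) {O : Set Z} (hO : IsOpen O)
    {y : Z → M} {γ : ∀ a, SmoothPath E x (y a)} (hγ : SmoothPathFamily O γ)
    (hy : ∀ a ∈ O, y a ∈ s.dom) :
    ContMDiffOn 𝓘(ℝ, Z) 𝓘(ℝ, EG) ∞
      (fun a => (F.obj (y a)).div ((F.map (γ a)).map₀ p) (s.sec (y a))) O := by
  intro a₀ ha₀
  refine ContMDiffAt.contMDiffWithinAt ?_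
  obtain ⟨ρ, hρ, hρO, hρ1⟩ := exists_contDiff_cutoff a₀ (hO.mem_nhds ha₀)
  have hγρ : SmoothPathFamily Set.univ fun a => γ (ρ a) :=
    ContMDiffOn.comp hγ ((hρ.comp contDiff_fst).prodMk contDiff_snd).contMDiff.contMDiffOn
      fun z _ => ⟨hρO z.1, trivial⟩
  have hyρ : ContMDiff 𝓘(ℝ, Z) 𝓘(ℝ, E) ∞ fun a => y (ρ a) := by
    have h1 := contMDiffOn_univ.1 (ContMDiffOn.comp hγρ
      (contDiff_id.prodMk (contDiff_const (c := (1 : ℝ)))).contMDiff.contMDiffOn (s := Set.univ)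
      fun z _ => ⟨trivial, trivial⟩)
    exact h1.congr fun a => ((γ (ρ a)).target le_rfl).symm
  have hk : ContMDiff 𝓘(ℝ, Z) 𝓘(ℝ, E) ∞ fun a => s.coord (y (ρ a)) :=
    contMDiffOn_univ.1 (s.contMDiffOn_coord.comp hyρ.contMDiffOn fun a _ => hy _ (hρO a))
  have hδ : SmoothPathFamily Set.univ fun a =>
      linePath s.param s.contMDiff_param (s.coord (y (ρ a))) :=
    ContMDiffOn.comp (g := fun z : E × ℝ => (linePath s.param s.contMDiff_param z.1).toFun z.2)
      (smoothPathFamily_linePath s.param s.contMDiff_param Set.univ)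
      ((hk.contDiff.comp contDiff_fst).prodMk contDiff_snd).contMDiff.contMDiffOn
      fun _ _ => ⟨trivial, trivial⟩
  -- With the end point generalized, substitution puts both families of paths over the same end
  -- points, so that `contMDiff_div_transport` applies.
  have hgen : ∀ (y' : Z → M), y' = (fun a => s.param (s.coord (y (ρ a)))) →
      ∀ (γ' : ∀ a, SmoothPath E x (y' a)) (σ : ∀ a, (F.obj (y' a)).X₀),
      SmoothPathFamily Set.univ γ' → (∀ a, F.point (y' a) (σ a) =
        F.point (s.param (s.coord (y (ρ a))))
          ((F.map (linePath s.param s.contMDiff_param (s.coord (y (ρ a))))).map₀ s.base)) →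
      ContMDiff 𝓘(ℝ, Z) 𝓘(ℝ, EG) ∞
        (fun a => (F.obj (y' a)).div ((F.map (γ' a)).map₀ p) (σ a)) := by
    rintro _ rfl γ' σ hγ' hσ
    have h1 : ∀ a, σ a = (F.map (linePath s.param s.contMDiff_param
        (s.coord (y (ρ a))))).map₀ s.base := fun a => eq_of_heq (Sigma.mk.inj (hσ a)).2
    simp only [h1]
    exact F.contMDiff_div_transport p s.base hγ' hδ (b := 2 / 3) (by norm_num)
      fun a v hv => linePath_of_ge _ _ _ hv
  have h := hgen (fun a => y (ρ a)) (funext fun a => (s.param_coord (hy _ (hρO a))).symm)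
    (fun a => γ (ρ a)) (fun a => s.sec (y (ρ a))) hγρ fun a => s.point_sec _ (hy _ (hρO a))
  refine h.contMDiffAt.congr_of_eventuallyEq ?_
  filter_upwards [hρ1] with a ha
  rw [ha, id]

/-- Two local sections differ smoothly. -/
theorem contMDiffOn_div [FiniteDimensional ℝ E] :
    ContMDiffOn 𝓘(ℝ, E) 𝓘(ℝ, EG) ∞ (fun y => (F.obj y).div (s.sec y) (s'.sec y))
      (s.dom ∩ s'.dom) := by
  have h := s'.contMDiffOn_div_transport s.base
    (s'.isOpen_dom.preimage s.contMDiff_param.continuous)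
    (smoothPathFamily_linePath s.param s.contMDiff_param _) fun a ha => ha
  have h1 := h.comp (s := s.dom ∩ s'.dom) (s.contMDiffOn_coord.mono Set.inter_subset_left)
    fun y hy => by
      change s.param (s.coord y) ∈ s'.dom
      rw [s.param_coord hy.1]
      exact hy.2
  refine h1.congr fun y hy => ?_
  exact congrArg (fun q : F.Total => (F.obj q.1).div q.2 (s'.sec q.1)) (s.point_sec y hy.1)

end LocalSection

end TransportTwoFunctor

end LocalSections

end

noncomputable section

/-! ### The smooth structure of the total space -/

section TotalSpace

variable {EG : Type*} [NormedAddCommGroup EG] [NormedSpace ℝ EG]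
  {EH : Type*} [NormedAddCommGroup EH] [NormedSpace ℝ EH]
  {G : Type*} [TopologicalSpace G] [ChartedSpace EG G] [Group G] [LieGroup 𝓘(ℝ, EG) ∞ G]
  {H : Type*} [TopologicalSpace H] [ChartedSpace EH H] [Group H] [LieGroup 𝓘(ℝ, EH) ∞ H]
  {C : SmoothCrossedModule EG EH G H}
  {E : Type*} [NormedAddCommGroup E] [NormedSpace ℝ E]
  {M : Type*} [TopologicalSpace M] [ChartedSpace E M]

namespace TransportTwoFunctor

variable {F : TransportTwoFunctor C E M}

namespace LocalSection

variable (s s' : F.LocalSection)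

/-- The coordinate in `G` of a point of the total space, with respect to a local section. -/
def ratio (q : F.Total) : G := (F.obj q.1).div q.2 (s.sec q.1)

theorem act_ratio (q : F.Total) : F.act (F.point q.1 (s.sec q.1)) (s.ratio q) = q :=
  congrArg (F.point q.1) (TwoTorsor.act₀_div _ _ _)

theorem ratio_act (q : F.Total) (g : G) : s.ratio (F.act q g) = s.ratio q * g :=
  F.div_act₀_left _ _ _

theorem ratio_sec (y : M) : s.ratio (F.point y (s.sec y)) = 1 :=
  TwoTorsor.div_eq _ (TwoTorsor.act₀_one _ _)

theorem ratio_sec_act (y : M) (g : G) : s.ratio (F.act (F.point y (s.sec y)) g) = g := by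
  rw [ratio_act, ratio_sec, one_mul]

/-- The chart of the total space given by a local section and charts of `M` and `G`. -/
def chart (x : M) (g : G) : PartialEquiv F.Total (E × EG) where
  toFun q := (chartAt E x q.1, chartAt EG g (s.ratio q))
  invFun z := F.act (F.point ((chartAt E x).symm z.1) (s.sec ((chartAt E x).symm z.1)))
    ((chartAt EG g).symm z.2)
  source := {q | q.1 ∈ s.dom ∧ q.1 ∈ (chartAt E x).source ∧ s.ratio q ∈ (chartAt EG g).source}
  target := {z | z.1 ∈ (chartAt E x).target ∧ (chartAt E x).symm z.1 ∈ s.dom ∧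
    z.2 ∈ (chartAt EG g).target}
  map_source' q hq := by
    refine ⟨(chartAt E x).map_source hq.2.1, ?_, (chartAt EG g).map_source hq.2.2⟩
    have h := (chartAt E x).left_inv hq.2.1
    change (chartAt E x).symm (chartAt E x q.1) ∈ s.dom
    rw [h]
    exact hq.1
  map_target' z hz := by
    refine ⟨hz.2.1, (chartAt E x).map_target hz.1, ?_⟩
    rw [ratio_sec_act]
    exact (chartAt EG g).map_target hz.2.2
  left_inv' q hq :=
    (congrArg₂ (fun y a => F.act (F.point y (s.sec y)) a) ((chartAt E x).left_inv hq.2.1)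
      ((chartAt EG g).left_inv hq.2.2)).trans (s.act_ratio q)
  right_inv' z hz := by
    refine Prod.ext ((chartAt E x).right_inv hz.1) ?_
    simp only [ratio_sec_act]
    exact (chartAt EG g).right_inv hz.2.2

/-- Up to charts of `M` and `G` the transition is `(y, a) ↦ (y, c y * a)`, where `c` is the smooth
quotient of the two sections. -/
theorem chart_transition [FiniteDimensional ℝ E] [IsManifold 𝓘(ℝ, E) ∞ M] (x x' : M) (g g' : G) :
    IsOpen ((s.chart x g).symm.trans (s'.chart x' g')).source ∧
    ContDiffOn ℝ ∞ ((s.chart x g).symm.trans (s'.chart x' g'))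
      ((s.chart x g).symm.trans (s'.chart x' g')).source := by
  have : IsManifold 𝓘(ℝ, EG) ∞ G := LieGroup.toContMDiffMul.toIsManifold
  let c : M → G := fun y => (F.obj y).div (s.sec y) (s'.sec y)
  let W : Set (E × EG) := {z | z.1 ∈ (chartAt E x).target ∧
    (chartAt E x).symm z.1 ∈ s.dom ∩ s'.dom ∧ z.2 ∈ (chartAt EG g).target}
  have hW : IsOpen W := by
    have h1 : IsOpen ((chartAt E x).target ∩ (chartAt E x).symm ⁻¹' (s.dom ∩ s'.dom)) :=
      (chartAt E x).isOpen_inter_preimage_symm (s.isOpen_dom.inter s'.isOpen_dom)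
    have h2 := h1.prod (chartAt EG g).open_target
    convert! h2 using 1
    ext z
    simp only [W, Set.mem_ofPred_eq, Set.mem_prod, Set.mem_inter_iff, Set.mem_preimage]
    tauto
  have hy : ContMDiffOn 𝓘(ℝ, E × EG) 𝓘(ℝ, E) ∞ (fun z : E × EG => (chartAt E x).symm z.1) W :=
    (contMDiffOn_chart_symm (x := x)).comp contDiff_fst.contMDiff.contMDiffOn fun z hz => hz.1
  have ha : ContMDiffOn 𝓘(ℝ, E × EG) 𝓘(ℝ, EG) ∞ (fun z : E × EG =>
      c ((chartAt E x).symm z.1) * (chartAt EG g).symm z.2) W :=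
    ((s.contMDiffOn_div s').comp hy fun z hz => hz.2.1).mul
      ((contMDiffOn_chart_symm (x := g)).comp contDiff_snd.contMDiff.contMDiffOn
        fun z hz => hz.2.2)
  have hr : ∀ z : E × EG, s'.ratio ((s.chart x g).symm z) =
      c ((chartAt E x).symm z.1) * (chartAt EG g).symm z.2 := fun z => s'.ratio_act _ _
  let m : E × EG → M × G := fun z => ((chartAt E x).symm z.1,
    c ((chartAt E x).symm z.1) * (chartAt EG g).symm z.2)
  have hs : ((s.chart x g).symm.trans (s'.chart x' g')).source =
      W ∩ m ⁻¹' ((chartAt E x').source ×ˢ (chartAt EG g').source) := by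
    ext z
    simp only [PartialEquiv.trans_source, Set.mem_inter_iff, Set.mem_preimage, Set.mem_prod, m, ← hr]
    simp only [W, chart, PartialEquiv.symm_source, Set.mem_ofPred_eq,
      Set.mem_inter_iff, act, point]
    tauto
  refine ⟨?_, ?_⟩
  · rw [hs]
    exact (hy.continuousOn.prodMk ha.continuousOn).isOpen_inter_preimage hW
      ((chartAt E x').open_source.prod (chartAt EG g').open_source)
  · rw [hs, ← contMDiffOn_iff_contDiffOn]
    have h1 := (contMDiffOn_chart (I := 𝓘(ℝ, E)) (n := ∞) (x := x')).comp
      (hy.mono Set.inter_subset_left) (s := W ∩ m ⁻¹' ((chartAt E x').source ×ˢ (chartAt EG g').source))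
      fun z hz => hz.2.1
    have h2 := (contMDiffOn_chart (I := 𝓘(ℝ, EG)) (n := ∞) (x := g')).comp
      (ha.mono Set.inter_subset_left) (s := W ∩ m ⁻¹' ((chartAt E x').source ×ˢ (chartAt EG g').source))
      fun z hz => hz.2.2
    refine (h1.prodMk_space h2).congr fun z hz => ?_
    refine Prod.ext rfl ?_
    exact congrArg (chartAt EG g') (hr z)

end LocalSection

variable (F)
variable [FiniteDimensional ℝ E] [IsManifold 𝓘(ℝ, E) ∞ M]

/-- The atlas of the total space consisting of the charts of all local sections. -/
def totalCore : ChartedSpaceCore (E × EG) F.Total where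
  atlas := {e | ∃ (s : F.LocalSection) (x : M) (g : G), e = s.chart x g}
  chartAt q := (F.exists_localSection q.1).choose.chart q.1
    ((F.exists_localSection q.1).choose.ratio q)
  mem_chart_source q := ⟨(F.exists_localSection q.1).choose_spec, mem_chart_source E q.1,
    mem_chart_source EG _⟩
  chart_mem_atlas q := ⟨_, _, _, rfl⟩
  open_source := by
    rintro _ _ ⟨s, x, g, rfl⟩ ⟨s', x', g', rfl⟩
    exact (s.chart_transition s' x x' g g').1
  continuousOn_toFun := by
    rintro _ _ ⟨s, x, g, rfl⟩ ⟨s', x', g', rfl⟩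
    exact (s.chart_transition s' x x' g g').2.continuousOn

/-- The total space of a transport 2-functor, as a manifold. -/
def SmoothTotal : Type _ := F.Total

instance : TopologicalSpace F.SmoothTotal := F.totalCore.toTopologicalSpace

instance : ChartedSpace (E × EG) F.SmoothTotal := F.totalCore.toChartedSpace

instance : IsManifold 𝓘(ℝ, E × EG) ∞ F.SmoothTotal := by
  refine isManifold_of_contDiffOn _ _ _ fun e e' he he' => ?_
  obtain ⟨e₀, h⟩ := Set.mem_iUnion.1 he
  obtain ⟨⟨s, x, g, rfl⟩, rfl⟩ := Set.mem_iUnion.1 h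
  obtain ⟨e₀', h'⟩ := Set.mem_iUnion.1 he'
  obtain ⟨⟨s', x', g', rfl⟩, rfl⟩ := Set.mem_iUnion.1 h'
  have h1 := (s.chart_transition s' x x' g g').2
  exact h1.mono Set.inter_subset_left

variable {F}

namespace LocalSection

variable (s : F.LocalSection)

/-- The charts of the total space. -/
def homeo (x : M) (g : G) : OpenPartialHomeomorph F.SmoothTotal (E × EG) :=
  F.totalCore.openPartialHomeomorph (s.chart x g) ⟨s, x, g, rfl⟩

theorem homeo_mem_maximalAtlas (x : M) (g : G) :
    s.homeo x g ∈ IsManifold.maximalAtlas 𝓘(ℝ, E × EG) ∞ F.SmoothTotal :=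
  IsManifold.subset_maximalAtlas (Set.mem_iUnion₂.2 ⟨s.chart x g, ⟨s, x, g, rfl⟩, rfl⟩)

/-- Near `q` these are the components of a chart followed by inverse charts of `M` and `G`. -/
theorem contMDiffAt_proj_ratio {q : F.SmoothTotal} (hq : q.1 ∈ s.dom) :
    ContMDiffAt 𝓘(ℝ, E × EG) 𝓘(ℝ, E) ∞ (fun q : F.SmoothTotal => q.1) q ∧
    ContMDiffAt 𝓘(ℝ, E × EG) 𝓘(ℝ, EG) ∞ (fun q : F.SmoothTotal => s.ratio q) q := by
  have : IsManifold 𝓘(ℝ, EG) ∞ G := LieGroup.toContMDiffMul.toIsManifold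
  let e := s.homeo q.1 (s.ratio q)
  have hqs : q ∈ e.source := ⟨hq, mem_chart_source E q.1, mem_chart_source EG _⟩
  have he : ContMDiffAt 𝓘(ℝ, E × EG) 𝓘(ℝ, E × EG) ∞ e q :=
    (contMDiffOn_of_mem_maximalAtlas (s.homeo_mem_maximalAtlas q.1 (s.ratio q))).contMDiffAt
      (e.open_source.mem_nhds hqs)
  constructor
  · have h1 : ContMDiffAt 𝓘(ℝ, E) 𝓘(ℝ, E) ∞ (chartAt E q.1).symm (e q).1 :=
      (contMDiffOn_chart_symm (x := q.1)).contMDiffAt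
        ((chartAt E q.1).open_target.mem_nhds ((chartAt E q.1).map_source hqs.2.1))
    have h2 := h1.comp q (contDiff_fst.contMDiff.contMDiffAt.comp q he)
    refine h2.congr_of_eventuallyEq ?_
    filter_upwards [e.open_source.mem_nhds hqs] with q' hq'
    exact ((chartAt E q.1).left_inv hq'.2.1).symm
  · have h1 : ContMDiffAt 𝓘(ℝ, EG) 𝓘(ℝ, EG) ∞ (chartAt EG (s.ratio q)).symm (e q).2 :=
      (contMDiffOn_chart_symm (x := s.ratio q)).contMDiffAt
        ((chartAt EG (s.ratio q)).open_target.mem_nhds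
          ((chartAt EG (s.ratio q)).map_source hqs.2.2))
    have h2 := h1.comp q (contDiff_snd.contMDiff.contMDiffAt.comp q he)
    refine h2.congr_of_eventuallyEq ?_
    filter_upwards [e.open_source.mem_nhds hqs] with q' hq'
    exact ((chartAt EG (s.ratio q)).left_inv hq'.2.2).symm

/-- A map to the total space is smooth if its projection and its coordinate in `G` are. -/
theorem contMDiffAt_of_ratio {V : Type*} [NormedAddCommGroup V] [NormedSpace ℝ V]
    {K : Type*} [TopologicalSpace K] {I : ModelWithCorners ℝ V K}
    {N : Type*} [TopologicalSpace N] [ChartedSpace K N] {f : N → F.SmoothTotal} {n : N}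
    (hn : (f n).1 ∈ s.dom) (hp : ContMDiffAt I 𝓘(ℝ, E) ∞ (fun n => (f n).1) n)
    (hr : ContMDiffAt I 𝓘(ℝ, EG) ∞ (fun n => s.ratio (f n)) n) :
    ContMDiffAt I 𝓘(ℝ, E × EG) ∞ f n := by
  have : IsManifold 𝓘(ℝ, EG) ∞ G := LieGroup.toContMDiffMul.toIsManifold
  let e := s.homeo (f n).1 (s.ratio (f n))
  have hns : f n ∈ e.source := ⟨hn, mem_chart_source E _, mem_chart_source EG _⟩
  have h1 := ((contMDiffOn_chart (I := 𝓘(ℝ, E)) (n := ∞) (x := (f n).1)).contMDiffAt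
    ((chartAt E (f n).1).open_source.mem_nhds hns.2.1)).comp n hp
  have h2 := ((contMDiffOn_chart (I := 𝓘(ℝ, EG)) (n := ∞) (x := s.ratio (f n))).contMDiffAt
    ((chartAt EG (s.ratio (f n))).open_source.mem_nhds hns.2.2)).comp n hr
  have h3 : ContMDiffAt I 𝓘(ℝ, E × EG) ∞ (fun n => e (f n)) n := h1.prodMk_space h2
  have h4 : ContMDiffAt 𝓘(ℝ, E × EG) 𝓘(ℝ, E × EG) ∞ e.symm (e (f n)) :=
    (contMDiffOn_symm_of_mem_maximalAtlas
      (s.homeo_mem_maximalAtlas (f n).1 (s.ratio (f n)))).contMDiffAt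
      (e.open_target.mem_nhds (e.map_source hns))
  refine (h4.comp n h3).congr_of_eventuallyEq ?_
  filter_upwards [hp.continuousAt.preimage_mem_nhds (s.isOpen_dom.mem_nhds hn),
    hp.continuousAt.preimage_mem_nhds ((chartAt E (f n).1).open_source.mem_nhds hns.2.1),
    hr.continuousAt.preimage_mem_nhds ((chartAt EG (s.ratio (f n))).open_source.mem_nhds hns.2.2)]
    with n' a1 a2 a3
  exact (e.left_inv (show f n' ∈ e.source from ⟨a1, a2, a3⟩)).symm

end LocalSection

variable (F)

/-- While the end point stays in the domain of a local section, the coordinate in `G` is the one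
treated in `contMDiffOn_div_transport`. -/
theorem contMDiffOn_transport (x : M) (p : (F.obj x).X₀) (n : ℕ)
    (U : Set (EuclideanSpace ℝ (Fin n))) (hU : IsOpen U)
    (y : EuclideanSpace ℝ (Fin n) → M) (γ : ∀ a, SmoothPath E x (y a))
    (hγ : ContMDiffOn 𝓘(ℝ, EuclideanSpace ℝ (Fin n) × ℝ) 𝓘(ℝ, E) ∞
      (fun z : EuclideanSpace ℝ (Fin n) × ℝ => (γ z.1).toFun z.2) (U ×ˢ Set.univ)) :
    ContMDiffOn (M' := F.SmoothTotal) 𝓘(ℝ, EuclideanSpace ℝ (Fin n)) 𝓘(ℝ, E × EG) ∞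
      (fun a => F.point (y a) ((F.map (γ a)).map₀ p)) U := by
  intro a₀ ha₀
  obtain ⟨s, hs⟩ := F.exists_localSection (y a₀)
  have hy : ContMDiffOn 𝓘(ℝ, EuclideanSpace ℝ (Fin n)) 𝓘(ℝ, E) ∞ y U := by
    have h1 := hγ.comp (contDiff_id.prodMk (contDiff_const (c := (1 : ℝ)))).contMDiff.contMDiffOn
      (s := U) fun z hz => ⟨hz, trivial⟩
    exact h1.congr fun a _ => ((γ a).target le_rfl).symm
  have hO : IsOpen (U ∩ y ⁻¹' s.dom) := hy.continuousOn.isOpen_inter_preimage hU s.isOpen_dom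
  have h2 := s.contMDiffOn_div_transport p hO
    (ContMDiffOn.mono hγ (Set.prod_mono Set.inter_subset_left subset_rfl)) fun a ha => ha.2
  refine ContMDiffAt.contMDiffWithinAt (s.contMDiffAt_of_ratio
    (f := fun a => F.point (y a) ((F.map (γ a)).map₀ p)) hs
    (hy.contMDiffAt (hU.mem_nhds ha₀)) ?_)
  exact h2.contMDiffAt (hO.mem_nhds ⟨ha₀, hs⟩)

/-- The total space of a transport 2-functor is a smooth principal bundle. -/
theorem nonempty_bundle : Nonempty F.Bundle := by
  choose s hs using F.exists_localSection
  have hproj : ContMDiff 𝓘(ℝ, E × EG) 𝓘(ℝ, E) ∞ (fun p : F.SmoothTotal => p.1) := fun p =>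
    ((s p.1).contMDiffAt_proj_ratio (hs p.1)).1
  have hact : ContMDiff (M' := F.SmoothTotal) (𝓘(ℝ, E × EG).prod 𝓘(ℝ, EG)) 𝓘(ℝ, E × EG) ∞
      (fun z : F.SmoothTotal × G => F.act z.1 z.2) := by
    intro z
    refine (s z.1.1).contMDiffAt_of_ratio (hs z.1.1)
      (hproj.comp (contMDiff_fst (N := G))).contMDiffAt ?_
    have h1 := ((s z.1.1).contMDiffAt_proj_ratio (q := z.1) (hs z.1.1)).2
    have h2 := (ContMDiffAt.comp (I' := 𝓘(ℝ, E × EG)) z h1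
      (contMDiffAt_fst (I := 𝓘(ℝ, E × EG)) (J := 𝓘(ℝ, EG)) (M := F.SmoothTotal) (N := G))).mul
      contMDiffAt_snd
    exact h2.congr_of_eventuallyEq (Filter.Eventually.of_forall fun z =>
      (s _).ratio_act z.1 z.2)
  have hsec : ∀ x₀, ContMDiffOn (M' := F.SmoothTotal) 𝓘(ℝ, E) 𝓘(ℝ, E × EG) ∞
      (fun y => F.point y ((s x₀).sec y)) (s x₀).dom := fun x₀ y hy => by
    refine ContMDiffAt.contMDiffWithinAt ((s x₀).contMDiffAt_of_ratio
      (f := fun y => F.point y ((s x₀).sec y)) hy contMDiffAt_id ?_)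
    simp only [LocalSection.ratio_sec]
    exact contMDiffAt_const
  have hratio : ∀ x₀, ContMDiffOn 𝓘(ℝ, E × EG) 𝓘(ℝ, EG) ∞
      (fun q : F.SmoothTotal => (s x₀).ratio q) {q | q.1 ∈ (s x₀).dom} := fun x₀ q hq =>
    ((s x₀).contMDiffAt_proj_ratio (q := q) hq).2.contMDiffWithinAt
  exact ⟨{
    top := inferInstanceAs (TopologicalSpace F.SmoothTotal)
    charted := inferInstanceAs (ChartedSpace (E × EG) F.SmoothTotal)
    isManifold := inferInstanceAs (IsManifold 𝓘(ℝ, E × EG) ∞ F.SmoothTotal)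
    smooth_proj := hproj
    smooth_act := hact
    local_triv := fun x₀ =>
      ⟨(s x₀).dom, (s x₀).sec, (s x₀).isOpen_dom, hs x₀, hsec x₀, hratio x₀⟩
    smooth_transport := F.contMDiffOn_transport }⟩

end TransportTwoFunctor

end TotalSpace

end

theorem mainTheorem6
    {EG : Type*} [NormedAddCommGroup EG] [NormedSpace ℝ EG] [FiniteDimensional ℝ EG]
    {EH : Type*} [NormedAddCommGroup EH] [NormedSpace ℝ EH] [FiniteDimensional ℝ EH]
    {G : Type*} [TopologicalSpace G] [ChartedSpace EG G] [Group G] [LieGroup 𝓘(ℝ, EG) ∞ G]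
    {H : Type*} [TopologicalSpace H] [ChartedSpace EH H] [Group H] [LieGroup 𝓘(ℝ, EH) ∞ H]
    (C : SmoothCrossedModule EG EH G H)
    {E : Type*} [NormedAddCommGroup E] [NormedSpace ℝ E] [FiniteDimensional ℝ E]
    {M : Type*} [TopologicalSpace M] [T2Space M] [ChartedSpace E M] [IsManifold 𝓘(ℝ, E) ∞ M]
    (F : TransportTwoFunctor C E M) :
    Nonempty F.Bundle ∧ ∀ P : F.Bundle,
      (∃! A : P.OneForm, P.IsTransportConnection A) ∧
      (∃! B : P.TwoForm, P.IsTransportTwoForm B) ∧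
      ∀ (A : P.OneForm) (B : P.TwoForm), P.IsTransportConnection A → P.IsTransportTwoForm B →
        P.IsConnection A ∧
        SmoothTwoForm B ∧
        (∀ (p : P.Space) (X Y : TangentSpace 𝓘(ℝ, E × EG) p),
          C.tStar (B p ![X, Y]) = P.curvature A p X Y) ∧
        (∀ g : P.Space → G, ContMDiff 𝓘(ℝ, E × EG) 𝓘(ℝ, EG) ∞ g → P.PullbackEq B g) := by
  -- Completeness enters through the integrals in Hadamard's lemma.
  have : CompleteSpace EH := FiniteDimensional.complete ℝ EH
  exact ⟨F.nonempty_bundle, fun P => ⟨P.existsUnique_isTransportConnection,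
    P.existsUnique_isTransportTwoForm, fun A B hA hB => ⟨hA.isConnection, hB.smoothTwoForm,
      TransportTwoFunctor.Bundle.IsTransportTwoForm.tStar_eq_curvature hA hB,
      fun g hg => hB.pullbackEq hg⟩⟩⟩
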